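/- **Setting.** Let $d\ge 2$ and let $|\cdot|$ be the Euclidean norm. Let $(\Omega,\mathscr F,\mathbb P)$ be a probability space and $\{\tau_x\}_{x\in\mathbb Z^d}$ a group of measurable transformations of $\Omega$ ($\tau_0=\mathrm{id}$, $\tau_{x+y}=\tau_x\circ\tau_y$) that preserves $\mathbb P$ and is ergodic. Let $\{C_{x,y}\}_{x,y\in\mathbb Z^d}$ be non-negative random variables with $C_{x,y}(\omega)=C_{y,x}(\omega)$ and $C_{x+z,y+z}(\omega)=C_{x,y}(\tau_z\omega)$ for all $x,y,z\in\mathbb Z^d$, $\omega\in\Omega$, and such that almost surely $0<\sum_{y}C_{x,y}<\infty$ for every $x$. **The corrector.** Let $L^2_{\rm cov}$ be the space of random fields $\psi:\mathbb Z^d\times\Omega\to\mathbb R$ with $\psi(x+z,\omega)-\psi(x,\omega)=\psi(z,\tau_x\omega)$ for all $x,z,\omega$ and $\|\psi\|_{L^2_{\rm cov}}^2:=\mathbb E\big[\sum_{x}\psi(x,\omega)^2C_{0,x}(\omega)\big]<\infty$. Let $L^2_{\rm pot}$ be the closure in $L^2_{\rm cov}$ of the gradients $D\varphi(z,\omega)=\varphi(\tau_z\omega)-\varphi(\omega)$,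 $\varphi\in L^\infty(\Omega;\mathbb P)$. A corrector is a minimizer $\chi:\mathbb Z^d\times\Omega\to\mathbb R^d$ of $$\tilde\chi\mapsto\mathbb E\Big[\sum_{z\in\mathbb Z^d}|z+\tilde\chi(z,\omega)|^2C_{0,z}(\omega)\Big]$$ over all $\tilde\chi$ whose $d$ components belong to $L^2_{\rm pot}$. **Theorem.** Suppose that for some $p,q\in(1,\infty]$ with $\frac1p+\frac1q<\frac2d$, $$\tilde\mu:=\sum_{z\in\mathbb Z^d}|z|^2C_{0,z}\in L^p(\Omega;\mathbb P),\qquad \tilde\nu:=\sum_{|z|=1}\frac1{C_{0,z}}\in L^q(\Omega;\mathbb P)$$ (with $1/0=\infty$), and that for the same $p$, $$\tilde\mu_*:=\sum_{z\in\mathbb Z^d}|z|^{\frac{d(p-1)+4p}{1+p}}\,C_{0,z}^{\frac{2p}{p+1}}\in L^{\frac{p+1}{2}}(\Omega;\mathbb P),$$ where for $p=\infty$ the three exponents are understood as their limits $d+4$, $2$ and $\infty$. Then a corrector exists, and every corrector $\chi$ is sublinear everywhere: $$\lim_{n\to\infty}\frac1n\sup_{x\in\mathbb Z^d,\ |x|\le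 n}|\chi(x,\omega)|=0\qquad\text{for }\mathbb P\text{-a.e. }\omega.$$ -/

import Mathlib

open MeasureTheory Filter Topology
open scoped ENNReal

noncomputable section

namespace RandomConductance

/-- The lattice `ℤ^d`. -/
abbrev Zd (d : ℕ) : Type := Fin d → ℤ

/-- The inclusion of `ℤ^d` into Euclidean space `ℝ^d`. -/
def toEuc {d : ℕ} (z : Zd d) : EuclideanSpace ℝ (Fin d) :=
  WithLp.toLp 2 fun i => (z i : ℝ)

/-- The ball `B_n = {x ∈ ℤ^d : |x| ≤ n}`, with `|x|` the Euclidean norm. -/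
def ball (d n : ℕ) : Set (Zd d) := {x | ‖toEuc x‖ ≤ (n : ℝ)}

section Environment

variable {d : ℕ} {Ω : Type*} [MeasurableSpace Ω] [AddAction (Zd d) Ω]

/-- Stationary symmetric random conductances; `x +ᵥ ω` is the shifted environment `τ_x ω`. -/
structure IsConductance (P : Measure Ω) (C : Zd d → Zd d → Ω → ℝ) : Prop where
  measurable : ∀ x y, Measurable (C x y)
  nonneg : ∀ x y ω, 0 ≤ C x y ω
  symm : ∀ x y ω, C x y ω = C y x ω
  shift : ∀ x y z ω, C (x + z) (y + z) ω = C x y (z +ᵥ ω)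
  /-- Almost surely `0 < π_x = ∑_y C_{x,y} < ∞` for every `x`. -/
  total : ∀ᵐ ω ∂P, ∀ x, (0 < ∑' y, ENNReal.ofReal (C x y ω)) ∧
    (∑' y, ENNReal.ofReal (C x y ω)) < ∞

/-- `μ̃ = ∑_z |z|² C_{0,z}`, with values in `[0,∞]`. -/
def muTilde (C : Zd d → Zd d → Ω → ℝ) (ω : Ω) : ℝ≥0∞ :=
  ∑' z, ENNReal.ofReal (‖toEuc z‖ ^ 2 * C 0 z ω)

/-- `ν̃ = ∑_{|z| = 1} 1 / C_{0,z}`, with values in `[0,∞]` and `1 / 0 = ∞`. -/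
def nuTilde (C : Zd d → Zd d → Ω → ℝ) (ω : Ω) : ℝ≥0∞ :=
  ∑' z : {z : Zd d // ‖toEuc z‖ = 1}, (ENNReal.ofReal (C 0 z ω))⁻¹

/-- The exponent `(d (p - 1) + 4 p) / (1 + p)`; its limit `d + 4` if `p = ∞`. -/
def starWeight (d : ℕ) (p : ℝ≥0∞) : ℝ :=
  if p = ∞ then d + 4 else (d * (p.toReal - 1) + 4 * p.toReal) / (1 + p.toReal)

/-- The exponent `2 p / (p + 1)`; its limit `2` if `p = ∞`. -/
def starPower (p : ℝ≥0∞) : ℝ :=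
  if p = ∞ then 2 else 2 * p.toReal / (p.toReal + 1)

/-- `μ̃_* = ∑_z |z| ^ ((d (p - 1) + 4 p) / (1 + p)) C_{0,z} ^ (2 p / (p + 1))`. -/
def muStar (p : ℝ≥0∞) (C : Zd d → Zd d → Ω → ℝ) (ω : Ω) : ℝ≥0∞ :=
  ∑' z, ENNReal.ofReal (‖toEuc z‖ ^ starWeight d p * C 0 z ω ^ starPower p)

/-- The squared norm `E[∑_x ψ(x,ω)² C_{0,x}(ω)]`, with values in `[0,∞]`. -/
def covNormSq (P : Measure Ω) (C : Zd d → Zd d → Ω → ℝ)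
    (ψ : Zd d → Ω → ℝ) : ℝ≥0∞ :=
  ∫⁻ ω, ∑' x, ENNReal.ofReal (ψ x ω ^ 2 * C 0 x ω) ∂P

/-- Membership in `L²_cov`: shift-covariant random fields with finite norm. -/
structure IsCov (P : Measure Ω) (C : Zd d → Zd d → Ω → ℝ)
    (ψ : Zd d → Ω → ℝ) : Prop where
  aemeasurable : ∀ x, AEMeasurable (ψ x) P
  cocycle : ∀ x z ω, ψ (x + z) ω - ψ x ω = ψ z (x +ᵥ ω)
  norm_lt_top : covNormSq P C ψ < ∞

/-- The gradient `Dφ(z,ω) = φ(τ_z ω) - φ(ω)`. -/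
def grad (φ : Ω → ℝ) (z : Zd d) (ω : Ω) : ℝ := φ (z +ᵥ ω) - φ ω

/-- Membership in `L²_pot`, the closure in `L²_cov` of the gradients of functions in `L^∞`. -/
structure IsPot (P : Measure Ω) (C : Zd d → Zd d → Ω → ℝ)
    (ψ : Zd d → Ω → ℝ) : Prop where
  isCov : IsCov P C ψ
  approx : ∀ ε : ℝ≥0∞, 0 < ε →
    ∃ φ : Ω → ℝ, MemLp φ ∞ P ∧ covNormSq P C (fun x ω => ψ x ω - grad φ x ω) < ε

/-- The functional `E[∑_z |z + χ(z,ω)|² C_{0,z}(ω)]` that the corrector minimizes. -/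
def energy (P : Measure Ω) (C : Zd d → Zd d → Ω → ℝ)
    (χ : Zd d → Ω → EuclideanSpace ℝ (Fin d)) : ℝ≥0∞ :=
  ∫⁻ ω, ∑' z, ENNReal.ofReal (‖toEuc z + χ z ω‖ ^ 2 * C 0 z ω) ∂P

/-- `χ` is (a version of) the corrector: a minimizer of the energy over the random fields
all of whose `d` components belong to `L²_pot`. -/
structure IsCorrector (P : Measure Ω) (C : Zd d → Zd d → Ω → ℝ)
    (χ : Zd d → Ω → EuclideanSpace ℝ (Fin d)) : Prop where
  isPot : ∀ i, IsPot P C fun x ω => χ x ω i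
  minimal : ∀ χ' : Zd d → Ω → EuclideanSpace ℝ (Fin d),
    (∀ i, IsPot P C fun x ω => χ' x ω i) → energy P C χ ≤ energy P C χ'

end Environment

end RandomConductance

end

set_option linter.unusedSectionVars false

namespace RandomConductance

/-! Each component of a corrector is the orthogonal projection, in the weighted space L²(Ω × ℤ^d),
of minus a coordinate function onto the closure of the gradients. Orthogonality to all gradients,
together with stationarity and symmetry, says that x_i + χ_i is almost surely harmonic
(`IsCorrector.ae_hasSum_zero`). Membership in the closure says that χ_i differs from a bounded
function by a field of arbitrarily small Dirichlet energy per site (`IsPot.ae_exists_approx`). A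
maximal inequality for the shifts (`mul_measure_maximal_le`) turns the moment assumptions into
bounds on averages over all cubes for almost every ω (`ae_exists_hasMomentBounds`).

For a frozen environment the rest is deterministic. The averages of ν^q give a Sobolev–Poincaré
inequality for the nearest-neighbour energy (`exists_sum_cube_sub_rpow_le`), proved by telescoping
box averages over dyadic scales. Only exponents t strictly below the critical one are needed, so a
geometric series replaces the endpoint argument. Applied to χ_i minus a bounded function, the
inequality gives sublinearity in the averaged ℓ^t sense (`exists_forall_sum_cube_rpow_le`).

De Giorgi iteration upgrades this to a pointwise bound. Testing harmonicity with a cutoff of the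
truncation (χ_i - k)₊ gives a Caccioppoli estimate (`sum_edgeEnergy_cutoff_le`). Jumps shorter than
the cutoff width are paid for by μ̃. Longer jumps see the function far away, where only its averaged
growth is known; Hölder's inequality against that growth produces exactly the weight and power in
μ̃_* (`exists_sum_long_jump_le`). Hölder's inequality with μ̃, μ̃_*^{(p+1)/(2p)} ∈ L^p costs the
integrability exponent 2p/(p-1), and Sobolev gains an exponent t. The condition 1/p + 1/q < 2/d is
what leaves room for t > 2p/(p-1), so one step is superlinear in the excess (`exists_excess_le`) and
the excess tends to zero along shrinking balls and rising levels. -/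

/-! ### Box averages and a subcritical Sobolev–Poincaré inequality on ℤ^d -/

/-- The box `[0, N)^d`. -/
noncomputable def box (d N : ℕ) : Finset (Zd d) := Fintype.piFinset fun _ => Finset.Ico 0 (N : ℤ)

lemma mem_box {d N : ℕ} {y : Zd d} : y ∈ box d N ↔ ∀ i, 0 ≤ y i ∧ y i < N := by
  simp [box]

lemma card_box (d N : ℕ) : (box d N).card = N ^ d := by
  simp [box]

/-- The `ℓ¹` norm of the discrete gradient. -/
noncomputable def gradNorm {d : ℕ} (g : Zd d → ℝ) (x : Zd d) : ℝ :=
  ∑ i, |g (x + Pi.single i 1) - g x|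

lemma gradNorm_nonneg {d : ℕ} (g : Zd d → ℝ) (x : Zd d) : 0 ≤ gradNorm g x :=
  Finset.sum_nonneg fun _ _ => abs_nonneg _

lemma sum_box_shift_le {d : ℕ} {F : Zd d → ℝ} (hF : ∀ x, 0 ≤ F x) {N : ℕ} (x z : Zd d)
    {S : Finset (Zd d)} (hS : ∀ y ∈ box d N, z + y ∈ S) :
    ∑ y ∈ box d N, F (x + z + y) ≤ ∑ w ∈ S, F (x + w) := by
  have : ∑ y ∈ box d N, F (x + z + y) = ∑ w ∈ (box d N).map (addLeftEmbedding z), F (x + w) := by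
    simp [Finset.sum_map, add_assoc]
  rw [this]
  refine Finset.sum_le_sum_of_subset_of_nonneg ?_ fun _ _ _ => hF _
  intro w hw
  obtain ⟨y, hy, rfl⟩ := Finset.mem_map.1 hw
  exact hS y hy

/-- The translation by z is decomposed into n unit steps. Every intermediate box stays inside x +
[0, 2N)^d, so each step costs at most one full gradient sum. -/
lemma sum_box_sub_le_aux {d : ℕ} (g : Zd d → ℝ) (N : ℕ) (x : Zd d) (n : ℕ) :
    ∀ z : Zd d, (∀ i, 0 ≤ z i ∧ z i ≤ N) → ∑ i, z i = n →
    ∑ y ∈ box d N, |g (x + z + y) - g (x + y)| ≤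
      n * ∑ w ∈ box d (2 * N), gradNorm g (x + w) := by
  induction n with
  | zero =>
    intro z hz hs
    have : z = 0 := by
      funext i
      have := (Finset.sum_eq_zero_iff_of_nonneg fun i _ => (hz i).1).1 (by simpa using hs)
      simpa using this i (Finset.mem_univ i)
    simp [this]
  | succ n ih =>
    intro z hz hs
    obtain ⟨i, hi⟩ : ∃ i, 0 < z i := by
      by_contra! h
      have := Finset.sum_nonpos fun i (_ : i ∈ Finset.univ) => h i
      omega
    set z' : Zd d := z - Pi.single i 1 with hz'
    have hz1 : z = z' + Pi.single i 1 := by simp [hz']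
    have hzj : ∀ j, 0 ≤ z' j ∧ z' j ≤ N := by
      intro j
      by_cases hj : j = i
      · subst hj; have := hz j; simp [hz']; omega
      · simpa [hz', hj] using hz j
    have hsum : ∑ j, z' j = n := by
      have : ∑ j, z j = ∑ j, z' j + 1 := by
        rw [hz1]; simp [Finset.sum_add_distrib]
      push_cast at hs; omega
    have h1 := ih z' hzj hsum
    have h2 : ∑ y ∈ box d N, |g (x + z + y) - g (x + z' + y)| ≤
        ∑ w ∈ box d (2 * N), gradNorm g (x + w) := by
      refine le_trans ?_ (sum_box_shift_le (gradNorm_nonneg g) (N := N) x z' ?_)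
      · refine Finset.sum_le_sum fun y _ => ?_
        have : x + z + y = x + z' + y + Pi.single i 1 := by rw [hz1]; abel
        rw [this]
        exact Finset.single_le_sum (f := fun i => |g (x + z' + y + Pi.single i 1) - g (x + z' + y)|)
          (fun _ _ => abs_nonneg _) (Finset.mem_univ i)
      · intro y hy
        rw [mem_box] at hy ⊢
        intro j
        have := hy j; have := hzj j
        simp only [Pi.add_apply]; push_cast; omega
    calc ∑ y ∈ box d N, |g (x + z + y) - g (x + y)|
        ≤ ∑ y ∈ box d N, (|g (x + z + y) - g (x + z' + y)| + |g (x + z' + y) - g (x + y)|) :=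
          Finset.sum_le_sum fun y _ => abs_sub_le _ _ _
      _ ≤ _ := by
          rw [Finset.sum_add_distrib]; push_cast; linarith

lemma sum_box_sub_le {d : ℕ} (g : Zd d → ℝ) (N : ℕ) (x z : Zd d)
    (hz : ∀ i, 0 ≤ z i ∧ z i ≤ N) :
    ∑ y ∈ box d N, |g (x + z + y) - g (x + y)| ≤
      d * N * ∑ w ∈ box d (2 * N), gradNorm g (x + w) := by
  have h0 : 0 ≤ ∑ i, z i := Finset.sum_nonneg fun i _ => (hz i).1
  have h1 : ∑ i, z i ≤ d * N := by
    refine (Finset.sum_le_sum fun i _ => (hz i).2).trans ?_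
    simp
  obtain ⟨n, hn⟩ := Int.eq_ofNat_of_zero_le h0
  refine (sum_box_sub_le_aux g N x n z hz hn).trans ?_
  refine mul_le_mul_of_nonneg_right ?_ (Finset.sum_nonneg fun _ _ => gradNorm_nonneg _ _)
  rw [hn] at h1
  exact_mod_cast h1

/-- The average of `g` over `x + [0, N)^d`. -/
noncomputable def boxAvg {d : ℕ} (N : ℕ) (g : Zd d → ℝ) (x : Zd d) : ℝ :=
  ((N : ℝ) ^ d)⁻¹ * ∑ y ∈ box d N, g (x + y)

lemma boxAvg_one {d : ℕ} (g : Zd d → ℝ) (x : Zd d) : boxAvg 1 g x = g x := by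
  have : box d 1 = {0} := by
    ext y; rw [mem_box, Finset.mem_singleton]
    constructor
    · intro h; funext i; have := h i; simp only [Pi.zero_apply]; push_cast at this; omega
    · rintro rfl i; simp
  simp [boxAvg, this]

lemma abs_boxAvg_add_sub_le {d : ℕ} (g : Zd d → ℝ) (N : ℕ) (x z : Zd d)
    (hz : ∀ i, 0 ≤ z i ∧ z i ≤ N) :
    |boxAvg N g (x + z) - boxAvg N g x| ≤
      ((N : ℝ) ^ d)⁻¹ * (d * N * ∑ w ∈ box d (2 * N), gradNorm g (x + w)) := by
  unfold boxAvg
  rw [← mul_sub, ← Finset.sum_sub_distrib, abs_mul, abs_of_nonneg (by positivity)]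
  gcongr
  exact (Finset.abs_sum_le_sum_abs _ _).trans (sum_box_sub_le g N x z hz)

/-- Going from x + y to x + z through x + y + z splits the difference into two translations of a
whole box, to which `sum_box_sub_le` applies. -/
lemma sum_sum_box_le {d : ℕ} (g : Zd d → ℝ) (N : ℕ) (x : Zd d) :
    ∑ y ∈ box d N, ∑ z ∈ box d N, |g (x + y) - g (x + z)| ≤
      2 * (N : ℝ) ^ d * (d * N * ∑ w ∈ box d (2 * N), gradNorm g (x + w)) := by
  set G := d * N * ∑ w ∈ box d (2 * N), gradNorm g (x + w)
  have key : ∑ z ∈ box d N, ∑ y ∈ box d N, |g (x + z + y) - g (x + y)| ≤ (N : ℝ) ^ d * G := by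
    refine (Finset.sum_le_card_nsmul _ _ G fun z hz => ?_).trans (by simp [card_box])
    refine sum_box_sub_le g N x z fun i => ?_
    have := mem_box.1 hz i
    omega
  calc ∑ y ∈ box d N, ∑ z ∈ box d N, |g (x + y) - g (x + z)|
      ≤ ∑ y ∈ box d N, ∑ z ∈ box d N,
          (|g (x + y + z) - g (x + z)| + |g (x + z + y) - g (x + y)|) := by
        refine Finset.sum_le_sum fun y _ => Finset.sum_le_sum fun z _ => ?_
        rw [add_right_comm x z y, add_comm |g (x + y + z) - g (x + z)|,
          abs_sub_comm (g (x + y + z)) (g (x + y))]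
        exact abs_sub_le _ _ _
    _ = ∑ z ∈ box d N, ∑ y ∈ box d N, |g (x + z + y) - g (x + y)| +
        ∑ z ∈ box d N, ∑ y ∈ box d N, |g (x + z + y) - g (x + y)| := by
        simp_rw [Finset.sum_add_distrib]
        congr 1
        exact Finset.sum_comm
    _ ≤ _ := by linarith

/-- The difference of two averages is a double average of differences, and the small box lies in the
large one. -/
lemma abs_boxAvg_double_sub_le {d : ℕ} (g : Zd d → ℝ) {L : ℕ} (hL : 0 < L) (x : Zd d) :
    |boxAvg (2 * L) g x - boxAvg L g x| ≤
      4 * d * (((L : ℝ) ^ d)⁻¹ * L) * ∑ w ∈ box d (4 * L), gradNorm g (x + w) := by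
  have hL' : (0 : ℝ) < (L : ℝ) ^ d := by positivity
  have hL2 : (0 : ℝ) < ((2 * L : ℕ) : ℝ) ^ d := by positivity
  have e : boxAvg (2 * L) g x - boxAvg L g x = (((2 * L : ℕ) : ℝ) ^ d)⁻¹ * ((L : ℝ) ^ d)⁻¹ *
      ∑ y ∈ box d (2 * L), ∑ z ∈ box d L, (g (x + y) - g (x + z)) := by
    simp only [boxAvg, Finset.sum_sub_distrib, Finset.sum_const, card_box, nsmul_eq_mul,
      ← Finset.mul_sum]
    push_cast at hL2 ⊢
    field_simp
  have hsub : box d L ⊆ box d (2 * L) := by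
    intro y hy; rw [mem_box] at hy ⊢; intro i; have := hy i; push_cast; omega
  have h1 : |∑ y ∈ box d (2 * L), ∑ z ∈ box d L, (g (x + y) - g (x + z))| ≤
      2 * ((2 * L : ℕ) : ℝ) ^ d * (d * (2 * L : ℕ) *
        ∑ w ∈ box d (2 * (2 * L)), gradNorm g (x + w)) := by
    refine le_trans ?_ (sum_sum_box_le g (2 * L) x)
    refine (Finset.abs_sum_le_sum_abs _ _).trans (Finset.sum_le_sum fun y _ => ?_)
    refine (Finset.abs_sum_le_sum_abs _ _).trans ?_
    exact Finset.sum_le_sum_of_subset_of_nonneg hsub fun _ _ _ => abs_nonneg _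
  rw [e, abs_mul, abs_of_pos (by positivity)]
  calc _ ≤ (((2 * L : ℕ) : ℝ) ^ d)⁻¹ * ((L : ℝ) ^ d)⁻¹ * (2 * ((2 * L : ℕ) : ℝ) ^ d *
        (d * (2 * L : ℕ) * ∑ w ∈ box d (2 * (2 * L)), gradNorm g (x + w))) := by gcongr
    _ = _ := by
      rw [show 2 * (2 * L) = 4 * L by ring]
      push_cast at hL2 ⊢
      field_simp
      ring

lemma abs_sub_boxAvg_le {d : ℕ} (g : Zd d → ℝ) (m : ℕ) (x : Zd d) :
    |g x - boxAvg (2 ^ m) g x| ≤ ∑ k ∈ Finset.range m,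
      4 * d * ((((2 ^ k : ℕ) : ℝ) ^ d)⁻¹ * (2 ^ k : ℕ)) *
        ∑ w ∈ box d (4 * 2 ^ k), gradNorm g (x + w) := by
  induction m with
  | zero => simp [boxAvg_one]
  | succ m ih =>
    rw [Finset.sum_range_succ]
    refine (abs_sub_le _ (boxAvg (2 ^ m) g x) _).trans (add_le_add ih ?_)
    rw [abs_sub_comm, pow_succ']
    exact abs_boxAvg_double_sub_le g (by positivity) x

lemma sum_box_add_le {d : ℕ} {F : Zd d → ℝ} (hF : ∀ x, 0 ≤ F x) {S : Finset (Zd d)}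
    (hS : ∀ x ∉ S, F x = 0) (T : Finset (Zd d)) (y : Zd d) :
    ∑ x ∈ T, F (x + y) ≤ ∑ x ∈ S, F x := by
  have : ∑ x ∈ T, F (x + y) = ∑ w ∈ T.map (addRightEmbedding y), F w := by
    simp [Finset.sum_map]
  rw [this]
  calc _ ≤ ∑ w ∈ S ∪ T.map (addRightEmbedding y), F w :=
        Finset.sum_le_sum_of_subset_of_nonneg Finset.subset_union_right fun _ _ _ => hF _
    _ = _ := (Finset.sum_subset Finset.subset_union_left fun x _ hx => hS x hx).symm

/-- A form of Young's convolution inequality, ℓ^r to ℓ^t, for the indicator of a box. Jensen in the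
box handles the r-th power; of the remaining power t/r, all but one factor is bounded by the total
sum, and that factor is summed over x by exchanging the sums. -/
lemma sum_box_rpow_le {d : ℕ} {h : Zd d → ℝ} (hh : ∀ x, 0 ≤ h x) {S : Finset (Zd d)}
    (hS : ∀ x ∉ S, h x = 0) {r t : ℝ} (hr : 1 ≤ r) (hrt : r ≤ t) {N : ℕ} (hN : 0 < N)
    (X : Finset (Zd d)) :
    ∑ x ∈ X, (∑ y ∈ box d N, h (x + y)) ^ t ≤
      ((N : ℝ) ^ d) ^ ((r - 1) * (t / r) + 1) * (∑ x ∈ S, h x ^ r) ^ (t / r) := by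
  set H := ∑ x ∈ S, h x ^ r with hH
  have hr0 : 0 < r := by linarith
  have htr : 1 ≤ t / r := (one_le_div hr0).2 hrt
  have hb : (0 : ℝ) < (N : ℝ) ^ d := by positivity
  have hF : ∀ x, 0 ≤ h x ^ r := fun x => Real.rpow_nonneg (hh x) r
  have hFS : ∀ x ∉ S, h x ^ r = 0 := fun x hx => by
    rw [hS x hx, Real.zero_rpow hr0.ne']
  have hH0 : 0 ≤ H := Finset.sum_nonneg fun x _ => hF x
  have hpt : ∀ x, (∑ y ∈ box d N, h (x + y)) ^ t ≤
      ((N : ℝ) ^ d) ^ ((r - 1) * (t / r)) * H ^ (t / r - 1) * ∑ y ∈ box d N, h (x + y) ^ r := by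
    intro x
    have s0 : 0 ≤ ∑ y ∈ box d N, h (x + y) := Finset.sum_nonneg fun _ _ => hh _
    have s1 : 0 ≤ ∑ y ∈ box d N, h (x + y) ^ r := Finset.sum_nonneg fun _ _ => hF _
    have a1 : (∑ y ∈ box d N, h (x + y)) ^ r ≤
        ((N : ℝ) ^ d) ^ (r - 1) * ∑ y ∈ box d N, h (x + y) ^ r := by
      have := Real.rpow_sum_le_const_mul_sum_rpow_of_nonneg (box d N) (f := fun y => h (x + y)) hr
        (fun _ _ => hh _)
      simpa [card_box] using this
    have a2 : ∑ y ∈ box d N, h (x + y) ^ r ≤ H := by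
      have := sum_box_add_le hF hFS (box d N) x
      simpa [add_comm] using this
    calc (∑ y ∈ box d N, h (x + y)) ^ t = ((∑ y ∈ box d N, h (x + y)) ^ r) ^ (t / r) := by
          rw [← Real.rpow_mul s0]; congr 1; field_simp
      _ ≤ (((N : ℝ) ^ d) ^ (r - 1) * ∑ y ∈ box d N, h (x + y) ^ r) ^ (t / r) := by
          gcongr
      _ = ((N : ℝ) ^ d) ^ ((r - 1) * (t / r)) * (∑ y ∈ box d N, h (x + y) ^ r) ^ (t / r) := by
          rw [Real.mul_rpow (by positivity) s1, ← Real.rpow_mul hb.le]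
      _ ≤ ((N : ℝ) ^ d) ^ ((r - 1) * (t / r)) *
          (H ^ (t / r - 1) * ∑ y ∈ box d N, h (x + y) ^ r) := by
          gcongr
          rcases s1.eq_or_lt with h0 | h0
          · rw [← h0, Real.zero_rpow (by linarith)]; simp
          · rw [← sub_add_cancel (t / r) 1, Real.rpow_add h0, Real.rpow_one, add_sub_cancel_right]
            gcongr
      _ = _ := by ring
  have h2 : ∑ x ∈ X, ∑ y ∈ box d N, h (x + y) ^ r ≤ (N : ℝ) ^ d * H := by
    rw [Finset.sum_comm]
    refine (Finset.sum_le_card_nsmul _ _ H fun y _ => ?_).trans (by simp [card_box])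
    exact sum_box_add_le hF hFS X y
  calc _ ≤ ∑ x ∈ X, ((N : ℝ) ^ d) ^ ((r - 1) * (t / r)) * H ^ (t / r - 1) *
          ∑ y ∈ box d N, h (x + y) ^ r := Finset.sum_le_sum fun x _ => hpt x
    _ ≤ ((N : ℝ) ^ d) ^ ((r - 1) * (t / r)) * H ^ (t / r - 1) * ((N : ℝ) ^ d * H) := by
        rw [← Finset.mul_sum]; gcongr
    _ = _ := by
        rw [Real.rpow_add hb, Real.rpow_one]
        rcases hH0.eq_or_lt with h0 | h0
        · rw [← h0]; simp [Real.zero_rpow (show t / r ≠ 0 by linarith)]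
        · rw [Real.rpow_sub h0, Real.rpow_one]; field_simp

lemma gradNorm_comp_add {d : ℕ} (g : Zd d → ℝ) (a x : Zd d) :
    gradNorm (fun y => g (a + y)) x = gradNorm g (a + x) := by
  simp [gradNorm, add_assoc]

lemma rpow_sum_mul_le {ι : Type*} (s : Finset ι) {t : ℝ} (ht : 1 ≤ t) (w b : ι → ℝ)
    (hw : ∀ i, 0 ≤ w i) (hb : ∀ i, 0 ≤ b i) :
    (∑ i ∈ s, w i * b i) ^ t ≤ (∑ i ∈ s, w i) ^ (t - 1) * ∑ i ∈ s, w i * b i ^ t := by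
  have ht0 : 0 < t := by linarith
  have h := Real.inner_le_weight_mul_Lp_of_nonneg s ht w b hw hb
  have s0 : 0 ≤ ∑ i ∈ s, w i * b i := Finset.sum_nonneg fun i _ => mul_nonneg (hw i) (hb i)
  have s1 : 0 ≤ ∑ i ∈ s, w i := Finset.sum_nonneg fun i _ => hw i
  have s2 : 0 ≤ ∑ i ∈ s, w i * b i ^ t :=
    Finset.sum_nonneg fun i _ => mul_nonneg (hw i) (Real.rpow_nonneg (hb i) _)
  calc _ ≤ ((∑ i ∈ s, w i) ^ (1 - t⁻¹) * (∑ i ∈ s, w i * b i ^ t) ^ t⁻¹) ^ t := by gcongr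
    _ = _ := by
      rw [Real.mul_rpow (by positivity) (by positivity), ← Real.rpow_mul s1, ← Real.rpow_mul s2,
        inv_mul_cancel₀ ht0.ne', Real.rpow_one]
      congr 2
      field_simp

/-- The increment between the averages at scales 2^k and 2^(k+1) is 2^{k(1-d)} times a box sum of
the gradient, so its ℓ^t norm is of order 2^{kγ} with γ = 1 - d/r + d/t. For γ > 0 the sum over
scales is geometric and dominated by the largest scale. -/
theorem exists_sum_box_sub_rpow_le (d : ℕ) {r t : ℝ} (hr : 1 ≤ r) (hrt : r ≤ t)
    (hγ : 0 < 1 - d / r + d / t) :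
    ∃ K : ℝ, 0 < K ∧ ∀ (m : ℕ) (a : Zd d) (g : Zd d → ℝ), ∃ c : ℝ,
      ∑ x ∈ box d (2 ^ m), |g (a + x) - c| ^ t ≤
        K * ((2 : ℝ) ^ m) ^ (t * (1 - d / r + d / t)) *
          (∑ x ∈ box d (4 * 2 ^ m), gradNorm g (a + x) ^ r) ^ (t / r) := by
  set γ := 1 - d / r + d / t with hγd
  have hr0 : 0 < r := by linarith
  have ht0 : 0 < t := by linarith
  have hq : 1 < (2 : ℝ) ^ γ := Real.one_lt_rpow (by norm_num) hγ
  set Q := (2 : ℝ) ^ γ / (2 ^ γ - 1) with hQ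
  have hQ0 : 0 < Q := div_pos (by linarith) (by linarith)
  set K1 : ℝ := (4 * d + 1) ^ t * ((4 : ℝ) ^ d) ^ ((r - 1) * (t / r) + 1) with hK1
  have hK10 : 0 < K1 := by positivity
  refine ⟨Q ^ t * K1, by positivity, ?_⟩
  suffices H0 : ∀ (m : ℕ) (g : Zd d → ℝ), ∃ c : ℝ,
      ∑ x ∈ box d (2 ^ m), |g x - c| ^ t ≤
        Q ^ t * K1 * ((2 : ℝ) ^ m) ^ (t * γ) *
          (∑ x ∈ box d (4 * 2 ^ m), gradNorm g x ^ r) ^ (t / r) by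
    intro m a g
    obtain ⟨c, hc⟩ := H0 m fun y => g (a + y)
    exact ⟨c, by simpa only [gradNorm_comp_add] using hc⟩
  intro m g
  set S := box d (4 * 2 ^ m) with hS
  set h : Zd d → ℝ := fun w => if w ∈ S then gradNorm g w else 0 with hh
  have hh0 : ∀ w, 0 ≤ h w := fun w => by
    simp only [hh]; split_ifs
    exacts [gradNorm_nonneg g w, le_rfl]
  have hhS : ∀ w ∉ S, h w = 0 := fun w hw => by simp [hh, hw]
  set H := ∑ x ∈ S, h x ^ r with hH
  have hHeq : ∑ x ∈ S, gradNorm g x ^ r = H :=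
    Finset.sum_congr rfl fun x hx => by simp [hh, hx]
  rw [hHeq]
  have hH0 : 0 ≤ H := Finset.sum_nonneg fun x _ => Real.rpow_nonneg (hh0 x) r
  -- The increment at scale k is written as w k * b x k, normalized so that the ℓ^t norm of b · k is
  -- bounded uniformly in k. The weighted Jensen inequality then sums the scales.
  set w : ℕ → ℝ := fun k => ((2 : ℝ) ^ γ) ^ k with hw
  set b : Zd d → ℕ → ℝ := fun x k => (4 * d + 1) * ((2 : ℝ) ^ k) ^ (1 - d - γ) *
    ∑ y ∈ box d (4 * 2 ^ k), h (x + y) with hbdef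
  have hw0 : ∀ k, 0 ≤ w k := fun k => by positivity
  have hb0 : ∀ x k, 0 ≤ b x k := fun x k =>
    mul_nonneg (by positivity) (Finset.sum_nonneg fun _ _ => hh0 _)
  have hwb : ∀ x k, w k * b x k = (4 * d + 1) * ((((2 ^ k : ℕ) : ℝ) ^ d)⁻¹ * (2 ^ k : ℕ)) *
      ∑ y ∈ box d (4 * 2 ^ k), h (x + y) := by
    intro x k
    have p2 : (0 : ℝ) < 2 ^ k := by positivity
    have : w k * ((2 : ℝ) ^ k) ^ (1 - d - γ) = (((2 ^ k : ℕ) : ℝ) ^ d)⁻¹ * (2 ^ k : ℕ) := by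
      have e1 : w k = ((2 : ℝ) ^ k) ^ γ := by
        simp only [hw]
        rw [← Real.rpow_natCast, ← Real.rpow_natCast, ← Real.rpow_mul (by norm_num),
          ← Real.rpow_mul (by norm_num), mul_comm]
      rw [e1, ← Real.rpow_add p2, show γ + (1 - d - γ) = 1 - (d : ℝ) by ring, Real.rpow_sub p2,
        Real.rpow_one, Real.rpow_natCast]
      push_cast
      field_simp
    rw [← this]; simp only [hbdef]; ring
  -- The box based at this corner can be reached from every x in the box by a translation with
  -- coordinates in [0, 2^m], so its average serves as the common constant. The comparison with it
  -- is charged to the extra index k = m.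
  set z0 : Zd d := fun _ => (2 ^ m : ℕ) with hz0
  set c := boxAvg (2 ^ m) g z0 with hc
  have hpt : ∀ x ∈ box d (2 ^ m), |g x - c| ≤ ∑ k ∈ Finset.range (m + 1), w k * b x k := by
    intro x hx
    have hx' := mem_box.1 hx
    refine (abs_sub_le _ (boxAvg (2 ^ m) g x) _).trans ?_
    rw [Finset.sum_range_succ]
    refine add_le_add ((abs_sub_boxAvg_le g m x).trans (Finset.sum_le_sum fun k hk => ?_)) ?_
    · rw [hwb]
      have hkm : 2 ^ (k + 1) ≤ 2 ^ m := Nat.pow_le_pow_right (by norm_num)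
        (Finset.mem_range.1 hk)
      have e : ∑ y ∈ box d (4 * 2 ^ k), h (x + y) =
          ∑ y ∈ box d (4 * 2 ^ k), gradNorm g (x + y) := by
        refine Finset.sum_congr rfl fun y hy => ?_
        have hmem : x + y ∈ S := by
          rw [hS, mem_box]
          intro i
          have h1 := hx' i
          have h2 := mem_box.1 hy i
          rw [pow_succ] at hkm
          zify at hkm
          push_cast at h1 h2 ⊢
          simp only [Pi.add_apply]
          constructor <;> linarith
        simp [hh, hmem]
      rw [e]
      refine mul_le_mul_of_nonneg_right ?_ (Finset.sum_nonneg fun _ _ => gradNorm_nonneg _ _)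
      refine mul_le_mul_of_nonneg_right (by linarith) (by positivity)
    · rw [hwb, abs_sub_comm]
      have hz : z0 = x + (z0 - x) := by abel
      rw [hc, hz]
      refine (abs_boxAvg_add_sub_le g (2 ^ m) x (z0 - x) fun i => ?_).trans ?_
      · have := hx' i
        simp only [hz0, Pi.sub_apply]
        omega
      have e : ∑ y ∈ box d (2 * 2 ^ m), gradNorm g (x + y) ≤
          ∑ y ∈ box d (4 * 2 ^ m), h (x + y) := by
        refine le_trans (le_of_eq (Finset.sum_congr rfl fun y hy => ?_))
          (Finset.sum_le_sum_of_subset_of_nonneg (s := box d (2 * 2 ^ m)) ?_ fun _ _ _ => hh0 _)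
        · have hmem : x + y ∈ S := by
            rw [hS, mem_box]
            intro i
            have h1 := hx' i
            have h2 := mem_box.1 hy i
            push_cast at h1 h2 ⊢
            simp only [Pi.add_apply]
            constructor <;> linarith
          simp [hh, hmem]
        · intro y hy
          rw [mem_box] at hy ⊢
          intro i
          have := hy i
          push_cast at this ⊢
          constructor <;> linarith [this.1, this.2, pow_pos (show (0 : ℤ) < 2 by norm_num) m]
      have e0 : 0 ≤ ∑ y ∈ box d (4 * 2 ^ m), h (x + y) := Finset.sum_nonneg fun _ _ => hh0 _
      calc _ ≤ ((((2 ^ m : ℕ) : ℝ)) ^ d)⁻¹ * (d * (2 ^ m : ℕ) *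
              ∑ y ∈ box d (4 * 2 ^ m), h (x + y)) := by gcongr
        _ = d * (((((2 ^ m : ℕ) : ℝ)) ^ d)⁻¹ * (2 ^ m : ℕ)) *
              ∑ y ∈ box d (4 * 2 ^ m), h (x + y) := by ring
        _ ≤ _ := by
          refine mul_le_mul_of_nonneg_right ?_ e0
          refine mul_le_mul_of_nonneg_right ?_ (by positivity)
          have : (0 : ℝ) ≤ d := by positivity
          linarith
  have hbt : ∀ k, ∑ x ∈ box d (2 ^ m), b x k ^ t ≤ K1 * H ^ (t / r) := by
    intro k
    have p2 : (0 : ℝ) < 2 ^ k := by positivity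
    have h1 := sum_box_rpow_le hh0 hhS hr hrt (show 0 < 4 * 2 ^ k by positivity) (box d (2 ^ m))
    have h2 : ∀ x, b x k ^ t = (4 * d + 1) ^ t * ((2 : ℝ) ^ k) ^ ((1 - d - γ) * t) *
        (∑ y ∈ box d (4 * 2 ^ k), h (x + y)) ^ t := by
      intro x
      simp only [hbdef]
      rw [Real.mul_rpow (by positivity) (Finset.sum_nonneg fun _ _ => hh0 _),
        Real.mul_rpow (by positivity) (by positivity), ← Real.rpow_mul p2.le]
    calc _ = (4 * d + 1) ^ t * ((2 : ℝ) ^ k) ^ ((1 - d - γ) * t) *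
        ∑ x ∈ box d (2 ^ m), (∑ y ∈ box d (4 * 2 ^ k), h (x + y)) ^ t := by
          rw [Finset.mul_sum]; exact Finset.sum_congr rfl fun x _ => h2 x
      _ ≤ (4 * d + 1) ^ t * ((2 : ℝ) ^ k) ^ ((1 - d - γ) * t) *
          ((((4 * 2 ^ k : ℕ) : ℝ) ^ d) ^ ((r - 1) * (t / r) + 1) * H ^ (t / r)) := by gcongr
      _ = K1 * H ^ (t / r) * (((2 : ℝ) ^ k) ^ ((1 - d - γ) * t) *
            ((2 : ℝ) ^ k) ^ (d * ((r - 1) * (t / r) + 1))) := by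
          push_cast
          rw [mul_pow, Real.mul_rpow (by positivity) (by positivity), hK1,
            Real.rpow_mul p2.le d, Real.rpow_natCast]
          ring
      _ = K1 * H ^ (t / r) := by
          rw [← Real.rpow_add p2]
          have : (1 - d - γ) * t + d * ((r - 1) * (t / r) + 1) = 0 := by
            rw [hγd]; field_simp; ring
          rw [this]; simp
  have hW : ∑ k ∈ Finset.range (m + 1), w k ≤ Q * ((2 : ℝ) ^ m) ^ γ := by
    have e : ((2 : ℝ) ^ m) ^ γ = ((2 : ℝ) ^ γ) ^ m := by
      rw [← Real.rpow_natCast, ← Real.rpow_natCast, ← Real.rpow_mul (by norm_num),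
        ← Real.rpow_mul (by norm_num), mul_comm]
    simp only [hw]
    rw [geom_sum_eq hq.ne', e, hQ, pow_succ, div_mul_eq_mul_div]
    have : 0 < (2 : ℝ) ^ γ - 1 := by linarith
    gcongr
    linarith
  have hW0 : 0 ≤ ∑ k ∈ Finset.range (m + 1), w k := Finset.sum_nonneg fun k _ => hw0 k
  have hW1 : 0 < ∑ k ∈ Finset.range (m + 1), w k :=
    Finset.sum_pos (fun k _ => by positivity) (by simp)
  refine ⟨c, ?_⟩
  set W := ∑ k ∈ Finset.range (m + 1), w k with hWd
  calc ∑ x ∈ box d (2 ^ m), |g x - c| ^ t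
      ≤ ∑ x ∈ box d (2 ^ m), W ^ (t - 1) * ∑ k ∈ Finset.range (m + 1), w k * b x k ^ t := by
        refine Finset.sum_le_sum fun x hx => ?_
        refine le_trans ?_ (rpow_sum_mul_le _ (hr.trans hrt) w (b x) hw0 (hb0 x))
        exact Real.rpow_le_rpow (abs_nonneg _) (hpt x hx) ht0.le
    _ = W ^ (t - 1) * ∑ k ∈ Finset.range (m + 1), w k * ∑ x ∈ box d (2 ^ m), b x k ^ t := by
        rw [← Finset.mul_sum, Finset.sum_comm]
        simp_rw [Finset.mul_sum]
    _ ≤ W ^ (t - 1) * ∑ k ∈ Finset.range (m + 1), w k * (K1 * H ^ (t / r)) := by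
        gcongr with k hk
        exact hbt k
    _ = W ^ t * (K1 * H ^ (t / r)) := by
        rw [← Finset.sum_mul, ← mul_assoc, ← hWd]
        congr 1
        rw [Real.rpow_sub hW1, Real.rpow_one]; field_simp
    _ ≤ (Q * ((2 : ℝ) ^ m) ^ γ) ^ t * (K1 * H ^ (t / r)) := by gcongr
    _ = _ := by
        rw [Real.mul_rpow hQ0.le (by positivity), ← Real.rpow_mul (by positivity), mul_comm γ t]
        ring

/-! ### Sobolev inequalities on cubes for degenerate conductances -/

/-- The cube `{x : ‖x‖_∞ ≤ n}`. -/
noncomputable def cube (d n : ℕ) : Finset (Zd d) := Fintype.piFinset fun _ => Finset.Icc (-n : ℤ) n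

lemma mem_cube {d n : ℕ} {x : Zd d} : x ∈ cube d n ↔ ∀ i, -(n : ℤ) ≤ x i ∧ x i ≤ n := by
  simp [cube]

lemma mem_cube_iff_norm {d n : ℕ} {x : Zd d} : x ∈ cube d n ↔ ‖x‖ ≤ n := by
  rw [mem_cube, pi_norm_le_iff_of_nonneg (by positivity)]
  refine forall_congr' fun i => ?_
  rw [Int.norm_eq_abs, abs_le]
  norm_cast

lemma card_cube (d n : ℕ) : (cube d n).card = (2 * n + 1) ^ d := by
  simp only [cube, Fintype.card_piFinset, Int.card_Icc, Finset.prod_const, Finset.card_univ,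
    Fintype.card_fin]
  congr 1
  omega

lemma cube_subset {d m n : ℕ} (h : m ≤ n) : cube d m ⊆ cube d n := by
  intro x hx
  rw [mem_cube] at hx ⊢
  intro i; have := hx i; omega

/-- The Dirichlet energy of `g` carried by the edges `(x, x + e_i)`. -/
noncomputable def edgeEnergy {d : ℕ} (C : Zd d → Zd d → ℝ) (g : Zd d → ℝ) (x : Zd d) : ℝ :=
  ∑ i, C x (x + Pi.single i 1) * (g (x + Pi.single i 1) - g x) ^ 2

lemma edgeEnergy_nonneg {d : ℕ} {C : Zd d → Zd d → ℝ} (hC : ∀ x y, 0 ≤ C x y) (g : Zd d → ℝ)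
    (x : Zd d) : 0 ≤ edgeEnergy C g x :=
  Finset.sum_nonneg fun _ _ => mul_nonneg (hC _ _) (sq_nonneg _)

lemma gradNorm_sq_le {d : ℕ} {C : Zd d → Zd d → ℝ} {ν : Zd d → ℝ}
    (hν : ∀ x i, 1 ≤ ν x * C x (x + Pi.single i 1)) (g : Zd d → ℝ) (x : Zd d) :
    gradNorm g x ^ 2 ≤ d * (ν x * edgeEnergy C g x) := by
  have h1 : gradNorm g x ^ 2 ≤ d * ∑ i, |g (x + Pi.single i 1) - g x| ^ 2 := by
    simpa [gradNorm] using sq_sum_le_card_mul_sum_sq (s := (Finset.univ : Finset (Fin d)))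
      (f := fun i => |g (x + Pi.single i 1) - g x|)
  refine h1.trans (mul_le_mul_of_nonneg_left ?_ (by positivity))
  rw [edgeEnergy, Finset.mul_sum]
  refine Finset.sum_le_sum fun i _ => ?_
  rw [sq_abs, ← mul_assoc]
  exact le_mul_of_one_le_left (sq_nonneg _) (hν x i)

/-- Pointwise |∇g|² ≤ d ν · energy. Raising this to the power q/(q+1) and applying Hölder with
exponents q + 1 and (q + 1)/q separates ν^q from the energy. The price of degeneracy is the gradient
exponent 2q/(q+1) instead of 2. -/
lemma sum_gradNorm_rpow_le {d : ℕ} {C : Zd d → Zd d → ℝ} (hC : ∀ x y, 0 ≤ C x y) {ν : Zd d → ℝ}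
    (hν0 : ∀ x, 0 ≤ ν x) (hν : ∀ x i, 1 ≤ ν x * C x (x + Pi.single i 1)) {q t : ℝ} (hq : 1 < q)
    (ht : 0 < t) (g : Zd d → ℝ) (a : Zd d) (S : Finset (Zd d)) :
    (∑ x ∈ S, gradNorm g (a + x) ^ (2 * q / (q + 1))) ^ (t / (2 * q / (q + 1))) ≤
      (d : ℝ) ^ (t / 2) * (∑ x ∈ S, ν (a + x) ^ q) ^ (t / (2 * q)) *
        (∑ x ∈ S, edgeEnergy C g (a + x)) ^ (t / 2) := by
  have hq0 : 0 < q := by linarith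
  set θ := q / (q + 1) with hθ
  have hθ0 : 0 < θ := by positivity
  have e0 : ∀ x, 0 ≤ edgeEnergy C g x := edgeEnergy_nonneg hC g
  have h1 : ∀ x, gradNorm g x ^ (2 * q / (q + 1)) ≤
      (d : ℝ) ^ θ * (ν x ^ θ * edgeEnergy C g x ^ θ) := by
    intro x
    calc gradNorm g x ^ (2 * q / (q + 1)) = (gradNorm g x ^ 2) ^ θ := by
          rw [← Real.rpow_natCast, ← Real.rpow_mul (gradNorm_nonneg g x)]
          congr 1; rw [hθ]; push_cast; ring
      _ ≤ (d * (ν x * edgeEnergy C g x)) ^ θ := by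
          gcongr; exact gradNorm_sq_le hν g x
      _ = _ := by
          rw [Real.mul_rpow (by positivity) (mul_nonneg (hν0 x) (e0 x)),
            Real.mul_rpow (hν0 x) (e0 x)]
  have hconj : (q + 1).HolderConjugate ((q + 1) / q) := by
    rw [Real.holderConjugate_iff]
    refine ⟨by linarith, ?_⟩
    field_simp
    ring
  have h2 : ∑ x ∈ S, ν (a + x) ^ θ * edgeEnergy C g (a + x) ^ θ ≤
      (∑ x ∈ S, ν (a + x) ^ q) ^ (1 / (q + 1)) * (∑ x ∈ S, edgeEnergy C g (a + x)) ^ θ := by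
    have := Real.inner_le_Lp_mul_Lq_of_nonneg S hconj (f := fun x => ν (a + x) ^ θ)
      (g := fun x => edgeEnergy C g (a + x) ^ θ) (fun x _ => Real.rpow_nonneg (hν0 _) _)
      (fun x _ => Real.rpow_nonneg (e0 _) _)
    refine this.trans (le_of_eq ?_)
    congr 2
    · refine Finset.sum_congr rfl fun x _ => ?_
      rw [← Real.rpow_mul (hν0 _)]; congr 1; rw [hθ]; field_simp
    · refine Finset.sum_congr rfl fun x _ => ?_
      rw [← Real.rpow_mul (e0 _), hθ, div_mul_div_cancel₀ (by positivity), div_self hq0.ne',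
        Real.rpow_one]
    · rw [hθ]; field_simp
  have n1 : 0 ≤ ∑ x ∈ S, ν (a + x) ^ q := Finset.sum_nonneg fun x _ => Real.rpow_nonneg (hν0 _) _
  have n2 : 0 ≤ ∑ x ∈ S, edgeEnergy C g (a + x) := Finset.sum_nonneg fun x _ => e0 _
  have n0 : 0 ≤ ∑ x ∈ S, gradNorm g (a + x) ^ (2 * q / (q + 1)) :=
    Finset.sum_nonneg fun x _ => Real.rpow_nonneg (gradNorm_nonneg _ _) _
  calc _ ≤ ((d : ℝ) ^ θ * ((∑ x ∈ S, ν (a + x) ^ q) ^ (1 / (q + 1)) *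
        (∑ x ∈ S, edgeEnergy C g (a + x)) ^ θ)) ^ (t / (2 * q / (q + 1))) := by
        refine Real.rpow_le_rpow n0 ?_ (by positivity)
        refine (Finset.sum_le_sum fun x _ => h1 (a + x)).trans ?_
        rw [← Finset.mul_sum]
        gcongr
    _ = _ := by
      rw [Real.mul_rpow (by positivity) (by positivity), Real.mul_rpow (by positivity)
        (by positivity), ← Real.rpow_mul (by positivity), ← Real.rpow_mul n1, ← Real.rpow_mul n2,
        ← mul_assoc, show θ * (t / (2 * q / (q + 1))) = t / 2 by rw [hθ]; field_simp,
        show 1 / (q + 1) * (t / (2 * q / (q + 1))) = t / (2 * q) by field_simp]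

/-- Subcritical Sobolev–Poincaré inequality on cubes for the Dirichlet energy. -/
theorem exists_sum_cube_sub_rpow_le (d : ℕ) {q t : ℝ} (hq : 1 < q) (ht : 2 ≤ t)
    (hdqt : (d : ℝ) / 2 + d / (2 * q) < 1 + d / t) {κ : ℝ} (hκ : 0 ≤ κ) :
    ∃ K : ℝ, 0 < K ∧ ∀ (C : Zd d → Zd d → ℝ) (ν : Zd d → ℝ), (∀ x y, 0 ≤ C x y) →
      (∀ x, 0 ≤ ν x) → (∀ x i, 1 ≤ ν x * C x (x + Pi.single i 1)) →
      (∀ n : ℕ, 1 ≤ n → ∑ x ∈ cube d n, ν x ^ q ≤ κ * (n : ℝ) ^ d) →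
      ∀ (n : ℕ) (g : Zd d → ℝ), 1 ≤ n → ∃ c : ℝ,
        ∑ x ∈ cube d n, |g x - c| ^ t ≤
          K * (n : ℝ) ^ d * ((n : ℝ) ^ 2 * (((n : ℝ) ^ d)⁻¹ *
            ∑ x ∈ cube d (24 * n), edgeEnergy C g x)) ^ (t / 2) := by
  have hq0 : 0 < q := by linarith
  have ht0 : 0 < t := by linarith
  set r := 2 * q / (q + 1) with hr
  have hr1 : 1 ≤ r := by rw [hr, le_div_iff₀ (by positivity)]; linarith
  have hr2 : r ≤ t := by
    refine le_trans ?_ ht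
    rw [hr, div_le_iff₀ (by positivity)]; linarith
  have hr0 : 0 < r := by linarith
  have hdr : (d : ℝ) / r = d / 2 + d / (2 * q) := by
    rw [hr]; field_simp
  -- By `hdr`, the hypothesis on d, q, t is exactly subcriticality of t for the gradient exponent r.
  have hγ : 0 < 1 - d / r + d / t := by linarith
  obtain ⟨K, hK, H⟩ := exists_sum_box_sub_rpow_le d hr1 hr2 hγ
  refine ⟨(K * d ^ (t / 2) * (κ * 24 ^ d) ^ (t / (2 * q)) + 1) * 6 ^ d * 36 ^ (t / 2),
    by positivity, ?_⟩
  intro C ν hC hν0 hν hνκ n g hn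
  -- A dyadic box of comparable size containing the cube. The gradient box has side 4 · 2^m, which
  -- is at most 24 n.
  obtain ⟨m, hm1, hm2⟩ : ∃ m : ℕ, 2 * n + 1 ≤ 2 ^ m ∧ 2 ^ m ≤ 6 * n := by
    refine ⟨Nat.clog 2 (2 * n + 1), Nat.le_pow_clog (by norm_num) _, ?_⟩
    have h1 := Nat.pow_pred_clog_lt_self (b := 2) (by norm_num) (x := 2 * n + 1) (by omega)
    have h2 : 0 < Nat.clog 2 (2 * n + 1) := Nat.clog_pos (by norm_num) (by omega)
    obtain ⟨k, hk⟩ := Nat.exists_eq_succ_of_ne_zero h2.ne'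
    rw [hk] at h1 ⊢
    simp only [Nat.pred_succ, Nat.succ_eq_add_one, pow_succ] at h1 ⊢
    omega
  set a : Zd d := fun _ => -(n : ℤ) with ha
  have e0 : ∀ x, 0 ≤ edgeEnergy C g x := edgeEnergy_nonneg hC g
  have hL0 : (0 : ℝ) < 2 ^ m := by positivity
  have hn0 : (0 : ℝ) < n := by positivity
  have hLn : (2 : ℝ) ^ m ≤ 6 * n := by exact_mod_cast hm2
  have hnL : (n : ℝ) ≤ 2 ^ m := by
    have : n ≤ 2 ^ m := by omega
    exact_mod_cast this
  have hlow : ∀ F : Zd d → ℝ, (∀ x, 0 ≤ F x) →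
      ∑ x ∈ cube d n, F x ≤ ∑ y ∈ box d (2 ^ m), F (a + y) := by
    intro F hF
    have : ∑ y ∈ box d (2 ^ m), F (a + y) =
        ∑ w ∈ (box d (2 ^ m)).map (addLeftEmbedding a), F w := by simp [Finset.sum_map]
    rw [this]
    refine Finset.sum_le_sum_of_subset_of_nonneg ?_ fun _ _ _ => hF _
    intro x hx
    refine Finset.mem_map.2 ⟨x - a, ?_, by simp⟩
    rw [mem_box]; rw [mem_cube] at hx
    intro i
    have := hx i
    simp only [ha, Pi.sub_apply]
    zify at hm1
    push_cast
    omega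
  have hup : ∀ F : Zd d → ℝ, (∀ x, 0 ≤ F x) →
      ∑ y ∈ box d (4 * 2 ^ m), F (a + y) ≤ ∑ x ∈ cube d (24 * n), F x := by
    intro F hF
    have : ∑ y ∈ box d (4 * 2 ^ m), F (a + y) =
        ∑ w ∈ (box d (4 * 2 ^ m)).map (addLeftEmbedding a), F w := by simp [Finset.sum_map]
    rw [this]
    refine Finset.sum_le_sum_of_subset_of_nonneg ?_ fun _ _ _ => hF _
    intro x hx
    obtain ⟨y, hy, rfl⟩ := Finset.mem_map.1 hx
    rw [mem_box] at hy; rw [mem_cube]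
    intro i
    have := hy i
    simp only [ha, addLeftEmbedding_apply, Pi.add_apply]
    zify at hm2
    push_cast at this ⊢
    constructor <;> linarith
  obtain ⟨c, hc⟩ := H m a g
  refine ⟨c, (hlow (fun x => |g x - c| ^ t) fun x => by positivity).trans (hc.trans ?_)⟩
  set E := ∑ x ∈ cube d (24 * n), edgeEnergy C g x with hE
  have hE0 : 0 ≤ E := Finset.sum_nonneg fun x _ => e0 x
  have hN : ∑ x ∈ box d (4 * 2 ^ m), ν (a + x) ^ q ≤ κ * 24 ^ d * ((2 : ℝ) ^ m) ^ d := by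
    refine (hup (fun x => ν x ^ q) fun x => Real.rpow_nonneg (hν0 x) q).trans ?_
    refine (hνκ (24 * n) (by omega)).trans ?_
    push_cast
    rw [mul_pow, ← mul_assoc]
    gcongr
  have hEE := hup _ e0
  have n1 : 0 ≤ ∑ x ∈ box d (4 * 2 ^ m), ν (a + x) ^ q :=
    Finset.sum_nonneg fun x _ => Real.rpow_nonneg (hν0 _) _
  have n2 : 0 ≤ ∑ x ∈ box d (4 * 2 ^ m), edgeEnergy C g (a + x) :=
    Finset.sum_nonneg fun x _ => e0 _
  set L : ℝ := 2 ^ m with hL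
  set A := (κ * 24 ^ d) ^ (t / (2 * q)) with hA
  have hA0 : 0 ≤ A := by positivity
  have hLE : 0 ≤ L ^ 2 * ((L ^ d)⁻¹ * E) := by positivity
  calc K * L ^ (t * (1 - d / r + d / t)) *
        (∑ x ∈ box d (4 * 2 ^ m), gradNorm g (a + x) ^ r) ^ (t / r)
      ≤ K * L ^ (t * (1 - d / r + d / t)) * ((d : ℝ) ^ (t / 2) *
          (κ * 24 ^ d * L ^ d) ^ (t / (2 * q)) * E ^ (t / 2)) := by
        refine mul_le_mul_of_nonneg_left ?_ (by positivity)
        refine (sum_gradNorm_rpow_le hC hν0 hν hq ht0 g a _).trans ?_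
        gcongr
    _ = K * d ^ (t / 2) * A * (L ^ d * (L ^ 2 * ((L ^ d)⁻¹ * E)) ^ (t / 2)) := by
        have e1 : (κ * 24 ^ d * L ^ d) ^ (t / (2 * q)) = A * L ^ (d * (t / (2 * q))) := by
          rw [Real.mul_rpow (by positivity) (by positivity), hA, Real.rpow_mul hL0.le,
            Real.rpow_natCast]
        have e2 : (L ^ 2 * ((L ^ d)⁻¹ * E)) ^ (t / 2) = L ^ ((2 - d) * (t / 2)) * E ^ (t / 2) := by
          rw [← mul_assoc, Real.mul_rpow (by positivity) hE0, Real.rpow_mul hL0.le,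
            Real.rpow_sub hL0, Real.rpow_natCast]
          norm_cast
        rw [e1, e2]
        have e3 : L ^ (t * (1 - d / r + d / t)) * L ^ (d * (t / (2 * q))) =
            L ^ d * L ^ ((2 - d) * (t / 2)) := by
          rw [← Real.rpow_natCast L d, ← Real.rpow_add hL0, ← Real.rpow_add hL0]
          congr 1
          rw [hdr]; field_simp; ring
        calc _ = K * d ^ (t / 2) * A * E ^ (t / 2) *
              (L ^ (t * (1 - d / r + d / t)) * L ^ (d * (t / (2 * q)))) := by ring
          _ = _ := by rw [e3]; ring
    _ ≤ (K * d ^ (t / 2) * A + 1) * ((6 * n) ^ d * ((6 * n) ^ 2 * (((n : ℝ) ^ d)⁻¹ * E)) ^ (t / 2)) := by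
        gcongr
        linarith
    _ = _ := by
        have : ((6 * n : ℝ) ^ 2 * (((n : ℝ) ^ d)⁻¹ * E)) ^ (t / 2) =
            36 ^ (t / 2) * ((n : ℝ) ^ 2 * (((n : ℝ) ^ d)⁻¹ * E)) ^ (t / 2) := by
          rw [← Real.mul_rpow (by norm_num) (by positivity)]
          congr 1; ring
        rw [this, mul_pow]
        ring

lemma abs_sub_rpow_le {t : ℝ} (ht : 0 ≤ t) (a b c : ℝ) :
    |a - b| ^ t ≤ 2 ^ t * (|a - c| ^ t + |b - c| ^ t) := by
  have h1 : |a - b| ≤ 2 * max |a - c| |b - c| := by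
    have h := abs_sub_le a c b
    rw [abs_sub_comm c b] at h
    linarith [le_max_left |a - c| |b - c|, le_max_right |a - c| |b - c|]
  calc |a - b| ^ t ≤ (2 * max |a - c| |b - c|) ^ t := by gcongr
    _ = 2 ^ t * (max |a - c| |b - c|) ^ t := Real.mul_rpow (by norm_num) (by positivity)
    _ ≤ _ := by
      gcongr
      rcases max_cases |a - c| |b - c| with ⟨h, _⟩ | ⟨h, _⟩ <;> rw [h]
      · linarith [Real.rpow_nonneg (abs_nonneg (b - c)) t]
      · linarith [Real.rpow_nonneg (abs_nonneg (a - c)) t]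

/-- Subcritical Sobolev inequality for functions supported in a cube. -/
theorem exists_sum_cube_rpow_le (d : ℕ) {q t : ℝ} (hq : 1 < q) (ht : 2 ≤ t) (hd : 0 < d)
    (hdqt : (d : ℝ) / 2 + d / (2 * q) < 1 + d / t) {κ : ℝ} (hκ : 0 ≤ κ) :
    ∃ K : ℝ, 0 < K ∧ ∀ (C : Zd d → Zd d → ℝ) (ν : Zd d → ℝ), (∀ x y, 0 ≤ C x y) →
      (∀ x, 0 ≤ ν x) → (∀ x i, 1 ≤ ν x * C x (x + Pi.single i 1)) →
      (∀ n : ℕ, 1 ≤ n → ∑ x ∈ cube d n, ν x ^ q ≤ κ * (n : ℝ) ^ d) →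
      ∀ (n : ℕ) (g : Zd d → ℝ), 1 ≤ n → (∀ x ∉ cube d n, g x = 0) →
        ∑ x ∈ cube d n, |g x| ^ t ≤
          K * (n : ℝ) ^ d * ((n : ℝ) ^ 2 * (((n : ℝ) ^ d)⁻¹ *
            ∑ x ∈ cube d (96 * n), edgeEnergy C g x)) ^ (t / 2) := by
  obtain ⟨K, hK, H⟩ := exists_sum_cube_sub_rpow_le d hq ht hdqt hκ
  refine ⟨2 ^ t * 2 * K * 4 ^ d * 16 ^ (t / 2), by positivity, ?_⟩
  intro C ν hC hν0 hν hνκ n g hn hg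
  obtain ⟨c, hc⟩ := H C ν hC hν0 hν hνκ (4 * n) g (by omega)
  -- The shift moves the cube of radius n off itself but keeps it inside the cube of radius 4n.
  -- Since g vanishes at x + T, the unknown constant c cancels from g x - g (x + T).
  set T : Zd d := fun _ => 2 * n + 1 with hT
  have e0 : ∀ x, 0 ≤ edgeEnergy C g x := edgeEnergy_nonneg hC g
  have h1 : ∑ x ∈ cube d n, |g x - c| ^ t ≤ ∑ x ∈ cube d (4 * n), |g x - c| ^ t :=
    Finset.sum_le_sum_of_subset_of_nonneg (cube_subset (by omega)) fun _ _ _ => by positivity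
  have h2 : ∑ x ∈ cube d n, |g (x + T) - c| ^ t ≤ ∑ x ∈ cube d (4 * n), |g x - c| ^ t := by
    have : ∑ x ∈ cube d n, |g (x + T) - c| ^ t =
        ∑ w ∈ (cube d n).map (addRightEmbedding T), |g w - c| ^ t := by simp [Finset.sum_map]
    rw [this]
    refine Finset.sum_le_sum_of_subset_of_nonneg ?_ fun _ _ _ => by positivity
    intro x hx
    obtain ⟨y, hy, rfl⟩ := Finset.mem_map.1 hx
    rw [mem_cube] at hy ⊢
    intro i; have := hy i
    simp only [hT, addRightEmbedding_apply, Pi.add_apply]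
    push_cast
    omega
  have h3 : ∀ x ∈ cube d n, |g x| ^ t ≤ 2 ^ t * (|g x - c| ^ t + |g (x + T) - c| ^ t) := by
    intro x hx
    have hz : g (x + T) = 0 := by
      refine hg _ fun hmem => ?_
      have h1 := mem_cube.1 hx ⟨0, hd⟩
      have h2 := mem_cube.1 hmem ⟨0, hd⟩
      simp only [hT, Pi.add_apply] at h2
      omega
    have := abs_sub_rpow_le (by linarith : 0 ≤ t) (g x) (g (x + T)) c
    rwa [hz, sub_zero, ← hz] at this
  set E := ∑ x ∈ cube d (96 * n), edgeEnergy C g x with hE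
  have hE0 : 0 ≤ E := Finset.sum_nonneg fun x _ => e0 x
  have hn0 : (0 : ℝ) < n := by positivity
  calc ∑ x ∈ cube d n, |g x| ^ t
      ≤ ∑ x ∈ cube d n, 2 ^ t * (|g x - c| ^ t + |g (x + T) - c| ^ t) := Finset.sum_le_sum h3
    _ ≤ 2 ^ t * (2 * ∑ x ∈ cube d (4 * n), |g x - c| ^ t) := by
        rw [← Finset.mul_sum, Finset.sum_add_distrib]
        gcongr
        linarith
    _ ≤ 2 ^ t * (2 * (K * ((4 * n : ℕ) : ℝ) ^ d * (((4 * n : ℕ) : ℝ) ^ 2 *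
          ((((4 * n : ℕ) : ℝ) ^ d)⁻¹ * E)) ^ (t / 2))) := by
        rw [show 24 * (4 * n) = 96 * n by ring] at hc
        gcongr
    _ ≤ 2 ^ t * (2 * (K * (4 * n : ℝ) ^ d * ((4 * n : ℝ) ^ 2 *
          (((n : ℝ) ^ d)⁻¹ * E)) ^ (t / 2))) := by
        push_cast
        gcongr
        linarith
    _ = _ := by
        have : ((4 * n : ℝ) ^ 2 * (((n : ℝ) ^ d)⁻¹ * E)) ^ (t / 2) =
            16 ^ (t / 2) * ((n : ℝ) ^ 2 * (((n : ℝ) ^ d)⁻¹ * E)) ^ (t / 2) := by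
          rw [← Real.mul_rpow (by norm_num) (by positivity)]
          congr 1; ring
        rw [this, mul_pow]
        ring

/-! ### Sublinearity on average -/

lemma sum_range_two_pow_le (m : ℕ) : ∑ j ∈ Finset.range m, (2 : ℝ) ^ j ≤ 2 ^ m := by
  rw [geom_sum_eq (by norm_num)]
  norm_num

/-- A function that is approximated in energy by bounded functions is sublinear on average. -/
theorem exists_forall_sum_cube_rpow_le {d : ℕ} {q t : ℝ} (hq : 1 < q) (ht : 2 ≤ t)
    (hdqt : (d : ℝ) / 2 + d / (2 * q) < 1 + d / t) {κ : ℝ} (hκ : 0 ≤ κ)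
    {C : Zd d → Zd d → ℝ} {ν : Zd d → ℝ} (hC : ∀ x y, 0 ≤ C x y)
    (hν0 : ∀ x, 0 ≤ ν x) (hν : ∀ x i, 1 ≤ ν x * C x (x + Pi.single i 1))
    (hνκ : ∀ n : ℕ, 1 ≤ n → ∑ x ∈ cube d n, ν x ^ q ≤ κ * (n : ℝ) ^ d)
    {f : Zd d → ℝ}
    (hf : ∀ δ : ℝ, 0 < δ → ∃ (b : Zd d → ℝ) (B : ℝ), (∀ x, |b x| ≤ B) ∧
      ∀ n : ℕ, 1 ≤ n → ∑ x ∈ cube d n, edgeEnergy C (fun y => f y - b y) x ≤ δ * (n : ℝ) ^ d)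
    {δ : ℝ} (hδ : 0 < δ) :
    ∃ N : ℕ, ∀ n : ℕ, N ≤ n → ∑ x ∈ cube d n, |f x| ^ t ≤ (δ * n) ^ t * (n : ℝ) ^ d := by
  have ht0 : 0 < t := by linarith
  obtain ⟨K, hK, H⟩ := exists_sum_cube_sub_rpow_le d hq ht hdqt hκ
  set A : ℝ := 2 ^ (3 + d) with hA
  have hA0 : 0 < A := by positivity
  set W : ℝ := 2 ^ t * 2 ^ d * 2 ^ t * (1 + 3 ^ d * (2 * A) ^ t) with hW
  have hW0 : 0 < W := by positivity
  set σ := δ / W ^ (1 / t) with hσ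
  have hσ0 : 0 < σ := by positivity
  have hWσ : W * σ ^ t = δ ^ t := by
    rw [hσ, Real.div_rpow hδ.le (by positivity), ← Real.rpow_mul hW0.le,
      one_div_mul_cancel ht0.ne', Real.rpow_one]
    field_simp
  -- Solves for the energy density that makes the right-hand side of the Poincaré inequality equal
  -- to (σ n)^t n^d; the factor 24^d accounts for the enlarged cube.
  set δ' := (σ ^ t / K) ^ (2 / t) / 24 ^ d with hδ'
  have hδ'0 : 0 < δ' := by positivity
  obtain ⟨b, B, hbB, hb⟩ := hf δ' hδ'0
  have hB : 0 ≤ B := (abs_nonneg _).trans (hbB 0)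
  set g : Zd d → ℝ := fun y => f y - b y with hg
  have h1 : ∀ n : ℕ, 1 ≤ n → ∃ c : ℝ, ∑ x ∈ cube d n, |g x - c| ^ t ≤ (σ * n) ^ t * (n : ℝ) ^ d := by
    intro n hn
    obtain ⟨c, hc⟩ := H C ν hC hν0 hν hνκ n g hn
    refine ⟨c, hc.trans ?_⟩
    have hn0 : (0 : ℝ) < n := by positivity
    have e0 : 0 ≤ ∑ x ∈ cube d (24 * n), edgeEnergy C g x :=
      Finset.sum_nonneg fun x _ => edgeEnergy_nonneg hC g x
    have e1 : (n : ℝ) ^ 2 * (((n : ℝ) ^ d)⁻¹ * ∑ x ∈ cube d (24 * n), edgeEnergy C g x) ≤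
        (n : ℝ) ^ 2 * (σ ^ t / K) ^ (2 / t) := by
      gcongr
      rw [inv_mul_le_iff₀ (by positivity)]
      refine (hb (24 * n) (by omega)).trans (le_of_eq ?_)
      rw [hδ']; push_cast; rw [mul_pow]; field_simp
    calc _ ≤ K * (n : ℝ) ^ d * ((n : ℝ) ^ 2 * (σ ^ t / K) ^ (2 / t)) ^ (t / 2) := by gcongr
      _ = _ := by
        rw [Real.mul_rpow (by positivity) (by positivity), ← Real.rpow_mul (by positivity),
          show 2 / t * (t / 2) = 1 by field_simp, Real.rpow_one, ← Real.rpow_natCast (n : ℝ) 2,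
          ← Real.rpow_mul hn0.le, Real.mul_rpow hσ0.le hn0.le]
        rw [show ((2 : ℕ) : ℝ) * (t / 2) = t by push_cast; field_simp]
        field_simp
  choose c hc using fun m : ℕ => h1 (2 ^ m) (Nat.one_le_two_pow)
  push_cast at hc
  have hcard : ∀ n : ℕ, (n : ℝ) ^ d ≤ (cube d n).card := by
    intro n
    rw [card_cube]; push_cast
    gcongr
    linarith [(Nat.cast_nonneg n : (0 : ℝ) ≤ n)]
  -- Both constants approximate g on the cube of radius 2^m, hence they are close. Summing these
  -- geometric increments keeps c m of order σ 2^m, up to the fixed c 0.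
  have hstep : ∀ m, |c (m + 1) - c m| ≤ A * σ * 2 ^ m := by
    intro m
    have p2 : (0 : ℝ) < 2 ^ m := by positivity
    have s1 : ∑ x ∈ cube d (2 ^ m), |g x - c (m + 1)| ^ t ≤
        (σ * 2 ^ (m + 1)) ^ t * ((2 : ℝ) ^ (m + 1)) ^ d :=
      (Finset.sum_le_sum_of_subset_of_nonneg (cube_subset
        (Nat.pow_le_pow_right (by norm_num) (Nat.le_succ m)))
        fun _ _ _ => by positivity).trans (hc (m + 1))
    have s2 : ((2 : ℝ) ^ m) ^ d * |c (m + 1) - c m| ^ t ≤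
        2 ^ t * ((σ * 2 ^ (m + 1)) ^ t * ((2 : ℝ) ^ (m + 1)) ^ d +
          (σ * 2 ^ m) ^ t * ((2 : ℝ) ^ m) ^ d) := by
      calc _ ≤ ∑ x ∈ cube d (2 ^ m), |c (m + 1) - c m| ^ t := by
            rw [Finset.sum_const, nsmul_eq_mul]
            gcongr
            have := hcard (2 ^ m)
            push_cast at this
            exact this
        _ ≤ ∑ x ∈ cube d (2 ^ m), 2 ^ t * (|g x - c (m + 1)| ^ t + |g x - c m| ^ t) := by
            refine Finset.sum_le_sum fun x _ => ?_
            have := abs_sub_rpow_le ht0.le (c (m + 1)) (c m) (g x)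
            rwa [abs_sub_comm _ (g x), abs_sub_comm (c m) (g x)] at this
        _ ≤ _ := by
            rw [← Finset.mul_sum, Finset.sum_add_distrib]
            gcongr
            exact hc m
    have s3 : 2 ^ t * ((σ * 2 ^ (m + 1)) ^ t * ((2 : ℝ) ^ (m + 1)) ^ d +
          (σ * 2 ^ m) ^ t * ((2 : ℝ) ^ m) ^ d) ≤ ((2 : ℝ) ^ m) ^ d * (A * σ * 2 ^ m) ^ t := by
      have e1 : (σ * 2 ^ (m + 1)) ^ t = 2 ^ t * (σ * 2 ^ m) ^ t := by
        rw [← Real.mul_rpow (by norm_num) (by positivity)]; congr 1; ring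
      have e2 : ((2 : ℝ) ^ (m + 1)) ^ d = 2 ^ d * (2 ^ m) ^ d := by
        rw [← mul_pow]; congr 1; ring
      have e3 : (A * σ * 2 ^ m) ^ t = A ^ t * (σ * 2 ^ m) ^ t := by
        rw [← Real.mul_rpow (by positivity) (by positivity)]; congr 1; ring
      have e4 : 2 ^ t * (2 ^ t * 2 ^ d + 1) ≤ A ^ t := by
        have q1 : (2 : ℝ) ^ d ≤ (2 ^ d) ^ t := by
          conv_lhs => rw [← Real.rpow_one ((2 : ℝ) ^ d)]
          exact Real.rpow_le_rpow_of_exponent_le (one_le_pow₀ (by norm_num)) (by linarith)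
        have q2 : (2 : ℝ) ≤ 2 ^ t := by
          conv_lhs => rw [← Real.rpow_one (2 : ℝ)]
          exact Real.rpow_le_rpow_of_exponent_le (by norm_num) (by linarith)
        have q3 : A ^ t = 2 ^ t * (2 ^ t * (2 ^ t * (2 ^ d) ^ t)) := by
          rw [← Real.mul_rpow (by norm_num) (by positivity), ← Real.mul_rpow (by norm_num)
            (by positivity), ← Real.mul_rpow (by norm_num) (by positivity), hA]
          congr 1; ring
        rw [q3]
        have q4 : (1 : ℝ) ≤ 2 ^ d := one_le_pow₀ (by norm_num)
        have q5 : 2 * 2 ^ d ≤ (2 : ℝ) ^ t * (2 ^ d) ^ t := by gcongr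
        have q6 : (1 : ℝ) ≤ 2 ^ t * 2 ^ d := by nlinarith
        have q7 : (2 : ℝ) ^ t * 2 ^ d + 1 ≤ 2 ^ t * (2 * 2 ^ d) := by linarith
        calc (2 : ℝ) ^ t * (2 ^ t * 2 ^ d + 1) ≤ 2 ^ t * (2 ^ t * (2 * 2 ^ d)) := by gcongr
          _ ≤ _ := by gcongr
      rw [e1, e2, e3]
      calc _ = ((2 : ℝ) ^ m) ^ d * ((2 ^ t * (2 ^ t * 2 ^ d + 1)) * (σ * 2 ^ m) ^ t) := by ring
        _ ≤ _ := by gcongr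
    have s4 : |c (m + 1) - c m| ^ t ≤ (A * σ * 2 ^ m) ^ t :=
      le_of_mul_le_mul_left (s2.trans s3) (by positivity)
    exact (Real.rpow_le_rpow_iff (abs_nonneg _) (by positivity) ht0).1 s4
  have hcm : ∀ m, |c m| ≤ |c 0| + A * σ * ∑ j ∈ Finset.range m, (2 : ℝ) ^ j := by
    intro m
    induction m with
    | zero => simp
    | succ m ih =>
      rw [Finset.sum_range_succ, mul_add]
      have := hstep m
      have h2 : |c (m + 1)| ≤ |c (m + 1) - c m| + |c m| := by
        have := abs_add_le (c (m + 1) - c m) (c m)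
        rwa [sub_add_cancel] at this
      linarith
  -- Beyond this radius the fixed quantities |c 0| and B are absorbed into the linear error.
  obtain ⟨N, hN⟩ := exists_nat_ge ((|c 0| + B) / (A * σ))
  refine ⟨max N 1, fun n hn => ?_⟩
  have hn1 : 1 ≤ n := (le_max_right _ _).trans hn
  obtain ⟨m, hm1, hm2⟩ : ∃ m : ℕ, n ≤ 2 ^ m ∧ 2 ^ m ≤ 2 * n := by
    refine ⟨Nat.clog 2 n, Nat.le_pow_clog (by norm_num) _, ?_⟩
    rcases hn1.eq_or_lt with h | h
    · rw [← h]; simp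
    have h1 := Nat.pow_pred_clog_lt_self (b := 2) (by norm_num) (x := n) h
    have h2 : 0 < Nat.clog 2 n := Nat.clog_pos (by norm_num) h
    obtain ⟨k, hk⟩ := Nat.exists_eq_succ_of_ne_zero h2.ne'
    rw [hk] at h1 ⊢
    simp only [Nat.pred_succ, Nat.succ_eq_add_one, pow_succ] at h1 ⊢
    omega
  have hm1' : (n : ℝ) ≤ 2 ^ m := by exact_mod_cast hm1
  have hm2' : (2 : ℝ) ^ m ≤ 2 * n := by exact_mod_cast hm2
  have p2 : (0 : ℝ) < 2 ^ m := by positivity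
  have hD : |c m| + B ≤ 2 * A * (σ * 2 ^ m) := by
    have i1 := hcm m
    have i2 : A * σ * ∑ j ∈ Finset.range m, (2 : ℝ) ^ j ≤ A * σ * 2 ^ m := by
      gcongr; exact sum_range_two_pow_le m
    have i3 : |c 0| + B ≤ A * σ * 2 ^ m := by
      rw [div_le_iff₀ (by positivity)] at hN
      have : (N : ℝ) ≤ n := by exact_mod_cast (le_max_left _ _).trans hn
      calc |c 0| + B ≤ N * (A * σ) := hN
        _ ≤ 2 ^ m * (A * σ) := by gcongr; linarith
        _ = _ := by ring
    linarith
  have hpt : ∀ x, |f x| ^ t ≤ 2 ^ t * (|g x - c m| ^ t + (2 * A * (σ * 2 ^ m)) ^ t) := by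
    intro x
    have i1 : |f x| ≤ |g x - c m| + 2 * A * (σ * 2 ^ m) := by
      have : f x = (g x - c m) + (c m + b x) := by simp only [hg]; ring
      rw [this]
      refine (abs_add_le _ _).trans (add_le_add le_rfl ?_)
      linarith [abs_add_le (c m) (b x), hbB x]
    have i2 := abs_sub_rpow_le ht0.le (|g x - c m|) (-(2 * A * (σ * 2 ^ m))) 0
    rw [sub_neg_eq_add, sub_zero, sub_zero, abs_abs, abs_neg,
      abs_of_nonneg (by positivity : 0 ≤ 2 * A * (σ * 2 ^ m)),
      abs_of_nonneg (by positivity : 0 ≤ |g x - c m| + 2 * A * (σ * 2 ^ m))] at i2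
    exact (Real.rpow_le_rpow (abs_nonneg _) i1 ht0.le).trans i2
  have hcard2 : ((cube d (2 ^ m)).card : ℝ) ≤ 3 ^ d * ((2 : ℝ) ^ m) ^ d := by
    rw [card_cube, ← mul_pow]; push_cast
    gcongr
    linarith [one_le_pow₀ (show (1 : ℝ) ≤ 2 by norm_num) (n := m)]
  calc ∑ x ∈ cube d n, |f x| ^ t ≤ ∑ x ∈ cube d (2 ^ m), |f x| ^ t :=
        Finset.sum_le_sum_of_subset_of_nonneg (cube_subset hm1) fun _ _ _ => by positivity
    _ ≤ ∑ x ∈ cube d (2 ^ m), 2 ^ t * (|g x - c m| ^ t + (2 * A * (σ * 2 ^ m)) ^ t) :=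
        Finset.sum_le_sum fun x _ => hpt x
    _ = 2 ^ t * (∑ x ∈ cube d (2 ^ m), |g x - c m| ^ t +
          (cube d (2 ^ m)).card * (2 * A * (σ * 2 ^ m)) ^ t) := by
        rw [← Finset.mul_sum, Finset.sum_add_distrib, Finset.sum_const, nsmul_eq_mul]
    _ ≤ 2 ^ t * ((σ * 2 ^ m) ^ t * ((2 : ℝ) ^ m) ^ d +
          3 ^ d * ((2 : ℝ) ^ m) ^ d * ((2 * A) ^ t * (σ * 2 ^ m) ^ t)) := by
        rw [← Real.mul_rpow (by positivity) (by positivity)]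
        gcongr
        exact hc m
    _ = 2 ^ t * (1 + 3 ^ d * (2 * A) ^ t) * ((σ * 2 ^ m) ^ t * ((2 : ℝ) ^ m) ^ d) := by ring
    _ ≤ 2 ^ t * (1 + 3 ^ d * (2 * A) ^ t) * ((σ * (2 * n)) ^ t * (2 * n : ℝ) ^ d) := by gcongr
    _ = W * σ ^ t * ((n : ℝ) ^ t * (n : ℝ) ^ d) := by
        rw [Real.mul_rpow hσ0.le (by positivity), Real.mul_rpow (x := 2) (y := n) (by norm_num)
          (by positivity), mul_pow, hW]
        ring
    _ = _ := by
        rw [hWσ, Real.mul_rpow hδ.le (by positivity)]; ring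

/-! ### The contribution of long jumps -/

/-- A dyadic decomposition: with N = 2^m n, averaged growth contributes (δN)^t N^d and the weight
N^{-d-2t}, leaving a multiple of (δ/n)^t 2^{-mt}, which is summable over m. -/
lemma sum_weighted_rpow_le {d : ℕ} {t : ℝ} (ht : 1 ≤ t) {f : Zd d → ℝ} {n : ℕ} (hn : 1 ≤ n)
    {δ : ℝ} (hδ : 0 ≤ δ)
    (hf : ∀ N : ℕ, n ≤ N → ∑ x ∈ cube d N, |f x| ^ t ≤ (δ * N) ^ t * (N : ℝ) ^ d)
    (S : Finset (Zd d)) :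
    ∑ y ∈ S, |f y| ^ t * (max ‖y‖ n) ^ (-(d + 2 * t)) ≤ 2 ^ (d + 2 * t) * 2 * (δ / n) ^ t := by
  set α : ℝ := d + 2 * t with hα
  have hα0 : 0 < α := by positivity
  have hn0 : (0 : ℝ) < n := by positivity
  have hex : ∀ y : Zd d, ∃ m : ℕ, ‖y‖ ≤ 2 ^ m * n := by
    intro y
    obtain ⟨m, hm⟩ := pow_unbounded_of_one_lt ‖y‖ (show (1 : ℝ) < 2 by norm_num)
    refine ⟨m, hm.le.trans (le_mul_of_one_le_right (by positivity) (by exact_mod_cast hn))⟩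
  classical
  set k : Zd d → ℕ := fun y => Nat.find (hex y) with hk
  have hk1 : ∀ y, ‖y‖ ≤ 2 ^ k y * n := fun y => Nat.find_spec (hex y)
  have hk2 : ∀ y, 2 ^ k y * n ≤ 2 * max ‖y‖ n := by
    intro y
    rcases Nat.eq_zero_or_pos (k y) with h | h
    · rw [h]; simp only [pow_zero, one_mul]
      linarith [le_max_right ‖y‖ n]
    · have := Nat.find_min (hex y) (m := k y - 1) (by simp only [hk] at h ⊢; omega)
      push Not at this
      obtain ⟨j, hj⟩ := Nat.exists_eq_succ_of_ne_zero h.ne'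
      rw [hj] at this ⊢
      simp only [Nat.succ_eq_add_one, Nat.add_sub_cancel, pow_succ] at this ⊢
      linarith [le_max_left ‖y‖ n]
  set M := S.sup k with hM
  have hpt : ∀ y ∈ S, |f y| ^ t * (max ‖y‖ n) ^ (-α) ≤
      ∑ m ∈ Finset.range (M + 1), if y ∈ cube d (2 ^ m * n) then
        |f y| ^ t * (2 ^ α * ((2 : ℝ) ^ m * n) ^ (-α)) else 0 := by
    intro y hy
    have hmem : k y ∈ Finset.range (M + 1) :=
      Finset.mem_range.2 (Nat.lt_succ_of_le (Finset.le_sup hy))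
    have hcube : y ∈ cube d (2 ^ k y * n) := by
      rw [mem_cube_iff_norm]; push_cast; exact hk1 y
    refine le_trans ?_ (Finset.single_le_sum (f := fun m => if y ∈ cube d (2 ^ m * n) then
        |f y| ^ t * (2 ^ α * ((2 : ℝ) ^ m * n) ^ (-α)) else 0) (fun m _ => ?_) hmem)
    · simp only [hcube, if_true]
      refine mul_le_mul_of_nonneg_left ?_ (by positivity)
      have hmax : 0 < max ‖y‖ n := lt_max_of_lt_right hn0
      calc (max ‖y‖ n) ^ (-α) = 2 ^ α * (2 * max ‖y‖ n) ^ (-α) := by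
            rw [Real.mul_rpow (by norm_num) hmax.le, ← mul_assoc, ← Real.rpow_add (by norm_num)]
            simp
        _ ≤ _ := by
            gcongr 2 ^ α * ?_
            exact Real.rpow_le_rpow_of_nonpos (by positivity) (hk2 y) (by linarith)
    · split_ifs <;> positivity
  calc _ ≤ ∑ y ∈ S, ∑ m ∈ Finset.range (M + 1), (if y ∈ cube d (2 ^ m * n) then
        |f y| ^ t * (2 ^ α * ((2 : ℝ) ^ m * n) ^ (-α)) else 0) := Finset.sum_le_sum hpt
    _ = ∑ m ∈ Finset.range (M + 1), ∑ y ∈ S with y ∈ cube d (2 ^ m * n),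
        |f y| ^ t * (2 ^ α * ((2 : ℝ) ^ m * n) ^ (-α)) := by
        rw [Finset.sum_comm]; simp_rw [Finset.sum_filter]
    _ ≤ ∑ m ∈ Finset.range (M + 1), 2 ^ α * (δ / n) ^ t * (1 / 2) ^ m := by
        refine Finset.sum_le_sum fun m _ => ?_
        rw [← Finset.sum_mul]
        have p2 : (0 : ℝ) < 2 ^ m := by positivity
        have i1 : ∑ y ∈ S with y ∈ cube d (2 ^ m * n), |f y| ^ t ≤
            (δ * (2 ^ m * n)) ^ t * ((2 : ℝ) ^ m * n) ^ d := by
          have := hf (2 ^ m * n) (Nat.le_mul_of_pos_left n (by positivity))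
          push_cast at this
          refine le_trans (Finset.sum_le_sum_of_subset_of_nonneg ?_ fun _ _ _ => by positivity) this
          intro y hy
          exact (Finset.mem_filter.1 hy).2
        calc _ ≤ (δ * (2 ^ m * n)) ^ t * ((2 : ℝ) ^ m * n) ^ d *
              (2 ^ α * ((2 : ℝ) ^ m * n) ^ (-α)) := by gcongr
          _ = 2 ^ α * (δ / n) ^ t * ((2 : ℝ) ^ m) ^ (-t) := by
              have P : (0 : ℝ) < 2 ^ m * n := by positivity
              rw [Real.mul_rpow hδ P.le, hα, Real.div_rpow hδ hn0.le,
                show -((d : ℝ) + 2 * t) = -t + -t + -d by ring, Real.rpow_add P, Real.rpow_add P,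
                Real.rpow_neg P.le d, Real.rpow_natCast, Real.rpow_neg P.le,
                Real.rpow_neg p2.le, Real.mul_rpow p2.le hn0.le]
              field_simp
          _ ≤ _ := by
              gcongr
              rw [one_div, inv_pow, Real.rpow_neg p2.le]
              gcongr
              conv_lhs => rw [← Real.rpow_one ((2 : ℝ) ^ m)]
              exact Real.rpow_le_rpow_of_exponent_le (one_le_pow₀ (by norm_num)) ht
    _ = 2 ^ α * (δ / n) ^ t * ∑ m ∈ Finset.range (M + 1), (1 / 2 : ℝ) ^ m := by
        rw [Finset.mul_sum]
    _ ≤ 2 ^ α * (δ / n) ^ t * 2 := by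
        gcongr
        exact sum_geometric_two_le _
    _ = _ := by ring

/-- Bound on the contribution of long jumps, for a function that is sublinear on average. -/
lemma exists_sum_long_jump_le (d : ℕ) {s t : ℝ} (hst : s.HolderConjugate t) :
    ∃ K : ℝ, 0 < K ∧ ∀ (C : Zd d → Zd d → ℝ) (M : Zd d → ℝ), (∀ x y, 0 ≤ C x y) →
      (∀ x, 0 ≤ M x) →
      (∀ x (Y : Finset (Zd d)), ∑ y ∈ Y, ‖y - x‖ ^ (d * (s - 1) + 2 * s) * C x y ^ s ≤ M x ^ s) →
      ∀ (f : Zd d → ℝ) (n : ℕ) (δ ρ : ℝ), 1 ≤ n → 0 ≤ δ → 0 < ρ → ρ ≤ 1 →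
      (∀ N : ℕ, n ≤ N → ∑ x ∈ cube d N, |f x| ^ t ≤ (δ * N) ^ t * (N : ℝ) ^ d) →
      ∀ (x : Zd d) (Y : Finset (Zd d)), ‖x‖ ≤ 2 * n → (∀ y ∈ Y, ρ * n / 2 < ‖y - x‖) →
        ∑ y ∈ Y, C x y * |f y| ≤ K * ρ⁻¹ ^ (d + 2 * t) * (δ / n) * M x := by
  have hs := hst.lt
  have ht := hst.symm.lt
  have hs0 := hst.pos
  have ht0 := hst.symm.pos
  set α : ℝ := d + 2 * t with hα
  have hα0 : 0 < α := by positivity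
  refine ⟨5 ^ α * (2 ^ α * 2) ^ (1 / t), by positivity, ?_⟩
  intro C M hC hM hCM f n δ ρ hn hδ hρ hρ1 hf x Y hx hY
  have hn0 : (0 : ℝ) < n := by positivity
  set w : ℝ := d * (s - 1) + 2 * s with hw
  have hpos : ∀ y ∈ Y, 0 < ‖y - x‖ := fun y hy => lt_trans (by positivity) (hY y hy)
  -- This identity dictates the exponent in μ̃_*: after Hölder, the dual weight is exactly the power
  -- d + 2t handled by `sum_weighted_rpow_le`.
  have hwt : w / s * t = α := by
    have h1 := hst.inv_add_inv_eq_one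
    have h2 : t = s / (s - 1) := by
      have : s - 1 ≠ 0 := by linarith
      field_simp at h1 ⊢; linarith
    have : s - 1 ≠ 0 := by linarith
    rw [hw, hα, h2]; field_simp
  have h1 : ∑ y ∈ Y, C x y * |f y| = ∑ y ∈ Y, (‖y - x‖ ^ (w / s) * C x y) *
      (|f y| * ‖y - x‖ ^ (-(w / s))) := by
    refine Finset.sum_congr rfl fun y hy => ?_
    rw [Real.rpow_neg (hpos y hy).le]
    have := Real.rpow_pos_of_pos (hpos y hy) (w / s)
    field_simp
  rw [h1]
  have h2 := Real.inner_le_Lp_mul_Lq_of_nonneg Y hst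
    (f := fun y => ‖y - x‖ ^ (w / s) * C x y) (g := fun y => |f y| * ‖y - x‖ ^ (-(w / s)))
    (fun y _ => mul_nonneg (by positivity) (hC x y)) (fun y _ => by positivity)
  have h3 : ∑ y ∈ Y, (‖y - x‖ ^ (w / s) * C x y) ^ s ≤ M x ^ s := by
    refine le_trans (le_of_eq (Finset.sum_congr rfl fun y _ => ?_)) (hCM x Y)
    rw [Real.mul_rpow (by positivity) (hC x y), ← Real.rpow_mul (norm_nonneg _),
      div_mul_cancel₀ _ hs0.ne']
  have h4 : ∑ y ∈ Y, (|f y| * ‖y - x‖ ^ (-(w / s))) ^ t ≤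
      (5 / ρ) ^ α * (2 ^ α * 2 * (δ / n) ^ t) := by
    calc _ ≤ ∑ y ∈ Y, (5 / ρ) ^ α * (|f y| ^ t * (max ‖y‖ n) ^ (-α)) := by
          refine Finset.sum_le_sum fun y hy => ?_
          rw [Real.mul_rpow (by positivity) (by positivity), ← Real.rpow_mul (norm_nonneg _),
            neg_mul, hwt, mul_left_comm]
          gcongr
          have hmax : 0 < max ‖y‖ n := lt_max_of_lt_right hn0
          -- Since ‖x‖ ≤ 2n and n ≤ (2/ρ)‖y - x‖, one gets ‖y‖ ≤ ‖y - x‖ + 2n ≤ (1/ρ + 4/ρ)‖y - x‖.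
          have i1 : max ‖y‖ n ≤ (5 / ρ) * ‖y - x‖ := by
            have j1 := hY y hy
            have j2 : (n : ℝ) ≤ 2 / ρ * ‖y - x‖ := by
              rw [div_mul_eq_mul_div, le_div_iff₀ hρ]; linarith
            have j3 : ‖y‖ ≤ ‖y - x‖ + ‖x‖ := by
              have := norm_add_le (y - x) x
              rwa [sub_add_cancel] at this
            have j4 : ‖y - x‖ ≤ 1 / ρ * ‖y - x‖ :=
              le_mul_of_one_le_left (norm_nonneg _) (by rw [le_div_iff₀ hρ]; linarith)
            have j5 : 5 / ρ * ‖y - x‖ = 1 / ρ * ‖y - x‖ + 2 * (2 / ρ * ‖y - x‖) := by ring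
            refine max_le ?_ ?_
            · linarith
            · have : 0 ≤ 1 / ρ * ‖y - x‖ := by positivity
              have : 0 ≤ 2 / ρ * ‖y - x‖ := by positivity
              linarith
          calc ‖y - x‖ ^ (-α) = (5 / ρ) ^ α * ((5 / ρ) * ‖y - x‖) ^ (-α) := by
                rw [Real.mul_rpow (by positivity) (norm_nonneg _), ← mul_assoc,
                  ← Real.rpow_add (by positivity)]
                simp
            _ ≤ _ := by
                gcongr (5 / ρ) ^ α * ?_
                exact Real.rpow_le_rpow_of_nonpos hmax i1 (by linarith)
      _ ≤ _ := by
          rw [← Finset.mul_sum]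
          gcongr
          exact sum_weighted_rpow_le ht.le hn hδ hf Y
  refine h2.trans ?_
  calc _ ≤ (M x ^ s) ^ (1 / s) * ((5 / ρ) ^ α * (2 ^ α * 2 * (δ / n) ^ t)) ^ (1 / t) := by
        have m0 := hM x
        have c0 : 0 ≤ ∑ y ∈ Y, (‖y - x‖ ^ (w / s) * C x y) ^ s :=
          Finset.sum_nonneg fun y _ => Real.rpow_nonneg
            (mul_nonneg (Real.rpow_nonneg (norm_nonneg _) _) (hC x y)) _
        gcongr
    _ = M x * (((5 / ρ) ^ α) ^ (1 / t) * ((2 ^ α * 2) ^ (1 / t) * (δ / n))) := by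
        rw [← Real.rpow_mul (hM x), mul_one_div_cancel hs0.ne', Real.rpow_one,
          Real.mul_rpow (by positivity) (by positivity),
          Real.mul_rpow (by positivity) (by positivity), ← Real.rpow_mul (x := δ / n)
          (by positivity), mul_one_div_cancel ht0.ne', Real.rpow_one]
    _ ≤ M x * ((5 / ρ) ^ α * ((2 ^ α * 2) ^ (1 / t) * (δ / n))) := by
        have := hM x
        gcongr
        have i1 : (1 : ℝ) ≤ (5 / ρ) ^ α :=
          Real.one_le_rpow (by rw [le_div_iff₀ hρ]; linarith) hα0.le
        conv_rhs => rw [← Real.rpow_one ((5 / ρ) ^ α)]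
        refine Real.rpow_le_rpow_of_exponent_le i1 ?_
        rw [div_le_one ht0]; exact ht.le
    _ = _ := by
        rw [div_eq_mul_inv 5 ρ, Real.mul_rpow (by norm_num) (by positivity)]; ring

/-! ### Caccioppoli estimate for truncations -/

/-- The discrete Caccioppoli identity: with (b - a) in place of (fb - fa) both sides agree. The
negative parts of fa - k and fb - k only increase the right-hand side, because each has zero product
with its own positive part. -/
lemma cutoff_test_le {a b α β k fa fb : ℝ} (ha : a = max (fa - k) 0) (hb : b = max (fb - k) 0) :
    (β * b - α * a) ^ 2 - a * b * (β - α) ^ 2 ≤ (fb - fa) * (β * (β * b) - α * (α * a)) := by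
  have ha0 : 0 ≤ a := ha ▸ le_max_right _ _
  have hb0 : 0 ≤ b := hb ▸ le_max_right _ _
  obtain ⟨wa, hwa, hwa0, hwa'⟩ : ∃ w, fa - k = a - w ∧ 0 ≤ w ∧ w * a = 0 := by
    refine ⟨a - (fa - k), by ring, ?_, ?_⟩
    · rw [ha]; linarith [le_max_left (fa - k) 0]
    · rw [ha]; rcases max_cases (fa - k) 0 with ⟨h, _⟩ | ⟨h, _⟩ <;> rw [h] <;> ring
  obtain ⟨wb, hwb, hwb0, hwb'⟩ : ∃ w, fb - k = b - w ∧ 0 ≤ w ∧ w * b = 0 := by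
    refine ⟨b - (fb - k), by ring, ?_, ?_⟩
    · rw [hb]; linarith [le_max_left (fb - k) 0]
    · rw [hb]; rcases max_cases (fb - k) 0 with ⟨h, _⟩ | ⟨h, _⟩ <;> rw [h] <;> ring
  have e : fb - fa = (b - wb) - (a - wa) := by linarith
  rw [e]
  have h1 : 0 ≤ β ^ 2 * (wa * b) := by positivity
  have h2 : 0 ≤ α ^ 2 * (wb * a) := by positivity
  nlinarith [h1, h2, congrArg (fun z => β ^ 2 * z) hwb', congrArg (fun z => α ^ 2 * z) hwa']

/-- The cross term between the linear part and the test function. Splitting the product difference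
symmetrically, the increment of the test function is absorbed by Young's inequality into half of the
energy, and the increment of the cutoff is bounded by its Lipschitz constant. The indicators record
that the Young error arises only where the truncation survives. -/
lemma linear_test_le {a b α β z D Λ : ℝ} (ha : 0 ≤ a) (hb : 0 ≤ b) (hα : 0 ≤ α) (hα1 : α ≤ 1)
    (hβ : 0 ≤ β) (hβ1 : β ≤ 1) (hz : |z| ≤ D) (hΛ : |β - α| ≤ Λ * D) :
    -(z * (β * (β * b) - α * (α * a))) ≤ 1 / 2 * (β * b - α * a) ^ 2 +
      1 / 2 * D ^ 2 * ((if α * a ≠ 0 then 1 else 0) + (if β * b ≠ 0 then 1 else 0)) +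
      1 / 2 * Λ * D ^ 2 * (α * a + β * b) := by
  have hD : 0 ≤ D := (abs_nonneg z).trans hz
  have hg : 0 ≤ α * a := by positivity
  have hh : 0 ≤ β * b := by positivity
  set g := α * a
  set h := β * b
  have e : β * h - α * g = 1 / 2 * (β + α) * (h - g) + 1 / 2 * (β - α) * (h + g) := by ring
  have i1 : -(z * (1 / 2 * (β - α) * (h + g))) ≤ 1 / 2 * Λ * D ^ 2 * (g + h) := by
    have : |z * (β - α)| ≤ D * (Λ * D) := by
      rw [abs_mul]
      exact mul_le_mul hz hΛ (abs_nonneg _) hD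
    have := (neg_le_abs (z * (β - α))).trans this
    nlinarith
  have i2 : -(z * (1 / 2 * (β + α) * (h - g))) ≤ 1 / 2 * (h - g) ^ 2 +
      1 / 2 * D ^ 2 * ((if g ≠ 0 then 1 else 0) + (if h ≠ 0 then 1 else 0)) := by
    by_cases hz0 : g = 0 ∧ h = 0
    · simp [hz0.1, hz0.2]
    · have i3 : (1 : ℝ) ≤ (if g ≠ 0 then 1 else 0) + (if h ≠ 0 then 1 else 0) := by
        by_cases h1 : g = 0
        · have h2 : h ≠ 0 := fun h' => hz0 ⟨h1, h'⟩
          simp [h1, h2]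
        · simp only [ne_eq, h1, not_false_eq_true, if_true]
          split_ifs <;> norm_num
      have i4 : -(z * (1 / 2 * (β + α) * (h - g))) ≤ D * |h - g| := by
        have : |z * (1 / 2 * (β + α) * (h - g))| ≤ D * (1 * |h - g|) := by
          rw [abs_mul, abs_mul]
          gcongr
          rw [abs_of_nonneg (by positivity)]; linarith
        have h3 := (neg_le_abs _).trans this
        linarith
      have i5 : D * |h - g| ≤ 1 / 2 * (h - g) ^ 2 + 1 / 2 * D ^ 2 := by
        rw [← sq_abs (h - g)]
        nlinarith [sq_nonneg (D - |h - g|)]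
      have i6 : 1 / 2 * D ^ 2 * 1 ≤ 1 / 2 * D ^ 2 *
          ((if g ≠ 0 then 1 else 0) + (if h ≠ 0 then 1 else 0)) := by
        gcongr
      linarith
  rw [e]
  linarith [mul_add z (1 / 2 * (β + α) * (h - g)) (1 / 2 * (β - α) * (h + g))]

/-- Stated along finite sets so that the energy identity needs no a priori summability of the full
double sum. -/
lemma sum_edgeEnergy_le {d : ℕ} {C : Zd d → Zd d → ℝ} (hC : ∀ x y, 0 ≤ C x y) (g : Zd d → ℝ)
    (V : Finset (Zd d)) :
    ∀ᶠ Y : Finset (Zd d) in atTop, ∑ x ∈ V, edgeEnergy C g x ≤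
      ∑ x ∈ Y, ∑ y ∈ Y, C x y * (g y - g x) ^ 2 := by
  classical
  filter_upwards [eventually_ge_atTop
    (V ∪ V.biUnion fun x => Finset.univ.image fun i => x + Pi.single i 1)] with Y hY
  have h0 : ∀ x y, 0 ≤ C x y * (g y - g x) ^ 2 := fun x y => mul_nonneg (hC x y) (sq_nonneg _)
  have hV : V ⊆ Y := Finset.subset_union_left.trans hY
  refine (Finset.sum_le_sum fun x hx => ?_).trans (Finset.sum_le_sum_of_subset_of_nonneg hV
    fun x _ _ => Finset.sum_nonneg fun y _ => h0 x y)
  have hinj : Set.InjOn (fun i : Fin d => x + Pi.single i (1 : ℤ))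
      (Finset.univ : Finset (Fin d)) := by
    intro i _ j _ hij
    have := add_left_cancel hij
    by_contra hne
    have h2 := congrFun this i
    simp [Pi.single_eq_of_ne hne] at h2
  have : edgeEnergy C g x = ∑ y ∈ Finset.univ.image fun i => x + Pi.single i 1,
      C x y * (g y - g x) ^ 2 := by
    rw [Finset.sum_image hinj]; rfl
  rw [this]
  refine Finset.sum_le_sum_of_subset_of_nonneg ?_ fun y _ _ => h0 x y
  intro y hy
  exact hY (Finset.mem_union_right _ (Finset.mem_biUnion.2 ⟨x, hx, hy⟩))

/-- Energy estimate for the truncations `(f - k)₊` of a function such that `ℓ + f` is harmonic. -/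
theorem sum_edgeEnergy_cutoff_le {d : ℕ} {C : Zd d → Zd d → ℝ} (hC : ∀ x y, 0 ≤ C x y)
    (hsymm : ∀ x y, C x y = C y x) {f l : Zd d → ℝ} (hl : ∀ x y, |l y - l x| ≤ ‖y - x‖)
    (hharm : ∀ x, HasSum (fun y => C x y * ((l y + f y) - (l x + f x))) 0)
    {μ T : Zd d → ℝ} (hμ : ∀ x (Y : Finset (Zd d)), ∑ y ∈ Y, ‖y - x‖ ^ 2 * C x y ≤ μ x)
    (hT0 : ∀ x, 0 ≤ T x) {k Λ ρ : ℝ} (hΛ : 0 ≤ Λ) (hρ : 0 ≤ ρ)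
    {η : Zd d → ℝ} (hη0 : ∀ x, 0 ≤ η x) (hη1 : ∀ x, η x ≤ 1)
    (hηΛ : ∀ x y, |η y - η x| ≤ Λ * ‖y - x‖) {S Q : Finset (Zd d)}
    (hηS : ∀ x, η x ≠ 0 → x ∈ S) (hSQ : ∀ x ∈ S, ∀ y, ‖y - x‖ ≤ ρ → y ∈ Q)
    {v : Zd d → ℝ} (hv : ∀ x, v x = max (f x - k) 0)
    (hT : ∀ x ∈ S, ∀ Y : Finset (Zd d), (∀ y ∈ Y, ρ < ‖y - x‖) → ∑ y ∈ Y, C x y * v y ≤ T x)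
    (V : Finset (Zd d)) :
    ∑ x ∈ V, edgeEnergy C (fun x => η x * v x) x ≤
      4 * ∑ x ∈ Q, if 0 < v x then
        1 / 2 * Λ ^ 2 * v x ^ 2 * μ x + v x * T x + 1 / 2 * μ x + 1 / 2 * Λ * v x * μ x else 0 := by
  classical
  have hμ0 : ∀ x, 0 ≤ μ x := fun x => by simpa using hμ x ∅
  have hv0 : ∀ x, 0 ≤ v x := fun x => (hv x).symm ▸ le_max_right _ _
  set g : Zd d → ℝ := fun x => η x * v x with hg
  have hg0 : ∀ x, 0 ≤ g x := fun x => mul_nonneg (hη0 x) (hv0 x)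
  set u : Zd d → ℝ := fun x => l x + f x with hu
  set B : Zd d → Zd d → ℝ := fun x y => C x y *
    (1 / 2 * Λ ^ 2 * ‖y - x‖ ^ 2 * (if x ∈ Q then v x ^ 2 else 0) +
      (if x ∈ S then v x else 0) * (if ρ < ‖y - x‖ then v y else 0) +
      1 / 2 * ‖y - x‖ ^ 2 * (if g x ≠ 0 then 1 else 0) +
      1 / 2 * Λ * ‖y - x‖ ^ 2 * g x) with hB
  set β : Zd d → ℝ := fun x => 1 / 2 * Λ ^ 2 * (if x ∈ Q then v x ^ 2 else 0) * μ x +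
      (if x ∈ S then v x else 0) * T x + 1 / 2 * (if g x ≠ 0 then 1 else 0) * μ x +
      1 / 2 * Λ * g x * μ x with hβ
  have hSQ' : S ⊆ Q := fun x hx => hSQ x hx x (by simpa using hρ)
  have hpair : ∀ x y, 1 / 2 * (C x y * (g y - g x) ^ 2) ≤
      C x y * (u y - u x) * (η y * g y - η x * g x) + (B x y + B y x) := by
    intro x y
    have j1 := cutoff_test_le (α := η x) (β := η y) (hv x) (hv y)
    have j2 := linear_test_le (hv0 x) (hv0 y) (hη0 x) (hη1 x) (hη0 y) (hη1 y) (hl x y) (hηΛ x y)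
    -- The cutoff error. For jumps up to ρ, the Lipschitz bound and v x v y ≤ (v x² + v y²)/2
    -- suffice. For longer jumps the product is kept and the far value is summed against C, which
    -- gives T.
    have j3 : v x * v y * (η y - η x) ^ 2 ≤
        1 / 2 * Λ ^ 2 * ‖y - x‖ ^ 2 * (if x ∈ Q then v x ^ 2 else 0) +
        (if x ∈ S then v x else 0) * (if ρ < ‖y - x‖ then v y else 0) +
        (1 / 2 * Λ ^ 2 * ‖y - x‖ ^ 2 * (if y ∈ Q then v y ^ 2 else 0) +
        (if y ∈ S then v y else 0) * (if ρ < ‖y - x‖ then v x else 0)) := by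
      have hx0 := hv0 x
      have hy0 := hv0 y
      have p1 : 0 ≤ 1 / 2 * Λ ^ 2 * ‖y - x‖ ^ 2 * (if x ∈ Q then v x ^ 2 else 0) := by
        split_ifs <;> positivity
      have p2 : 0 ≤ 1 / 2 * Λ ^ 2 * ‖y - x‖ ^ 2 * (if y ∈ Q then v y ^ 2 else 0) := by
        split_ifs <;> positivity
      by_cases hS : x ∈ S ∨ y ∈ S
      · by_cases hfar : ρ < ‖y - x‖
        · have q1 : (η y - η x) ^ 2 ≤ 1 := by
            rw [sq_le_one_iff_abs_le_one, abs_le]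
            constructor <;> linarith [hη0 x, hη0 y, hη1 x, hη1 y]
          have q2 : v x * v y * (η y - η x) ^ 2 ≤ v x * v y := by
            exact mul_le_of_le_one_right (by positivity) q1
          simp only [hfar, if_true]
          have q3 : v x * v y ≤ (if x ∈ S then v x else 0) * v y +
              (if y ∈ S then v y else 0) * v x := by
            rcases hS with h | h
            · simp only [h, if_true]
              have : 0 ≤ (if y ∈ S then v y else 0) * v x := by split_ifs <;> positivity
              linarith
            · simp only [h, if_true]
              have : 0 ≤ (if x ∈ S then v x else 0) * v y := by split_ifs <;> positivity
              linarith
          linarith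
        · have hxy : x ∈ Q ∧ y ∈ Q := by
            rcases hS with h | h
            · exact ⟨hSQ' h, hSQ x h y (not_lt.1 hfar)⟩
            · exact ⟨hSQ y h x (by rw [norm_sub_rev]; exact not_lt.1 hfar), hSQ' h⟩
          simp only [hxy.1, hxy.2, hfar, if_true, if_false, mul_zero, add_zero]
          have q1 : (η y - η x) ^ 2 ≤ (Λ * ‖y - x‖) ^ 2 := by
            rw [← sq_abs]
            exact pow_le_pow_left₀ (abs_nonneg _) (hηΛ x y) 2
          have q2 : v x * v y ≤ 1 / 2 * (v x ^ 2 + v y ^ 2) := by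
            nlinarith [sq_nonneg (v x - v y)]
          calc _ ≤ 1 / 2 * (v x ^ 2 + v y ^ 2) * (Λ * ‖y - x‖) ^ 2 := by gcongr
            _ = _ := by ring
      · have hx : η x = 0 := by_contra fun h => hS (Or.inl (hηS x h))
        have hy : η y = 0 := by_contra fun h => hS (Or.inr (hηS y h))
        have hx1 : x ∉ S := fun h => hS (Or.inl h)
        have hy1 : y ∉ S := fun h => hS (Or.inr h)
        simp only [hx, hy, hx1, hy1, if_false, zero_mul, sub_self, ne_eq, OfNat.ofNat_ne_zero,
          not_false_eq_true, zero_pow, mul_zero, add_zero]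
        positivity
    have e : u y - u x = (f y - f x) + (l y - l x) := by simp only [hu]; ring
    have j4 : 1 / 2 * (g y - g x) ^ 2 ≤ (u y - u x) * (η y * g y - η x * g x) +
        ((1 / 2 * Λ ^ 2 * ‖y - x‖ ^ 2 * (if x ∈ Q then v x ^ 2 else 0) +
        (if x ∈ S then v x else 0) * (if ρ < ‖y - x‖ then v y else 0) +
        1 / 2 * ‖y - x‖ ^ 2 * (if g x ≠ 0 then 1 else 0) +
        1 / 2 * Λ * ‖y - x‖ ^ 2 * g x) +
        (1 / 2 * Λ ^ 2 * ‖y - x‖ ^ 2 * (if y ∈ Q then v y ^ 2 else 0) +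
        (if y ∈ S then v y else 0) * (if ρ < ‖y - x‖ then v x else 0) +
        1 / 2 * ‖y - x‖ ^ 2 * (if g y ≠ 0 then 1 else 0) +
        1 / 2 * Λ * ‖y - x‖ ^ 2 * g y)) := by
      rw [e, add_mul]
      simp only [hg] at *
      linarith
    have j5 := mul_le_mul_of_nonneg_left j4 (hC x y)
    simp only [hB]
    rw [← hsymm x y, norm_sub_rev x y]
    refine le_trans (le_of_eq ?_) (j5.trans (le_of_eq ?_)) <;> ring
  have hBβ : ∀ x (Y : Finset (Zd d)), ∑ y ∈ Y, B x y ≤ β x := by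
    intro x Y
    have s1 : ∑ y ∈ Y, B x y = (1 / 2 * Λ ^ 2 * (if x ∈ Q then v x ^ 2 else 0) +
        1 / 2 * (if g x ≠ 0 then 1 else 0) + 1 / 2 * Λ * g x) * ∑ y ∈ Y, ‖y - x‖ ^ 2 * C x y +
        (if x ∈ S then v x else 0) * ∑ y ∈ Y with ρ < ‖y - x‖, C x y * v y := by
      rw [Finset.mul_sum, Finset.sum_filter, Finset.mul_sum, ← Finset.sum_add_distrib]
      refine Finset.sum_congr rfl fun y _ => ?_
      simp only [hB]
      by_cases h : ρ < ‖y - x‖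
      · simp only [h, if_true]; ring
      · simp only [h, if_false]; ring
    have s2 : 0 ≤ 1 / 2 * Λ ^ 2 * (if x ∈ Q then v x ^ 2 else 0) +
        1 / 2 * (if g x ≠ 0 then 1 else 0) + 1 / 2 * Λ * g x := by
      have := hg0 x
      have p1 : (0 : ℝ) ≤ if x ∈ Q then v x ^ 2 else 0 := by split_ifs <;> positivity
      have p2 : (0 : ℝ) ≤ if g x ≠ 0 then 1 else 0 := by split_ifs <;> positivity
      positivity
    have s3 : (if x ∈ S then v x else 0) * ∑ y ∈ Y with ρ < ‖y - x‖, C x y * v y ≤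
        (if x ∈ S then v x else 0) * T x := by
      by_cases hx : x ∈ S
      · simp only [hx, if_true]
        refine mul_le_mul_of_nonneg_left ?_ (hv0 x)
        exact hT x hx _ fun y hy => (Finset.mem_filter.1 hy).2
      · simp [hx]
    have s4 := mul_le_mul_of_nonneg_left (hμ x Y) s2
    rw [s1]
    simp only [hβ]
    linarith
  have hβ0 : ∀ x, 0 ≤ β x := fun x => by simpa using hBβ x ∅
  have hζS : ∀ x ∉ S, η x * g x = 0 := fun x hx => by
    have : η x = 0 := by_contra fun h => hx (hηS x h)
    simp [this]
  have hβQ : ∀ x ∉ Q, β x = 0 := fun x hx => by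
    have h1 : x ∉ S := fun h => hx (hSQ' h)
    have h2 : η x = 0 := by_contra fun h => h1 (hηS x h)
    simp [hβ, hg, hx, h1, h2]
  -- Summation by parts on Y × Y is exact by symmetry of C. The flux is tested only at points of the
  -- finite set S, so harmonicity makes it vanish as Y exhausts the lattice.
  have hev : ∀ᶠ Y : Finset (Zd d) in atTop, 1 / 2 * ∑ x ∈ V, edgeEnergy C g x ≤
      -2 * ∑ x ∈ S, η x * g x * (∑ y ∈ Y, C x y * (u y - u x)) + 2 * ∑ x ∈ Q, β x := by
    filter_upwards [sum_edgeEnergy_le hC g V, eventually_ge_atTop S] with Y hY hSY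
    have t1 : ∑ x ∈ Y, ∑ y ∈ Y, 1 / 2 * (C x y * (g y - g x) ^ 2) ≤
        ∑ x ∈ Y, ∑ y ∈ Y, (C x y * (u y - u x) * (η y * g y - η x * g x) + (B x y + B y x)) :=
      Finset.sum_le_sum fun x _ => Finset.sum_le_sum fun y _ => hpair x y
    have t2 : ∑ x ∈ Y, ∑ y ∈ Y, C x y * (u y - u x) * (η y * g y - η x * g x) =
        -2 * ∑ x ∈ Y, η x * g x * (∑ y ∈ Y, C x y * (u y - u x)) := by
      have : ∑ x ∈ Y, ∑ y ∈ Y, C x y * (u y - u x) * (η y * g y) =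
          - ∑ x ∈ Y, ∑ y ∈ Y, C x y * (u y - u x) * (η x * g x) := by
        rw [Finset.sum_comm, ← Finset.sum_neg_distrib]
        refine Finset.sum_congr rfl fun x _ => ?_
        rw [← Finset.sum_neg_distrib]
        refine Finset.sum_congr rfl fun y _ => ?_
        rw [hsymm y x]; ring
      simp_rw [mul_sub, Finset.sum_sub_distrib]
      simp_rw [mul_sub] at this
      rw [this, Finset.mul_sum, ← Finset.sum_neg_distrib, ← Finset.sum_sub_distrib]
      refine Finset.sum_congr rfl fun x _ => ?_
      rw [← Finset.sum_sub_distrib, ← Finset.sum_mul]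
      ring
    have t3 : ∑ x ∈ Y, η x * g x * (∑ y ∈ Y, C x y * (u y - u x)) =
        ∑ x ∈ S, η x * g x * (∑ y ∈ Y, C x y * (u y - u x)) :=
      (Finset.sum_subset hSY fun x _ hx => by rw [hζS x hx, zero_mul]).symm
    have t4 : ∑ x ∈ Y, ∑ y ∈ Y, B x y ≤ ∑ x ∈ Q, β x := by
      refine (Finset.sum_le_sum fun x _ => hBβ x Y).trans ?_
      calc _ ≤ ∑ x ∈ Q ∪ Y, β x := Finset.sum_le_sum_of_subset_of_nonneg
            Finset.subset_union_right fun x _ _ => hβ0 x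
        _ = _ := (Finset.sum_subset Finset.subset_union_left fun x _ hx => hβQ x hx).symm
    have t5 : ∑ x ∈ Y, ∑ y ∈ Y, B y x = ∑ x ∈ Y, ∑ y ∈ Y, B x y := Finset.sum_comm
    simp_rw [Finset.sum_add_distrib, ← Finset.mul_sum] at t1
    rw [t2, t3, t5] at t1
    linarith
  have hlim : Tendsto (fun Y : Finset (Zd d) =>
      -2 * ∑ x ∈ S, η x * g x * (∑ y ∈ Y, C x y * (u y - u x)) + 2 * ∑ x ∈ Q, β x) atTop
      (𝓝 (-2 * ∑ x ∈ S, η x * g x * 0 + 2 * ∑ x ∈ Q, β x)) := by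
    refine Tendsto.add_const _ (Tendsto.const_mul _ ?_)
    exact tendsto_finsetSum _ fun x _ => (hharm x).const_mul _
  have hfin := ge_of_tendsto hlim hev
  simp only [mul_zero, Finset.sum_const_zero, zero_add] at hfin
  have hβle : ∑ x ∈ Q, β x ≤ ∑ x ∈ Q, if 0 < v x then
      1 / 2 * Λ ^ 2 * v x ^ 2 * μ x + v x * T x + 1 / 2 * μ x + 1 / 2 * Λ * v x * μ x else 0 := by
    refine Finset.sum_le_sum fun x hx => ?_
    rcases (hv0 x).eq_or_lt with h | h
    · simp [hβ, hg, ← h]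
    · simp only [hβ, h, if_true, hx]
      have m0 := hμ0 x
      have T0 := hT0 x
      have g1 : g x ≤ v x := mul_le_of_le_one_left h.le (hη1 x)
      have k1 : (if x ∈ S then v x else 0) ≤ v x := by split_ifs <;> linarith
      have k2 : (if g x ≠ 0 then (1 : ℝ) else 0) ≤ 1 := by split_ifs <;> norm_num
      have l1 : (if x ∈ S then v x else 0) * T x ≤ v x * T x := by gcongr
      have l2 : 1 / 2 * (if g x ≠ 0 then (1 : ℝ) else 0) * μ x ≤ 1 / 2 * 1 * μ x := by gcongr
      have l3 : 1 / 2 * Λ * g x * μ x ≤ 1 / 2 * Λ * v x * μ x := by gcongr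
      linarith
  linarith

/-! ### De Giorgi iteration in a fixed environment -/

/-- Deterministic conductances with spatially averaged moment bounds. -/
structure HasMomentBounds {d : ℕ} (p q κ : ℝ) (C : Zd d → Zd d → ℝ) (μ ν M : Zd d → ℝ) : Prop where
  nonneg : ∀ x y, 0 ≤ C x y
  symm : ∀ x y, C x y = C y x
  ν_nonneg : ∀ x, 0 ≤ ν x
  M_nonneg : ∀ x, 0 ≤ M x
  one_le : ∀ x i, 1 ≤ ν x * C x (x + Pi.single i 1)
  sum_ν : ∀ n : ℕ, 1 ≤ n → ∑ x ∈ cube d n, ν x ^ q ≤ κ * (n : ℝ) ^ d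
  sum_le_μ : ∀ x (Y : Finset (Zd d)), ∑ y ∈ Y, ‖y - x‖ ^ 2 * C x y ≤ μ x
  sum_μ : ∀ n : ℕ, 1 ≤ n → ∑ x ∈ cube d n, μ x ^ p ≤ κ * (n : ℝ) ^ d
  sum_le_M : ∀ x (Y : Finset (Zd d)), ∑ y ∈ Y, ‖y - x‖ ^ (d * (2 * p / (p + 1) - 1) +
    2 * (2 * p / (p + 1))) * C x y ^ (2 * p / (p + 1)) ≤ M x ^ (2 * p / (p + 1))
  sum_M : ∀ n : ℕ, 1 ≤ n → ∑ x ∈ cube d n, M x ^ p ≤ κ * (n : ℝ) ^ d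

/-- A piecewise linear cutoff between the radii `R` and `R + r`. -/
noncomputable def cutoff {d : ℕ} (R r : ℝ) (x : Zd d) : ℝ := max 0 (min 1 ((R + r - ‖x‖) / r))

lemma cutoff_nonneg {d : ℕ} (R r : ℝ) (x : Zd d) : 0 ≤ cutoff R r x := le_max_left _ _

lemma cutoff_le_one {d : ℕ} (R r : ℝ) (x : Zd d) : cutoff R r x ≤ 1 :=
  max_le zero_le_one (min_le_left _ _)

lemma cutoff_eq_one {d : ℕ} {R r : ℝ} (hr : 0 < r) {x : Zd d} (hx : ‖x‖ ≤ R) :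
    cutoff R r x = 1 := by
  have : 1 ≤ (R + r - ‖x‖) / r := by rw [le_div_iff₀ hr]; linarith
  simp [cutoff, min_eq_left this]

lemma norm_le_of_cutoff_ne_zero {d : ℕ} {R r : ℝ} (hr : 0 < r) {x : Zd d}
    (hx : cutoff R r x ≠ 0) : ‖x‖ ≤ R + r := by
  by_contra! h
  refine hx (max_eq_left ((min_le_right _ _).trans ?_))
  exact div_nonpos_of_nonpos_of_nonneg (by linarith) hr.le

lemma abs_cutoff_sub_le {d : ℕ} {R r : ℝ} (hr : 0 < r) (x y : Zd d) :
    |cutoff R r y - cutoff R r x| ≤ r⁻¹ * ‖y - x‖ := by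
  have h1 : ∀ a b : ℝ, |max 0 (min 1 b) - max 0 (min 1 a)| ≤ |b - a| := by
    intro a b
    have h1 := abs_max_sub_max_le_abs (min 1 b) (min 1 a) 0
    have h2 := abs_min_sub_min_le_max 1 b 1 a
    rw [max_comm 0, max_comm 0]
    refine h1.trans (h2.trans ?_)
    simp
  refine (h1 _ _).trans ?_
  rw [← sub_div, abs_div, abs_of_pos hr, div_eq_inv_mul]
  gcongr
  rw [show R + r - ‖y‖ - (R + r - ‖x‖) = ‖x‖ - ‖y‖ by ring, norm_sub_rev y x]
  exact abs_norm_sub_norm_le x y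

/-- The normalized `ℓ^t` norm of `(f - k)₊` over the ball of radius `R`. -/
noncomputable def excess {d : ℕ} (t : ℝ) (f : Zd d → ℝ) (n : ℕ) (ε k R : ℝ) : ℝ :=
  ((n : ℝ) ^ d)⁻¹ * ∑ x ∈ cube d (2 * n) with ‖x‖ ≤ R, (max (f x - k) 0 / (ε * n)) ^ t

lemma excess_nonneg {d : ℕ} (t : ℝ) (f : Zd d → ℝ) (n : ℕ) {ε : ℝ} (hε : 0 ≤ ε) (k R : ℝ) :
    0 ≤ excess t f n ε k R :=
  mul_nonneg (by positivity) (Finset.sum_nonneg fun x _ => by positivity)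

/-- Where the higher truncation is positive, the lower one, h, is at least the level gap L. So h / L
≥ 1, and the lower-order terms are all absorbed into the single power (h / L)^a with a ≥ 2. -/
lemma energy_density_le {m M v h L a ρ n K w : ℝ} (hm : 0 ≤ m) (hM : 0 ≤ M) (hv : 0 ≤ v)
    (hvh : v ≤ h) (hLh : L ≤ h) (hL : 0 < L) (ha : 2 ≤ a) (hρ : 0 < ρ) (hρ1 : ρ ≤ 1) (hn : 0 < n)
    (hLn : L ≤ ρ * n) (hK : 0 ≤ K) (hw : 1 ≤ w) :
    1 / 2 * (ρ * n / 2)⁻¹ ^ 2 * v ^ 2 * m + v * (K * w * (1 / n) * M) + 1 / 2 * m +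
      1 / 2 * (ρ * n / 2)⁻¹ * v * m ≤ (4 + K) * w * ((h / L) ^ a * (m + M)) := by
  set r := ρ * n / 2 with hr
  have hr0 : 0 < r := by positivity
  set H := h / L with hH
  have i2 : 1 ≤ H := by rw [hH, le_div_iff₀ hL]; linarith
  have i3 : v ≤ L * H := by rw [hH, mul_div_cancel₀ _ hL.ne']; exact hvh
  have i4 : H ^ 2 ≤ H ^ a := by
    rw [← Real.rpow_natCast]
    exact Real.rpow_le_rpow_of_exponent_le i2 (by exact_mod_cast ha)
  have i5 : H ≤ H ^ a := by
    refine le_trans ?_ i4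
    nlinarith
  have i6 : 1 ≤ H ^ a := i2.trans i5
  set G := H ^ a
  have i7 : r⁻¹ * v ≤ 2 * H := by
    rw [inv_mul_le_iff₀ hr0]
    refine i3.trans ?_
    calc L * H ≤ ρ * n * H := by gcongr
      _ = _ := by rw [hr]; ring
  have j1 : 1 / 2 * r⁻¹ ^ 2 * v ^ 2 * m ≤ 2 * (G * m) := by
    calc _ = 1 / 2 * (r⁻¹ * v) ^ 2 * m := by ring
      _ ≤ 1 / 2 * (2 * H) ^ 2 * m := by gcongr
      _ = 2 * (H ^ 2 * m) := by ring
      _ ≤ _ := by gcongr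
  have j2 : v * (K * w * (1 / n) * M) ≤ K * w * (G * M) := by
    have : v * (1 / n) ≤ G := by
      rw [mul_one_div, div_le_iff₀ hn]
      refine i3.trans ?_
      have : L ≤ n := hLn.trans (mul_le_of_le_one_left hn.le hρ1)
      rw [mul_comm G]
      gcongr
    calc _ = K * w * ((v * (1 / n)) * M) := by ring
      _ ≤ _ := by gcongr
  have j3 : 1 / 2 * m ≤ 1 * (G * m) := by
    have : 1 * m ≤ G * m := by gcongr
    linarith
  have j4 : 1 / 2 * r⁻¹ * v * m ≤ 1 * (G * m) := by
    calc _ = 1 / 2 * (r⁻¹ * v) * m := by ring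
      _ ≤ 1 / 2 * (2 * H) * m := by gcongr
      _ = H * m := by ring
      _ ≤ G * m := by gcongr
      _ = _ := by ring
  have j5 : 4 * (G * m) ≤ 4 * w * (G * m) := by
    have : 0 ≤ G * m := by positivity
    nlinarith
  have j6 : 0 ≤ K * w * (G * m) + 4 * w * (G * M) := by positivity
  linarith

set_option maxHeartbeats 1000000 in
/-- One step of the De Giorgi iteration. -/
theorem exists_excess_le (d : ℕ) (hd : 0 < d) {p q t κ : ℝ} (hp : 1 < p) (hq : 1 < q)
    (hκ : 0 ≤ κ) (ht : 2 * p / (p - 1) < t) (hdqt : (d : ℝ) / 2 + d / (2 * q) < 1 + d / t) :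
    ∃ A c : ℝ, 0 < A ∧ 0 < c ∧ ∀ (C : Zd d → Zd d → ℝ) (μ ν M : Zd d → ℝ),
      HasMomentBounds p q κ C μ ν M → ∀ (f l : Zd d → ℝ), (∀ x y, |l y - l x| ≤ ‖y - x‖) →
      (∀ x, HasSum (fun y => C x y * ((l y + f y) - (l x + f x))) 0) →
      ∀ n : ℕ, 1 ≤ n →
      (∀ N : ℕ, n ≤ N → ∑ x ∈ cube d N, |f x| ^ (2 * p / (p - 1)) ≤
        (1 * N : ℝ) ^ (2 * p / (p - 1)) * (N : ℝ) ^ d) →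
      ∀ ε ρ k R : ℝ, 0 < ε → ε ≤ 1 → 0 < ρ → ρ ≤ 1 → 0 ≤ k → n ≤ R - ρ * n → R ≤ 2 * n →
        excess t f n ε (k + ρ * (ε * n)) (R - ρ * n) ≤
          A * ε⁻¹ ^ t * ρ⁻¹ ^ c * excess t f n ε k R ^ (t / (2 * p / (p - 1))) := by
  have hp1 : 0 < p - 1 := by linarith
  have hp0 : 0 < p := by linarith
  set t₀ := 2 * p / (p - 1) with ht₀
  set s := 2 * p / (p + 1) with hs
  set p' := p / (p - 1) with hp'
  have hp'0 : 0 < p' := by positivity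
  have ht₀' : t₀ = 2 * p' := by rw [ht₀, hp']; ring
  have ht₀0 : 0 < t₀ := by positivity
  have ht₀2 : 2 < t₀ := by rw [ht₀, lt_div_iff₀ hp1]; linarith
  have ht0 : 0 < t := by linarith
  have ht2 : 2 ≤ t := by linarith
  have hst : s.HolderConjugate t₀ := by
    rw [Real.holderConjugate_iff]
    refine ⟨by rw [hs, lt_div_iff₀ (by positivity)]; linarith, ?_⟩
    rw [hs, ht₀]; field_simp; ring
  have hpp : p'.HolderConjugate p := by
    rw [Real.holderConjugate_iff]
    refine ⟨by rw [hp', lt_div_iff₀ hp1]; linarith, ?_⟩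
    rw [hp']; field_simp; ring
  obtain ⟨Ks, hKs, HS⟩ := exists_sum_cube_rpow_le d hq ht2 hd hdqt hκ
  obtain ⟨Kt, hKt, HT⟩ := exists_sum_long_jump_le d hst
  set α : ℝ := d + 2 * t₀ with hα
  have hα0 : 0 < α := by positivity
  -- Chosen so that Hölder with exponents p', p turns ∑ H^a (μ + M) into (∑ H^t)^{1/p'}; a ≥ 2
  -- because t > 2p'.
  set a := t / p' with ha
  have ha2 : 2 ≤ a := by rw [ha, le_div_iff₀ hp'0]; linarith
  set κ' : ℝ := 2 ^ p * (2 * κ * 2 ^ d) with hκ'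
  set A₁ : ℝ := 4 * (4 + Kt) * κ' ^ (1 / p) + 1 with hA₁
  have hA₁0 : 0 < A₁ := by positivity
  refine ⟨Ks * 2 ^ d * (4 * A₁) ^ (t / 2), (α + a) * (t / 2), by positivity, by positivity, ?_⟩
  intro C μ ν M hC f l hl hharm n hn hf ε ρ k R hε hε1 hρ hρ1 hk hR1 hR2
  have hn0 : (0 : ℝ) < n := by positivity
  set k' := k + ρ * (ε * n) with hk'
  set R' := R - ρ * n with hR'
  set L := ρ * (ε * n) with hL
  have hL0 : 0 < L := by positivity
  have hμ0 : ∀ x, 0 ≤ μ x := fun x => by simpa using hC.sum_le_μ x ∅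
  have hM0 := hC.M_nonneg
  -- Half of the gap between the radii: the cutoff is supported in R' + r, and jumps of length at
  -- most r from there end within R = R' + 2r.
  set r := ρ * n / 2 with hr
  have hr0 : 0 < r := by positivity
  set h : Zd d → ℝ := fun x => max (f x - k) 0 with hh
  set v : Zd d → ℝ := fun x => max (f x - k') 0 with hv
  have hh0 : ∀ x, 0 ≤ h x := fun x => le_max_right _ _
  have hv0 : ∀ x, 0 ≤ v x := fun x => le_max_right _ _
  set S := (cube d (2 * n)).filter fun x => ‖x‖ ≤ R' + r with hS
  set Q := (cube d (2 * n)).filter fun x => ‖x‖ ≤ R with hQ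
  set Y := excess t f n ε k R with hY
  have hY0 : 0 ≤ Y := excess_nonneg t f n hε.le k R
  set T : Zd d → ℝ := fun x => Kt * ρ⁻¹ ^ α * (1 / n) * M x with hT
  have hT0 : ∀ x, 0 ≤ T x := fun x => mul_nonneg (by positivity) (hM0 x)
  have hmemQ : ∀ x : Zd d, ‖x‖ ≤ R → x ∈ Q := fun x hx => by
    rw [hQ, Finset.mem_filter, mem_cube_iff_norm]
    exact ⟨by push_cast; linarith, hx⟩
  have hvf : ∀ y, v y ≤ |f y| := fun y =>
    max_le (by have := le_abs_self (f y); have : 0 ≤ k' := by positivity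
               linarith) (abs_nonneg _)
  have henergy := sum_edgeEnergy_cutoff_le hC.nonneg hC.symm hl hharm hC.sum_le_μ hT0
    (k := k') (Λ := r⁻¹) (ρ := r) (by positivity) hr0.le (η := cutoff R' r)
    (cutoff_nonneg R' r) (cutoff_le_one R' r) (abs_cutoff_sub_le hr0) (S := S) (Q := Q)
    (fun x hx => by
      have h1 := norm_le_of_cutoff_ne_zero hr0 hx
      rw [hS, Finset.mem_filter, mem_cube_iff_norm]
      refine ⟨?_, h1⟩
      push_cast
      have : R' + r ≤ R := by rw [hR', hr]; linarith [mul_pos hρ hn0]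
      linarith)
    (fun x hx y hy => by
      refine hmemQ y ?_
      have h1 := (Finset.mem_filter.1 hx).2
      have h2 := norm_add_le (y - x) x
      rw [sub_add_cancel] at h2
      have : R = R' + r + r := by rw [hR', hr]; ring
      linarith)
    (v := v) (fun x => rfl)
    (fun x hx Y hY => by
      have h1 := (mem_cube_iff_norm.1 (Finset.mem_filter.1 hx).1)
      push_cast at h1
      refine le_trans (Finset.sum_le_sum fun y _ => ?_)
        (HT C M hC.nonneg hM0 hC.sum_le_M f n 1 ρ hn zero_le_one hρ hρ1 hf x Y h1 hY)
      exact mul_le_mul_of_nonneg_left (hvf y) (hC.nonneg x y))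
    (cube d (96 * (2 * n)))
  -- bound the right-hand side
  set H : Zd d → ℝ := fun x => h x / L with hH
  have hH0 : ∀ x, 0 ≤ H x := fun x => div_nonneg (hh0 x) hL0.le
  have hρα : 1 ≤ ρ⁻¹ ^ α := Real.one_le_rpow ((one_le_inv₀ hρ).2 hρ1) hα0.le
  have hpt : ∀ x, (if 0 < v x then 1 / 2 * r⁻¹ ^ 2 * v x ^ 2 * μ x + v x * T x + 1 / 2 * μ x +
      1 / 2 * r⁻¹ * v x * μ x else 0) ≤ (4 + Kt) * ρ⁻¹ ^ α * (H x ^ a * (μ x + M x)) := by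
    intro x
    split_ifs with hvx
    · have hfx : k' < f x := by
        by_contra! hle
        have : v x = 0 := max_eq_right (by linarith)
        linarith
      have e1 : v x = f x - k' := max_eq_left (by linarith)
      have e2 : h x = f x - k := max_eq_left (by rw [hk'] at hfx; linarith)
      have i1 : v x ≤ h x := by rw [e1, e2, hk']; linarith
      have i2 : L ≤ h x := by rw [e2]; rw [hk'] at hfx; linarith
      have i3 : L ≤ ρ * n := by
        rw [hL]; gcongr; exact mul_le_of_le_one_left hn0.le hε1
      exact energy_density_le (hμ0 x) (hM0 x) (hv0 x) i1 i2 hL0 ha2 hρ hρ1 hn0 i3 hKt.le hρα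
    · have := hμ0 x
      have := hM0 x
      have := hH0 x
      positivity
  have hHt : ∑ x ∈ Q, H x ^ t = ρ⁻¹ ^ t * ((n : ℝ) ^ d * Y) := by
    have : (n : ℝ) ^ d * Y = ∑ x ∈ Q, (h x / (ε * n)) ^ t := by
      rw [hY, excess, ← mul_assoc, mul_inv_cancel₀ (by positivity), one_mul]
    rw [this, Finset.mul_sum]
    refine Finset.sum_congr rfl fun x _ => ?_
    rw [← Real.mul_rpow (by positivity) (div_nonneg (hh0 x) (by positivity))]
    congr 1
    rw [hH, hL]; field_simp
  have hsum : ∑ x ∈ Q, (μ x + M x) ^ p ≤ κ' * (n : ℝ) ^ d := by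
    calc _ ≤ ∑ x ∈ cube d (2 * n), (μ x + M x) ^ p :=
          Finset.sum_le_sum_of_subset_of_nonneg (Finset.filter_subset _ _)
            fun x _ _ => Real.rpow_nonneg (add_nonneg (hμ0 x) (hM0 x)) _
      _ ≤ ∑ x ∈ cube d (2 * n), 2 ^ p * (μ x ^ p + M x ^ p) := by
          refine Finset.sum_le_sum fun x _ => ?_
          have := abs_sub_rpow_le hp0.le (μ x) (-M x) 0
          rwa [sub_neg_eq_add, sub_zero, sub_zero, abs_neg, abs_of_nonneg (hμ0 x),
            abs_of_nonneg (hM0 x), abs_of_nonneg (add_nonneg (hμ0 x) (hM0 x))] at this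
      _ ≤ 2 ^ p * (κ * ((2 * n : ℕ) : ℝ) ^ d + κ * ((2 * n : ℕ) : ℝ) ^ d) := by
          rw [← Finset.mul_sum, Finset.sum_add_distrib]
          have h1 := hC.sum_μ (2 * n) (by omega)
          have h2 := hC.sum_M (2 * n) (by omega)
          gcongr
      _ = _ := by rw [hκ']; push_cast; rw [mul_pow]; ring
  have hholder : ∑ x ∈ Q, H x ^ a * (μ x + M x) ≤
      (ρ⁻¹ ^ t * ((n : ℝ) ^ d * Y)) ^ (1 / p') * (κ' * (n : ℝ) ^ d) ^ (1 / p) := by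
    refine (Real.inner_le_Lp_mul_Lq_of_nonneg Q hpp (f := fun x => H x ^ a)
      (g := fun x => μ x + M x) (fun x _ => Real.rpow_nonneg (hH0 x) _)
      (fun x _ => add_nonneg (hμ0 x) (hM0 x))).trans ?_
    have e1 : ∑ x ∈ Q, (H x ^ a) ^ p' = ρ⁻¹ ^ t * ((n : ℝ) ^ d * Y) := by
      rw [← hHt]
      refine Finset.sum_congr rfl fun x _ => ?_
      rw [← Real.rpow_mul (hH0 x), ha, div_mul_cancel₀ _ hp'0.ne']
    rw [e1]
    have : 0 ≤ ∑ x ∈ Q, (μ x + M x) ^ p :=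
      Finset.sum_nonneg fun x _ => Real.rpow_nonneg (add_nonneg (hμ0 x) (hM0 x)) _
    gcongr
  have hκ'0 : 0 ≤ κ' := by positivity
  have hE : ∑ x ∈ cube d (96 * (2 * n)), edgeEnergy C (fun x => cutoff R' r x * v x) x ≤
      A₁ * ρ⁻¹ ^ (α + a) * (n : ℝ) ^ d * Y ^ (1 / p') := by
    refine henergy.trans ?_
    calc _ ≤ 4 * ∑ x ∈ Q, (4 + Kt) * ρ⁻¹ ^ α * (H x ^ a * (μ x + M x)) := by
          gcongr with x; exact hpt x
      _ = 4 * (4 + Kt) * ρ⁻¹ ^ α * ∑ x ∈ Q, H x ^ a * (μ x + M x) := by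
          rw [← Finset.mul_sum]; ring
      _ ≤ 4 * (4 + Kt) * ρ⁻¹ ^ α *
          ((ρ⁻¹ ^ t * ((n : ℝ) ^ d * Y)) ^ (1 / p') * (κ' * (n : ℝ) ^ d) ^ (1 / p)) := by
          gcongr
      _ = 4 * (4 + Kt) * κ' ^ (1 / p) * (ρ⁻¹ ^ (α + a) * (n : ℝ) ^ d * Y ^ (1 / p')) := by
          have hnd : (0 : ℝ) < (n : ℝ) ^ d := by positivity
          have e1 : ((n : ℝ) ^ d) ^ (1 / p') * ((n : ℝ) ^ d) ^ (1 / p) = (n : ℝ) ^ d := by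
            rw [← Real.rpow_add hnd, hpp.one_div_add_one_div, div_one, Real.rpow_one]
          rw [Real.mul_rpow (by positivity) (by positivity), Real.mul_rpow hnd.le hY0,
            Real.mul_rpow hκ'0 hnd.le, ← Real.rpow_mul (by positivity), mul_one_div, ← ha,
            Real.rpow_add (by positivity) α a]
          calc _ = 4 * (4 + Kt) * κ' ^ (1 / p) * (ρ⁻¹ ^ α * ρ⁻¹ ^ a *
                (((n : ℝ) ^ d) ^ (1 / p') * ((n : ℝ) ^ d) ^ (1 / p)) * Y ^ (1 / p')) := by ring
            _ = _ := by rw [e1]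
      _ ≤ A₁ * (ρ⁻¹ ^ (α + a) * (n : ℝ) ^ d * Y ^ (1 / p')) := by
          gcongr; rw [hA₁]; linarith
      _ = _ := by ring
  have hsob := HS C ν hC.nonneg hC.ν_nonneg hC.one_le hC.sum_ν (2 * n)
    (fun x => cutoff R' r x * v x) (by omega) (fun x hx => by
      have : cutoff R' r x = 0 := by
        by_contra hne
        refine hx ?_
        have h1 := norm_le_of_cutoff_ne_zero hr0 hne
        rw [mem_cube_iff_norm]; push_cast
        have : R' + r ≤ R := by rw [hR', hr]; linarith [mul_pos hρ hn0]
        linarith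
      simp [this])
  have hE0 : 0 ≤ ∑ x ∈ cube d (96 * (2 * n)), edgeEnergy C (fun x => cutoff R' r x * v x) x :=
    Finset.sum_nonneg fun x _ => edgeEnergy_nonneg hC.nonneg _ _
  have hlow : (n : ℝ) ^ d * (ε * n) ^ t * excess t f n ε k' R' ≤
      ∑ x ∈ cube d (2 * n), |cutoff R' r x * v x| ^ t := by
    calc _ = (ε * n) ^ t * ∑ x ∈ cube d (2 * n) with ‖x‖ ≤ R', (v x / (ε * n)) ^ t := by
          rw [excess]
          have : (n : ℝ) ^ d ≠ 0 := by positivity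
          field_simp
          rfl
      _ = ∑ x ∈ cube d (2 * n) with ‖x‖ ≤ R', |cutoff R' r x * v x| ^ t := by
          rw [Finset.mul_sum]
          refine Finset.sum_congr rfl fun x hx => ?_
          rw [cutoff_eq_one hr0 (Finset.mem_filter.1 hx).2, one_mul, abs_of_nonneg (hv0 x),
            ← Real.mul_rpow (by positivity) (div_nonneg (hv0 x) (by positivity))]
          congr 1; field_simp
      _ ≤ _ := Finset.sum_le_sum_of_subset_of_nonneg (Finset.filter_subset _ _)
          fun x _ _ => by positivity
  have hP : (0 : ℝ) < (n : ℝ) ^ d * (ε * n) ^ t := by positivity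
  refine le_of_mul_le_mul_left (hlow.trans (hsob.trans ?_)) hP
  have e1 : (((2 * n : ℕ) : ℝ) ^ 2 * ((((2 * n : ℕ) : ℝ) ^ d)⁻¹ *
      ∑ x ∈ cube d (96 * (2 * n)), edgeEnergy C (fun x => cutoff R' r x * v x) x)) ≤
      (4 * A₁) * ρ⁻¹ ^ (α + a) * (n : ℝ) ^ 2 * Y ^ (1 / p') := by
    have : (((2 * n : ℕ) : ℝ) ^ d)⁻¹ ≤ ((n : ℝ) ^ d)⁻¹ := by
      gcongr; linarith
    calc _ ≤ ((2 * n : ℕ) : ℝ) ^ 2 * (((n : ℝ) ^ d)⁻¹ *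
          (A₁ * ρ⁻¹ ^ (α + a) * (n : ℝ) ^ d * Y ^ (1 / p'))) := by gcongr
      _ = _ := by
        have : (n : ℝ) ^ d ≠ 0 := by positivity
        push_cast; field_simp; ring
  calc _ ≤ Ks * ((2 * n : ℕ) : ℝ) ^ d *
        ((4 * A₁) * ρ⁻¹ ^ (α + a) * (n : ℝ) ^ 2 * Y ^ (1 / p')) ^ (t / 2) := by gcongr
    _ = _ := by
      have e2 : ((n : ℝ) ^ 2) ^ (t / 2) = (n : ℝ) ^ t := by
        rw [← Real.rpow_natCast, ← Real.rpow_mul hn0.le]; congr 1; push_cast; ring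
      -- The Sobolev power t/2 meets the Hölder power 1/p'. Since t₀ = 2p' < t, the resulting
      -- exponent exceeds 1.
      have e3 : (Y ^ (1 / p')) ^ (t / 2) = Y ^ (t / t₀) := by
        rw [← Real.rpow_mul hY0]; congr 1; rw [ht₀']; field_simp
      rw [Real.mul_rpow (by positivity) (by positivity), Real.mul_rpow (by positivity)
        (by positivity), Real.mul_rpow (by positivity) (by positivity), e2, e3,
        ← Real.rpow_mul (by positivity), Real.mul_rpow hε.le hn0.le, Real.inv_rpow hε.le]
      push_cast
      have : ε ^ t ≠ 0 := by positivity
      rw [mul_pow]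
      field_simp

/-- Fast geometric convergence. With b λ^β ≤ 1 and D y₀^β = λ, the bound Y j ≤ y₀ λ^j propagates:
the superlinear gain pays for the growing factor b^j. -/
lemma exists_tendsto_zero_of_superlinear {D b β : ℝ} (hD : 0 < D) (hb : 0 < b) (hβ : 0 < β) :
    ∃ y₀ : ℝ, 0 < y₀ ∧ ∀ Y : ℕ → ℝ, (∀ j, 0 ≤ Y j) →
      (∀ j, Y (j + 1) ≤ D * b ^ j * Y j ^ (1 + β)) → Y 0 ≤ y₀ → Tendsto Y atTop (𝓝 0) := by
  set lam := min (1 / 2) (b ^ (-(1 / β))) with hl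
  have hl0 : 0 < lam := by positivity
  have hl1 : lam < 1 := (min_le_left _ _).trans_lt (by norm_num)
  have hbl : b * lam ^ β ≤ 1 := by
    calc b * lam ^ β ≤ b * (b ^ (-(1 / β))) ^ β := by
          gcongr; exact min_le_right _ _
      _ = 1 := by
          rw [← Real.rpow_mul hb.le, neg_mul, one_div_mul_cancel hβ.ne', Real.rpow_neg_one,
            mul_inv_cancel₀ hb.ne']
  set y₀ := (lam / D) ^ (1 / β) with hy
  have hy0 : 0 < y₀ := by positivity
  have hyβ : D * y₀ ^ β = lam := by
    rw [hy, ← Real.rpow_mul (by positivity), one_div_mul_cancel hβ.ne', Real.rpow_one]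
    field_simp
  refine ⟨y₀, hy0, fun Y hY0 hY hle => ?_⟩
  have key : ∀ j, Y j ≤ y₀ * lam ^ j := by
    intro j
    induction j with
    | zero => simpa using hle
    | succ j ih =>
      calc Y (j + 1) ≤ D * b ^ j * Y j ^ (1 + β) := hY j
        _ ≤ D * b ^ j * (y₀ * lam ^ j) ^ (1 + β) := by
            have := hY0 j
            gcongr
        _ = (D * y₀ ^ β) * (b * lam ^ β) ^ j * (y₀ * lam ^ j) := by
            rw [Real.rpow_add (by positivity), Real.rpow_one, Real.mul_rpow hy0.le (by positivity),
              mul_pow, ← Real.rpow_natCast (lam ^ β), ← Real.rpow_mul hl0.le, mul_comm β,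
              Real.rpow_mul hl0.le, Real.rpow_natCast]
            ring
        _ ≤ lam * 1 * (y₀ * lam ^ j) := by
            rw [hyβ]
            gcongr
            exact pow_le_one₀ (by positivity) hbl
        _ = _ := by ring
  refine squeeze_zero hY0 key ?_
  have := (tendsto_pow_atTop_nhds_zero_of_lt_one hl0.le hl1).const_mul y₀
  simpa using this

/-- In terms of w = 1/t the two demands read 1/2 + 1/(2q) - 1/d < w < (p-1)/(2p), and this interval
is nonempty exactly when 1/p + 1/q < 2/d. The maximum with 0 in the proof keeps t finite and
positive. -/
lemma exists_sobolev_exponent {d : ℕ} (hd : 0 < d) {p q : ℝ} (hp : 1 < p) (hq : 1 < q)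
    (hpq : 1 / p + 1 / q < 2 / d) :
    ∃ t : ℝ, 2 * p / (p - 1) < t ∧ (d : ℝ) / 2 + d / (2 * q) < 1 + d / t := by
  have hd0 : (0 : ℝ) < d := by positivity
  have hp1 : 0 < p - 1 := by linarith
  have h1 : 1 / 2 + 1 / (2 * q) - 1 / d < (p - 1) / (2 * p) := by
    have e1 : (p - 1) / (2 * p) = 1 / 2 - 1 / p / 2 := by field_simp
    have e2 : 1 / (2 * q) = 1 / q / 2 := by field_simp
    have e3 : (2 : ℝ) / d = 2 * (1 / d) := by ring
    rw [e1, e2]; linarith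
  obtain ⟨w, hw1, hw2⟩ := exists_between
    (max_lt h1 (show 0 < (p - 1) / (2 * p) by positivity))
  have hw0 : 0 < w := (le_max_right _ _).trans_lt hw1
  have hw3 := (le_max_left _ _).trans_lt hw1
  refine ⟨1 / w, ?_, ?_⟩
  · rw [lt_div_iff₀ hw0]
    rw [lt_div_iff₀ (by positivity)] at hw2
    rw [div_mul_eq_mul_div, div_lt_one hp1]
    linarith
  · have := mul_lt_mul_of_pos_left hw3 hd0
    rw [div_div_eq_mul_div, div_one]
    have e : (d : ℝ) * (1 / 2 + 1 / (2 * q) - 1 / d) = d / 2 + d / (2 * q) - 1 := by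
      field_simp
    linarith

lemma edgeEnergy_neg {d : ℕ} (C : Zd d → Zd d → ℝ) (g : Zd d → ℝ) (x : Zd d) :
    edgeEnergy C (fun y => -g y) x = edgeEnergy C g x := by
  unfold edgeEnergy
  refine Finset.sum_congr rfl fun i _ => ?_
  ring

/-- Averaged sublinearity is used twice: with the exponent 2p/(p-1) it controls the long jumps, and
with the exponent t it makes the initial excess small enough for the iteration to converge. -/
theorem exists_forall_le_of_harmonic {d : ℕ} (hd : 0 < d) {p q κ : ℝ} (hp : 1 < p) (hq : 1 < q)
    (hκ : 0 ≤ κ) (hpq : 1 / p + 1 / q < 2 / d) {C : Zd d → Zd d → ℝ} {μ ν M : Zd d → ℝ}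
    (hC : HasMomentBounds p q κ C μ ν M) {f l : Zd d → ℝ} (hl : ∀ x y, |l y - l x| ≤ ‖y - x‖)
    (hharm : ∀ x, HasSum (fun y => C x y * ((l y + f y) - (l x + f x))) 0)
    (hf : ∀ δ : ℝ, 0 < δ → ∃ (b : Zd d → ℝ) (B : ℝ), (∀ x, |b x| ≤ B) ∧
      ∀ n : ℕ, 1 ≤ n → ∑ x ∈ cube d n, edgeEnergy C (fun y => f y - b y) x ≤ δ * (n : ℝ) ^ d)
    {ε : ℝ} (hε : 0 < ε) (hε1 : ε ≤ 1) :
    ∃ N : ℕ, ∀ n : ℕ, N ≤ n → ∀ x ∈ cube d n, f x ≤ ε * n := by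
  obtain ⟨t, ht, hdqt⟩ := exists_sobolev_exponent hd hp hq hpq
  have hp1 : 0 < p - 1 := by linarith
  set t₀ := 2 * p / (p - 1) with ht₀
  have ht₀2 : 2 < t₀ := by rw [ht₀, lt_div_iff₀ hp1]; linarith
  have ht0 : 0 < t := by linarith
  have hd0 : (0 : ℝ) < d := by positivity
  have hdqt₀ : (d : ℝ) / 2 + d / (2 * q) < 1 + d / t₀ := by
    refine hdqt.trans_le ?_
    gcongr
  obtain ⟨A, c, hA, hc, H⟩ := exists_excess_le d hd hp hq hκ ht hdqt
  obtain ⟨y₀, hy₀, hY⟩ := exists_tendsto_zero_of_superlinear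
    (D := A * ε⁻¹ ^ t * 2 ^ c) (b := 2 ^ c) (β := t / t₀ - 1) (by positivity) (by positivity)
    (by rw [sub_pos, lt_div_iff₀ (by linarith)]; linarith)
  obtain ⟨N₁, hN₁⟩ := exists_forall_sum_cube_rpow_le hq ht₀2.le hdqt₀ hκ hC.nonneg hC.ν_nonneg
    hC.one_le hC.sum_ν hf one_pos
  set δ := ε / 2 * (y₀ / 2 ^ d) ^ (1 / t) with hδ
  obtain ⟨N₂, hN₂⟩ := exists_forall_sum_cube_rpow_le hq (by linarith : 2 ≤ t) hdqt hκ hC.nonneg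
    hC.ν_nonneg hC.one_le hC.sum_ν hf (δ := δ) (by positivity)
  refine ⟨max 1 (max N₁ N₂), fun n hn x hx => ?_⟩
  have hn1 : 1 ≤ n := (le_max_left _ _).trans hn
  have hnN₁ : N₁ ≤ n := ((le_max_left _ _).trans (le_max_right _ _)).trans hn
  have hnN₂ : N₂ ≤ n := ((le_max_right _ _).trans (le_max_right _ _)).trans hn
  have hn0 : (0 : ℝ) < n := by positivity
  -- Levels rise from 0 to ε n and radii shrink from 2n to n, with gaps 2^{-(j+1)} relative to ε n
  -- and n respectively.
  set kk : ℕ → ℝ := fun j => ε * n * (1 - (1 / 2) ^ j) with hkk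
  set RR : ℕ → ℝ := fun j => n * (1 + (1 / 2) ^ j) with hRR
  set Y : ℕ → ℝ := fun j => excess t f n ε (kk j) (RR j) with hYd
  have hpow : ∀ j : ℕ, (1 / 2 : ℝ) ^ j ≤ 1 := fun j => pow_le_one₀ (by norm_num) (by norm_num)
  have hstep : ∀ j, Y (j + 1) ≤ A * ε⁻¹ ^ t * 2 ^ c * (2 ^ c) ^ j * Y j ^ (1 + (t / t₀ - 1)) := by
    intro j
    have hk : kk (j + 1) = kk j + (1 / 2) ^ (j + 1) * (ε * n) := by
      simp only [hkk, pow_succ]; ring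
    have hR : RR (j + 1) = RR j - (1 / 2) ^ (j + 1) * n := by
      simp only [hRR, pow_succ]; ring
    have := H C μ ν M hC f l hl hharm n hn1 (fun N hN => hN₁ N (hnN₁.trans hN)) ε
      ((1 / 2) ^ (j + 1)) (kk j) (RR j) hε hε1 (by positivity) (hpow _)
      (mul_nonneg (by positivity) (by linarith [hpow j]))
      (by rw [← hR]; simp only [hRR]; nlinarith [pow_pos (show (0 : ℝ) < 1 / 2 by norm_num) (j + 1)])
      (by simp only [hRR]; nlinarith [hpow j])
    rw [← hk, ← hR] at this
    refine this.trans (le_of_eq ?_)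
    rw [add_sub_cancel]
    have e : (((1 / 2 : ℝ) ^ (j + 1))⁻¹) ^ c = 2 ^ c * (2 ^ c) ^ j := by
      rw [one_div, inv_pow, inv_inv, ← Real.rpow_natCast, ← Real.rpow_mul (by norm_num), mul_comm,
        Real.rpow_mul (by norm_num), Real.rpow_natCast, pow_succ]
      ring
    rw [e]; simp only [hYd]; ring
  have hY00 : Y 0 ≤ y₀ := by
    simp only [hYd, hkk, hRR, excess, pow_zero, sub_self, mul_zero, sub_zero]
    have h1 := hN₂ (2 * n) (by omega)
    calc _ ≤ ((n : ℝ) ^ d)⁻¹ * ∑ x ∈ cube d (2 * n), |f x| ^ t * ((ε * n) ^ t)⁻¹ := by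
          gcongr
          refine (Finset.sum_le_sum_of_subset_of_nonneg (Finset.filter_subset _ _)
            fun x _ _ => by positivity).trans (Finset.sum_le_sum fun x _ => ?_)
          rw [Real.div_rpow (le_max_right _ _) (by positivity), div_eq_mul_inv]
          gcongr
          exact max_le (le_abs_self _) (abs_nonneg _)
      _ ≤ ((n : ℝ) ^ d)⁻¹ * (((δ * (2 * n : ℕ)) ^ t * ((2 * n : ℕ) : ℝ) ^ d) * ((ε * n) ^ t)⁻¹) := by
          rw [← Finset.sum_mul]
          gcongr
      _ = 2 ^ d * (δ * (2 * n) / (ε * n)) ^ t := by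
          rw [Real.div_rpow (by positivity) (by positivity)]
          push_cast
          rw [mul_pow]
          field_simp
      _ = 2 ^ d * ((y₀ / 2 ^ d) ^ (1 / t)) ^ t := by
          congr 2
          rw [hδ]; field_simp
      _ = y₀ := by
          rw [← Real.rpow_mul (by positivity), one_div_mul_cancel ht0.ne', Real.rpow_one]
          field_simp
      _ ≤ y₀ := le_rfl
  have hlim := hY Y (fun j => excess_nonneg t f n hε.le _ _) hstep hY00
  by_contra! hcon
  -- On the lattice a single site has positive mass, so one point above the limiting level keeps
  -- every excess away from zero.
  have hlow : ∀ j, ((n : ℝ) ^ d)⁻¹ * ((f x - ε * n) / (ε * n)) ^ t ≤ Y j := by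
    intro j
    simp only [hYd, excess]
    gcongr
    have hxm : x ∈ (cube d (2 * n)).filter fun x => ‖x‖ ≤ RR j := by
      rw [Finset.mem_filter]
      refine ⟨cube_subset (by omega) hx, (mem_cube_iff_norm.1 hx).trans ?_⟩
      simp only [hRR]
      nlinarith [pow_pos (show (0 : ℝ) < 1 / 2 by norm_num) j]
    refine le_trans ?_ (Finset.single_le_sum (f := fun x => (max (f x - kk j) 0 / (ε * n)) ^ t)
      (fun y _ => by positivity) hxm)
    have h1 : kk j ≤ ε * n := by
      simp only [hkk]
      have : (0 : ℝ) < (1 / 2) ^ j := by positivity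
      have : 0 < ε * n := by positivity
      nlinarith
    have h2 : 0 ≤ f x - ε * n := by linarith
    have h3 : f x - ε * n ≤ max (f x - kk j) 0 := (by linarith : _ ≤ f x - kk j).trans
      (le_max_left _ _)
    gcongr
  have h0 := ge_of_tendsto' hlim hlow
  have : 0 < ((n : ℝ) ^ d)⁻¹ * ((f x - ε * n) / (ε * n)) ^ t := by
    have : 0 < f x - ε * n := by linarith
    positivity
  linarith

/-- Deterministic everywhere-sublinearity: if `ℓ + f` is harmonic and `f` is approximated in
energy by bounded functions, then `f` is sublinear. -/
theorem exists_forall_abs_le_of_harmonic {d : ℕ} (hd : 0 < d) {p q κ : ℝ} (hp : 1 < p)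
    (hq : 1 < q) (hκ : 0 ≤ κ) (hpq : 1 / p + 1 / q < 2 / d) {C : Zd d → Zd d → ℝ}
    {μ ν M : Zd d → ℝ} (hC : HasMomentBounds p q κ C μ ν M) {f l : Zd d → ℝ}
    (hl : ∀ x y, |l y - l x| ≤ ‖y - x‖)
    (hharm : ∀ x, HasSum (fun y => C x y * ((l y + f y) - (l x + f x))) 0)
    (hf : ∀ δ : ℝ, 0 < δ → ∃ (b : Zd d → ℝ) (B : ℝ), (∀ x, |b x| ≤ B) ∧
      ∀ n : ℕ, 1 ≤ n → ∑ x ∈ cube d n, edgeEnergy C (fun y => f y - b y) x ≤ δ * (n : ℝ) ^ d)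
    {ε : ℝ} (hε : 0 < ε) (hε1 : ε ≤ 1) :
    ∃ N : ℕ, ∀ n : ℕ, N ≤ n → ∀ x ∈ cube d n, |f x| ≤ ε * n := by
  obtain ⟨N₁, h₁⟩ := exists_forall_le_of_harmonic hd hp hq hκ hpq hC hl hharm hf hε hε1
  obtain ⟨N₂, h₂⟩ := exists_forall_le_of_harmonic hd hp hq hκ hpq hC (f := fun x => -f x)
    (l := fun x => -l x) (fun x y => by
      rw [show -l y - -l x = -(l y - l x) by ring, abs_neg]; exact hl x y)
    (fun x => by
      have := (hharm x).neg
      rw [neg_zero] at this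
      have e : (fun y => C x y * (-l y + -f y - (-l x + -f x))) =
          fun y => -(C x y * (l y + f y - (l x + f x))) := by funext y; ring
      rwa [e])
    (fun δ hδ => by
      obtain ⟨b, B, hB, h⟩ := hf δ hδ
      refine ⟨fun x => -b x, B, fun x => by rw [abs_neg]; exact hB x, fun n hn => ?_⟩
      have e : (fun y => -f y - -b y) = fun y => -(f y - b y) := by funext y; ring
      rw [e]
      simp_rw [edgeEnergy_neg C fun y => f y - b y]
      exact h n hn) hε hε1
  refine ⟨max N₁ N₂, fun n hn x hx => abs_le.2 ⟨?_, ?_⟩⟩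
  · linarith [h₂ n ((le_max_right _ _).trans hn) x hx]
  · exact h₁ n ((le_max_left _ _).trans hn) x hx

/-! ### Maximal inequality for measure-preserving shifts -/

/-- Greedy Vitali covering: keep the largest cube and discard those meeting it. Discarded centres
lie within twice the largest radius; as only centres are counted, the constant is 2^d. -/
lemma card_mul_le_sum_of_maximal {d : ℕ} (F : Zd d → ℝ≥0∞) (lam : ℝ≥0∞) (r : Zd d → ℕ) (m : ℕ) :
    ∀ A : Finset (Zd d), A.card = m →
      (∀ x ∈ A, lam * ((2 * r x + 1) ^ d : ℕ) ≤ ∑ y ∈ cube d (r x), F (x + y)) →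
      lam * A.card ≤ 2 ^ d * ∑ y ∈ A.biUnion fun x => (cube d (r x)).map (addLeftEmbedding x),
        F y := by
  classical
  induction m using Nat.strong_induction_on with
  | _ m ih =>
    intro A hAm hA
    rcases A.eq_empty_or_nonempty with rfl | hne
    · simp
    obtain ⟨x, hx, hmax⟩ := A.exists_max_image r hne
    set Q : Zd d → Finset (Zd d) := fun x => (cube d (r x)).map (addLeftEmbedding x) with hQ
    have hmemQ : ∀ x y, y ∈ Q x ↔ y - x ∈ cube d (r x) := by
      intro x y
      simp only [hQ, Finset.mem_map, addLeftEmbedding_apply]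
      constructor
      · rintro ⟨z, hz, rfl⟩; simpa using hz
      · intro h; exact ⟨y - x, h, by simp⟩
    set A' := A.filter fun y => Disjoint (Q y) (Q x) with hA'
    have hxA' : x ∉ A' := by
      intro h
      have := (Finset.mem_filter.1 h).2
      rw [disjoint_self] at this
      have h0 : x ∈ Q x := by rw [hmemQ]; simp [mem_cube]
      rw [this] at h0
      simp at h0
    have hlt : A'.card < m := hAm ▸ Finset.card_lt_card
      ((Finset.filter_subset _ _).ssubset_of_ne fun h => hxA' (by rw [hA', h]; exact hx))
    have h1 := ih _ hlt A' rfl fun y hy => hA y (Finset.mem_filter.1 hy).1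
    have hcover : A ⊆ A' ∪ (cube d (2 * r x)).map (addLeftEmbedding x) := by
      intro y hy
      by_cases hd : Disjoint (Q y) (Q x)
      · exact Finset.mem_union_left _ (Finset.mem_filter.2 ⟨hy, hd⟩)
      · refine Finset.mem_union_right _ (Finset.mem_map.2 ⟨y - x, ?_, by simp⟩)
        obtain ⟨z, hz1, hz2⟩ := Finset.not_disjoint_iff.1 hd
        rw [hmemQ, mem_cube] at hz1 hz2
        rw [mem_cube]
        intro i
        have h1 := hz1 i; have h2 := hz2 i; have h3 := hmax y hy
        simp only [Pi.sub_apply] at *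
        push_cast
        omega
    have hcard : A.card ≤ A'.card + 2 ^ d * (2 * r x + 1) ^ d := by
      refine (Finset.card_le_card hcover).trans ((Finset.card_union_le _ _).trans ?_)
      rw [Finset.card_map, card_cube, ← mul_pow]
      gcongr
      omega
    have hsumx : ∑ y ∈ Q x, F y = ∑ y ∈ cube d (r x), F (x + y) := by simp [hQ]
    have hdisj : Disjoint (A'.biUnion Q) (Q x) := by
      rw [Finset.disjoint_biUnion_left]
      exact fun y hy => (Finset.mem_filter.1 hy).2
    calc lam * A.card ≤ lam * (A'.card + 2 ^ d * ((2 * r x + 1) ^ d : ℕ)) := by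
          gcongr; exact_mod_cast hcard
      _ = lam * A'.card + 2 ^ d * (lam * ((2 * r x + 1) ^ d : ℕ)) := by ring
      _ ≤ 2 ^ d * ∑ y ∈ A'.biUnion Q, F y + 2 ^ d * ∑ y ∈ Q x, F y := by
          rw [hsumx]
          gcongr
          exact hA x hx
      _ = 2 ^ d * ∑ y ∈ A'.biUnion Q ∪ Q x, F y := by
          rw [Finset.sum_union hdisj, mul_add]
      _ ≤ _ := by
          gcongr
          refine Finset.union_subset (Finset.biUnion_subset_biUnion_of_subset_left _
            (Finset.filter_subset _ _)) ?_
          exact Finset.subset_biUnion_of_mem Q hx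

section Action

variable {d : ℕ} {Ω : Type*} [MeasurableSpace Ω] [AddAction (Zd d) Ω]
  [MeasurableConstVAdd (Zd d) Ω] (P : Measure Ω) [VAddInvariantMeasure (Zd d) Ω P]

lemma ae_forall_vadd {p : Ω → Prop} (h : ∀ᵐ ω ∂P, p ω) : ∀ᵐ ω ∂P, ∀ x : Zd d, p (x +ᵥ ω) :=
  ae_all_iff.2 fun x => (measurePreserving_vadd x P).quasiMeasurePreserving.ae h

/-- Wiener's maximal inequality for nonnegative functions. -/
theorem mul_measure_maximal_le {h : Ω → ℝ≥0∞} (hh : Measurable h) (lam : ℝ≥0∞) :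
    lam * P {ω | ∃ n : ℕ, lam * ((2 * n + 1) ^ d : ℕ) < ∑ x ∈ cube d n, h (x +ᵥ ω)} ≤
      4 ^ d * ∫⁻ ω, h ω ∂P := by
  classical
  set E : ℕ → Set Ω := fun N => {ω | ∃ n ≤ N, lam * ((2 * n + 1) ^ d : ℕ) <
    ∑ x ∈ cube d n, h (x +ᵥ ω)} with hE
  have hmeas : ∀ n, Measurable fun ω => ∑ x ∈ cube d n, h (x +ᵥ ω) := fun n =>
    Finset.measurable_sum _ fun x _ => hh.comp (measurable_const_vadd x)
  have hEm : ∀ N, MeasurableSet (E N) := by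
    intro N
    have : E N = ⋃ n ∈ Finset.range (N + 1), {ω | lam * ((2 * n + 1) ^ d : ℕ) <
        ∑ x ∈ cube d n, h (x +ᵥ ω)} := by
      ext ω; simp [hE]
    rw [this]
    exact Finset.measurableSet_biUnion _ fun n _ => measurableSet_lt measurable_const (hmeas n)
  have hEmono : Monotone E := fun M N hMN ω ⟨n, hn, h⟩ => ⟨n, hn.trans hMN, h⟩
  have hU : {ω | ∃ n : ℕ, lam * ((2 * n + 1) ^ d : ℕ) < ∑ x ∈ cube d n, h (x +ᵥ ω)} =
      ⋃ N, E N := by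
    ext ω
    simp only [hE, Set.mem_ofPred_eq, Set.mem_iUnion]
    exact ⟨fun ⟨n, hn⟩ => ⟨n, n, le_rfl, hn⟩, fun ⟨_, n, _, hn⟩ => ⟨n, hn⟩⟩
  have hint : ∀ (g : Ω → ℝ≥0∞) (x : Zd d), Measurable g →
      ∫⁻ ω, g (x +ᵥ ω) ∂P = ∫⁻ ω, g ω ∂P := fun g x hg =>
    (measurePreserving_vadd x P).lintegral_comp hg
  have key : ∀ N, lam * P (E N) ≤ 4 ^ d * ∫⁻ ω, h ω ∂P := by
    intro N
    -- Transference: the covering lemma is applied along the orbit of ω inside a cube of radius N.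
    -- Radii are at most N, so the cubes used stay within radius 2N, and integration turns the orbit
    -- sums into P (E N) and the integral of h.
    have hpt : ∀ ω, lam * ∑ x ∈ cube d N, (E N).indicator 1 (x +ᵥ ω) ≤
        (2 : ℝ≥0∞) ^ d * ∑ y ∈ cube d (2 * N), h (y +ᵥ ω) := by
      intro ω
      set A := (cube d N).filter fun x => x +ᵥ ω ∈ E N with hA
      have hr : ∀ x, ∃ n, n ≤ N ∧ (x ∈ A → lam * ((2 * n + 1) ^ d : ℕ) <
          ∑ y ∈ cube d n, h (y +ᵥ (x +ᵥ ω))) := by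
        intro x
        by_cases hx : x ∈ A
        · obtain ⟨n, hn, h⟩ := (Finset.mem_filter.1 hx).2
          exact ⟨n, hn, fun _ => h⟩
        · exact ⟨0, Nat.zero_le _, fun h => absurd h hx⟩
      choose r hrN hr using hr
      have h1 := card_mul_le_sum_of_maximal (fun y => h (y +ᵥ ω)) lam r A.card A rfl
        (fun x hx => by
          refine (hr x hx).le.trans (le_of_eq (Finset.sum_congr rfl fun y _ => ?_))
          rw [vadd_vadd, add_comm])
      have h2 : ∑ x ∈ cube d N, (E N).indicator (1 : Ω → ℝ≥0∞) (x +ᵥ ω) = A.card := by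
        simp only [hA, Finset.card_filter, Nat.cast_sum, Nat.cast_ite, Nat.cast_one, Nat.cast_zero,
          Set.indicator_apply, Pi.one_apply]
      rw [h2]
      refine h1.trans ?_
      gcongr
      refine Finset.biUnion_subset.2 fun x hx y hy => ?_
      obtain ⟨z, hz, rfl⟩ := Finset.mem_map.1 hy
      have hx' := mem_cube.1 (Finset.mem_filter.1 hx).1
      rw [mem_cube] at hz ⊢
      intro i
      have := hx' i; have := hz i; have := hrN x
      simp only [addLeftEmbedding_apply, Pi.add_apply]
      push_cast
      omega
    have h3 := lintegral_mono hpt (μ := P)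
    have m1 : ∀ x : Zd d, Measurable fun ω => (E N).indicator (1 : Ω → ℝ≥0∞) (x +ᵥ ω) := fun x =>
      (measurable_one.indicator (hEm N)).comp (measurable_const_vadd x)
    have m2 : ∀ x : Zd d, Measurable fun ω => h (x +ᵥ ω) := fun x =>
      hh.comp (measurable_const_vadd x)
    rw [lintegral_const_mul _ (Finset.measurable_sum _ fun x _ => m1 x),
      lintegral_const_mul _ (hmeas _), lintegral_finsetSum _ (fun x _ => m1 x),
      lintegral_finsetSum _ (fun x _ => m2 x)] at h3
    simp only [hint h _ hh, hint _ _ (measurable_one.indicator (hEm N)),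
      lintegral_indicator_one (hEm N), Finset.sum_const, card_cube, nsmul_eq_mul] at h3
    have h4 : (2 : ℝ≥0∞) ^ d * (((2 * (2 * N) + 1) ^ d : ℕ) * ∫⁻ ω, h ω ∂P) ≤
        ((2 * N + 1) ^ d : ℕ) * (4 ^ d * ∫⁻ ω, h ω ∂P) := by
      have : 2 ^ d * (2 * (2 * N) + 1) ^ d ≤ (2 * N + 1) ^ d * 4 ^ d := by
        rw [← mul_pow, ← mul_pow]
        exact Nat.pow_le_pow_left (by omega) d
      rw [← mul_assoc, ← mul_assoc (((2 * N + 1) ^ d : ℕ) : ℝ≥0∞)]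
      refine mul_le_mul_left ?_ _
      exact_mod_cast this
    have h5 : (((2 * N + 1) ^ d : ℕ) : ℝ≥0∞) * (lam * P (E N)) ≤
        ((2 * N + 1) ^ d : ℕ) * (4 ^ d * ∫⁻ ω, h ω ∂P) := by
      rw [mul_left_comm]
      exact h3.trans h4
    exact (ENNReal.mul_le_mul_iff_right (by positivity) (ENNReal.natCast_ne_top _)).1 h5
  rw [hU, hEmono.measure_iUnion, ENNReal.mul_iSup]
  exact iSup_le key

/-- Borel–Cantelli applied to the maximal inequality. The index j is eventually good for all cube
radii at once, which a limit theorem for each fixed j would not give. -/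
theorem ae_eventually_sum_cube_le {h : ℕ → Ω → ℝ≥0∞} (hh : ∀ j, AEMeasurable (h j) P)
    {lam : ℕ → ℝ≥0∞} (hlam0 : ∀ j, lam j ≠ 0) (hlam : ∀ j, lam j ≠ ∞)
    (hsum : ∑' j, (∫⁻ ω, h j ω ∂P) / lam j ≠ ∞) :
    ∀ᵐ ω ∂P, ∀ᶠ j in atTop, ∀ n : ℕ,
      ∑ x ∈ cube d n, h j (x +ᵥ ω) ≤ lam j * ((2 * n + 1) ^ d : ℕ) := by
  set g : ℕ → Ω → ℝ≥0∞ := fun j => (hh j).mk (h j)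
  have hg : ∀ j, Measurable (g j) := fun j => (hh j).measurable_mk
  have hgh : ∀ᵐ ω ∂P, ∀ j, ∀ x : Zd d, h j (x +ᵥ ω) = g j (x +ᵥ ω) :=
    ae_all_iff.2 fun j => ae_forall_vadd P (hh j).ae_eq_mk
  have hint : ∀ j, ∫⁻ ω, g j ω ∂P = ∫⁻ ω, h j ω ∂P := fun j =>
    lintegral_congr_ae (hh j).ae_eq_mk.symm
  have hBC : ∑' j, P {ω | ∃ n : ℕ, lam j * ((2 * n + 1) ^ d : ℕ) <
      ∑ x ∈ cube d n, g j (x +ᵥ ω)} ≠ ∞ := by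
    refine ne_top_of_le_ne_top (b := 4 ^ d * ∑' j, (∫⁻ ω, h j ω ∂P) / lam j) ?_ ?_
    · exact ENNReal.mul_ne_top (by finiteness) hsum
    · rw [← ENNReal.tsum_mul_left]
      refine ENNReal.tsum_le_tsum fun j => ?_
      rw [← mul_div_assoc, ENNReal.le_div_iff_mul_le (Or.inl (hlam0 j)) (Or.inl (hlam j)),
        mul_comm, ← hint]
      exact mul_measure_maximal_le P (hg j) (lam j)
  filter_upwards [ae_eventually_notMem hBC, hgh] with ω hω hω2
  filter_upwards [hω] with j hj n
  simp only [not_exists, not_lt] at hj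
  simp only [hω2]
  exact hj n

theorem ae_exists_forall_sum_cube_le {h : Ω → ℝ≥0∞} (hh : AEMeasurable h P)
    (hint : ∫⁻ ω, h ω ∂P ≠ ∞) :
    ∀ᵐ ω ∂P, ∃ κ : ℝ≥0∞, κ ≠ ∞ ∧ ∀ n : ℕ, 1 ≤ n →
      ∑ x ∈ cube d n, h (x +ᵥ ω) ≤ κ * (n : ℝ≥0∞) ^ d := by
  have := ae_eventually_sum_cube_le (d := d) P (h := fun _ => h) (fun _ => hh) (lam := fun j => 2 ^ j)
    (fun j => by positivity) (fun j => by finiteness) (by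
      simp_rw [div_eq_mul_inv]
      rw [ENNReal.tsum_mul_left]
      refine ENNReal.mul_ne_top hint ?_
      simp_rw [ENNReal.inv_pow]
      rw [ENNReal.tsum_geometric]
      simp)
  filter_upwards [this] with ω hω
  obtain ⟨j, hj⟩ := hω.exists
  refine ⟨2 ^ j * 3 ^ d, by finiteness, fun n hn => (hj n).trans ?_⟩
  rw [mul_assoc, ← mul_pow]
  gcongr
  push_cast
  have : 2 * n + 1 ≤ 3 * n := by omega
  exact_mod_cast Nat.pow_le_pow_left this d

end Action

/-! ### Realizing `L²_cov` inside L²(Ω × ℤ^d) -/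

section Cov

variable {d : ℕ} {Ω : Type*} [MeasurableSpace Ω]

/-- The field `√C_{0,z} ψ(z, ω)` on `Ω × ℤ^d`, whose `L²` norm is the norm of `L²_cov`. -/
noncomputable def weighted (C : Zd d → Zd d → Ω → ℝ) (ψ : Zd d → Ω → ℝ) (p : Ω × Zd d) : ℝ :=
  √(C 0 p.2 p.1) * ψ p.2 p.1

lemma ae_prod_count_of_ae {P : Measure Ω} {Q : Ω → Zd d → Prop} (h : ∀ᵐ ω ∂P, ∀ z, Q ω z) :
    ∀ᵐ p ∂(P.prod (Measure.count : Measure (Zd d))), Q p.1 p.2 := by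
  filter_upwards [Measure.quasiMeasurePreserving_fst.ae h] with p hp using hp p.2

lemma ae_of_ae_prod_count {P : Measure Ω} [SFinite P] {Q : Ω → Zd d → Prop}
    (h : ∀ᵐ p ∂(P.prod (Measure.count : Measure (Zd d))), Q p.1 p.2) : ∀ᵐ ω ∂P, ∀ z, Q ω z := by
  filter_upwards [Measure.ae_ae_of_ae_prod h] with ω hω z
  rw [Measure.ae_count_iff] at hω
  exact hω z

lemma aestronglyMeasurable_uncurry {P : Measure Ω} {f : Zd d → Ω → ℝ}
    (hf : ∀ z, AEMeasurable (f z) P) :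
    AEStronglyMeasurable (fun p : Ω × Zd d => f p.2 p.1)
      (P.prod (Measure.count : Measure (Zd d))) := by
  have h1 : Measurable fun p : Ω × Zd d => (hf p.2).mk (f p.2) p.1 :=
    measurable_from_prod_countable_left fun z => (hf z).measurable_mk
  refine ⟨_, h1.stronglyMeasurable, ?_⟩
  exact ae_prod_count_of_ae (Q := fun ω z => f z ω = (hf z).mk (f z) ω)
    (ae_all_iff.2 fun z => (hf z).ae_eq_mk)

lemma aestronglyMeasurable_weighted {P : Measure Ω} {C : Zd d → Zd d → Ω → ℝ}
    (hC : ∀ x y, Measurable (C x y)) {ψ : Zd d → Ω → ℝ} (hψ : ∀ z, AEMeasurable (ψ z) P) :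
    AEStronglyMeasurable (weighted C ψ) (P.prod (Measure.count : Measure (Zd d))) :=
  aestronglyMeasurable_uncurry (f := fun z ω => √(C 0 z ω) * ψ z ω)
    fun z => ((hC 0 z).sqrt.aemeasurable).mul (hψ z)

lemma enorm_weighted_sq {C : Zd d → Zd d → Ω → ℝ} (hC : ∀ x y ω, 0 ≤ C x y ω) (ψ : Zd d → Ω → ℝ)
    (p : Ω × Zd d) : ‖weighted C ψ p‖ₑ ^ 2 = ENNReal.ofReal (ψ p.2 p.1 ^ 2 * C 0 p.2 p.1) := by
  rw [← ofReal_norm, ← ENNReal.ofReal_pow (norm_nonneg _), Real.norm_eq_abs, sq_abs,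
    weighted, mul_pow, Real.sq_sqrt (hC _ _ _), mul_comm]

lemma eLpNorm_weighted_sq {P : Measure Ω} [SFinite P] {C : Zd d → Zd d → Ω → ℝ}
    (hCm : ∀ x y, Measurable (C x y)) (hC : ∀ x y ω, 0 ≤ C x y ω) {ψ : Zd d → Ω → ℝ}
    (hψ : ∀ z, AEMeasurable (ψ z) P) :
    eLpNorm (weighted C ψ) 2 (P.prod (Measure.count : Measure (Zd d))) ^ 2 =
      covNormSq P C ψ := by
  rw [eLpNorm_eq_lintegral_rpow_enorm_toReal (by norm_num) (by norm_num)]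
  have h2 : (2 : ℝ≥0∞).toReal = 2 := by norm_num
  rw [h2, ← ENNReal.rpow_natCast, ← ENNReal.rpow_mul]
  norm_num
  rw [lintegral_prod]
  · unfold covNormSq
    simp_rw [lintegral_count, enorm_weighted_sq hC]
  · exact (aestronglyMeasurable_weighted hCm hψ).enorm.pow_const 2

lemma memLp_weighted {P : Measure Ω} [SFinite P] {C : Zd d → Zd d → Ω → ℝ}
    (hCm : ∀ x y, Measurable (C x y)) (hC : ∀ x y ω, 0 ≤ C x y ω) {ψ : Zd d → Ω → ℝ}
    (hψ : ∀ z, AEMeasurable (ψ z) P) (h : covNormSq P C ψ < ∞) :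
    MemLp (weighted C ψ) 2 (P.prod (Measure.count : Measure (Zd d))) := by
  refine ⟨aestronglyMeasurable_weighted hCm hψ, ?_⟩
  rw [← eLpNorm_weighted_sq hCm hC hψ] at h
  exact lt_of_not_ge fun h' => by simp [top_le_iff.1 h'] at h

lemma covNormSq_lt_top_of_memLp {P : Measure Ω} [SFinite P] {C : Zd d → Zd d → Ω → ℝ}
    (hCm : ∀ x y, Measurable (C x y)) (hC : ∀ x y ω, 0 ≤ C x y ω) {ψ : Zd d → Ω → ℝ}
    (hψ : ∀ z, AEMeasurable (ψ z) P)
    (h : MemLp (weighted C ψ) 2 (P.prod (Measure.count : Measure (Zd d)))) :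
    covNormSq P C ψ < ∞ := by
  rw [← eLpNorm_weighted_sq hCm hC hψ]
  exact ENNReal.pow_lt_top h.2

lemma weighted_add (C : Zd d → Zd d → Ω → ℝ) (ψ φ : Zd d → Ω → ℝ) :
    weighted C (fun z ω => ψ z ω + φ z ω) = weighted C ψ + weighted C φ := by
  funext p; simp [weighted, mul_add]

lemma weighted_sub (C : Zd d → Zd d → Ω → ℝ) (ψ φ : Zd d → Ω → ℝ) :
    weighted C (fun z ω => ψ z ω - φ z ω) = weighted C ψ - weighted C φ := by
  funext p; simp [weighted, mul_sub]

lemma weighted_smul (C : Zd d → Zd d → Ω → ℝ) (t : ℝ) (ψ : Zd d → Ω → ℝ) :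
    weighted C (fun z ω => t * ψ z ω) = t • weighted C ψ := by
  funext p; simp [weighted, mul_left_comm]

lemma one_le_norm_toEuc {z : Zd d} (hz : z ≠ 0) : 1 ≤ ‖toEuc z‖ := by
  obtain ⟨i, hi⟩ := Function.ne_iff.1 hz
  have h1 : (1 : ℝ) ≤ |(z i : ℝ)| := by
    have : (1 : ℤ) ≤ |z i| := Int.one_le_abs hi
    exact_mod_cast this
  refine h1.trans ?_
  have := PiLp.norm_apply_le (toEuc z) i
  simpa [toEuc] using this

lemma lintegral_covNormSq_coord_le {P : Measure Ω} {C : Zd d → Zd d → Ω → ℝ}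
    (hC : ∀ x y ω, 0 ≤ C x y ω) (i : Fin d) :
    covNormSq P C (fun z _ => (z i : ℝ)) ≤ ∫⁻ ω, muTilde C ω ∂P := by
  refine lintegral_mono fun ω => ENNReal.tsum_le_tsum fun z => ENNReal.ofReal_le_ofReal ?_
  refine mul_le_mul_of_nonneg_right ?_ (hC _ _ _)
  rw [← sq_abs]
  have := PiLp.norm_apply_le (toEuc z) i
  have h : |(z i : ℝ)| ≤ ‖toEuc z‖ := by simpa [toEuc] using this
  gcongr

end Cov

section Pot

variable {d : ℕ} {Ω : Type*} [MeasurableSpace Ω] [AddAction (Zd d) Ω]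
  [MeasurableConstVAdd (Zd d) Ω] {P : Measure Ω} [IsProbabilityMeasure P]
  [VAddInvariantMeasure (Zd d) Ω P] {C : Zd d → Zd d → Ω → ℝ}

lemma aemeasurable_grad {φ : Ω → ℝ} (hφ : AEMeasurable φ P) (z : Zd d) :
    AEMeasurable (grad φ z) P :=
  (hφ.comp_quasiMeasurePreserving
    (measurePreserving_vadd z P).quasiMeasurePreserving).sub hφ

lemma grad_cocycle (φ : Ω → ℝ) (x z : Zd d) (ω : Ω) :
    grad φ (x + z) ω - grad φ x ω = grad φ z (x +ᵥ ω) := by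
  simp only [grad, vadd_vadd, add_comm x z]; ring

lemma ae_bounded_of_memLp_top {φ : Ω → ℝ} (hφ : MemLp φ ∞ P) :
    ∃ B : ℝ, 0 ≤ B ∧ ∀ᵐ ω ∂P, |φ ω| ≤ B := by
  refine ⟨(eLpNorm φ ∞ P).toReal, ENNReal.toReal_nonneg, ?_⟩
  have h1 := enorm_ae_le_eLpNormEssSup φ P
  filter_upwards [h1] with ω hω
  rw [← Real.norm_eq_abs, ← toReal_enorm]
  rw [← eLpNorm_exponent_top] at hω
  exact ENNReal.toReal_mono hφ.2.ne hω

/-- A bounded φ has gradient at most 2B, and lattice points z ≠ 0 have |z| ≥ 1, so μ̃ dominates; at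
z = 0 the gradient vanishes. -/
lemma covNormSq_grad_lt_top (hC : IsConductance P C) (hμ : ∫⁻ ω, muTilde C ω ∂P < ∞) {φ : Ω → ℝ}
    (hφ : MemLp φ ∞ P) : covNormSq P C (grad φ) < ∞ := by
  obtain ⟨B, hB, hφB⟩ := ae_bounded_of_memLp_top hφ
  have hle : covNormSq P C (grad φ) ≤ ∫⁻ ω, ENNReal.ofReal ((2 * B) ^ 2) * muTilde C ω ∂P := by
    refine lintegral_mono_ae ?_
    filter_upwards [hφB, ae_forall_vadd (d := d) P hφB] with ω h0 h1
    unfold muTilde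
    rw [← ENNReal.tsum_mul_left]
    refine ENNReal.tsum_le_tsum fun z => ?_
    rw [← ENNReal.ofReal_mul (by positivity)]
    refine ENNReal.ofReal_le_ofReal ?_
    rw [← mul_assoc]
    refine mul_le_mul_of_nonneg_right ?_ (hC.nonneg _ _ _)
    by_cases hz : z = 0
    · subst hz
      rw [show grad φ (0 : Zd d) ω = 0 by simp [grad]]
      nlinarith [mul_nonneg (sq_nonneg (2 * B)) (sq_nonneg ‖toEuc (0 : Zd d)‖)]
    · have h2 : |grad φ z ω| ≤ 2 * B := by
        unfold grad
        have := abs_sub (φ (z +ᵥ ω)) (φ ω)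
        linarith [h1 z]
      have h3 := one_le_norm_toEuc hz
      rw [← sq_abs]
      calc |grad φ z ω| ^ 2 ≤ (2 * B) ^ 2 := by gcongr
        _ = (2 * B) ^ 2 * 1 := by ring
        _ ≤ _ := by gcongr; exact one_le_pow₀ h3
  refine hle.trans_lt ?_
  rw [lintegral_const_mul']
  · exact ENNReal.mul_lt_top ENNReal.ofReal_lt_top hμ
  · exact ENNReal.ofReal_ne_top

lemma isCov_grad (hC : IsConductance P C) (hμ : ∫⁻ ω, muTilde C ω ∂P < ∞) {φ : Ω → ℝ}
    (hφ : MemLp φ ∞ P) : IsCov P C (grad φ) where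
  aemeasurable := aemeasurable_grad hφ.1.aemeasurable
  cocycle := grad_cocycle φ
  norm_lt_top := covNormSq_grad_lt_top hC hμ hφ

lemma memLp_weighted_grad (hC : IsConductance P C) (hμ : ∫⁻ ω, muTilde C ω ∂P < ∞) {φ : Ω → ℝ}
    (hφ : MemLp φ ∞ P) :
    MemLp (weighted C (grad φ)) 2 (P.prod (Measure.count : Measure (Zd d))) :=
  memLp_weighted hC.measurable hC.nonneg (isCov_grad hC hμ hφ).aemeasurable
    (isCov_grad hC hμ hφ).norm_lt_top

lemma IsCov.memLp (hC : IsConductance P C) {ψ : Zd d → Ω → ℝ} (hψ : IsCov P C ψ) :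
    MemLp (weighted C ψ) 2 (P.prod (Measure.count : Measure (Zd d))) :=
  memLp_weighted hC.measurable hC.nonneg hψ.aemeasurable hψ.norm_lt_top

variable (P C) in
/-- The gradients of bounded functions, as a subspace of `L²(Ω × ℤ^d)`. -/
def gradSubmodule (hC : IsConductance P C) (hμ : ∫⁻ ω, muTilde C ω ∂P < ∞) :
    Submodule ℝ (Lp ℝ 2 (P.prod (Measure.count : Measure (Zd d)))) where
  carrier := {u | ∃ (φ : Ω → ℝ) (hφ : MemLp φ ∞ P), u = (memLp_weighted_grad hC hμ hφ).toLp _}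
  add_mem' := by
    rintro _ _ ⟨φ, hφ, rfl⟩ ⟨φ', hφ', rfl⟩
    refine ⟨φ + φ', hφ.add hφ', ?_⟩
    rw [← MemLp.toLp_add]
    congr 1
    rw [← weighted_add]
    congr 1
    funext z ω; simp only [grad, Pi.add_apply]; ring
  zero_mem' := by
    refine ⟨0, MemLp.zero, ?_⟩
    rw [eq_comm, Lp.ext_iff]
    have h : weighted C (grad (0 : Ω → ℝ)) = fun _ => 0 := by funext p; simp [weighted, grad]
    filter_upwards [(memLp_weighted_grad hC hμ (MemLp.zero (p := ∞) (μ := P))).coeFn_toLp,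
      Lp.coeFn_zero ℝ 2 (P.prod (Measure.count : Measure (Zd d)))] with p h1 h2
    rw [h2]
    refine Eq.trans h1 ?_
    exact congrFun h p
  smul_mem' := by
    rintro t _ ⟨φ, hφ, rfl⟩
    refine ⟨fun ω => t * φ ω, hφ.const_mul t, ?_⟩
    rw [← MemLp.toLp_const_smul]
    congr 1
    rw [← weighted_smul]
    congr 1
    funext z ω; simp only [grad]; ring

lemma IsPot.toLp_mem_closure (hC : IsConductance P C) (hμ : ∫⁻ ω, muTilde C ω ∂P < ∞)
    {ψ : Zd d → Ω → ℝ} (hψ : IsPot P C ψ) :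
    (hψ.isCov.memLp hC).toLp _ ∈ (gradSubmodule P C hC hμ).topologicalClosure := by
  change _ ∈ closure _
  rw [EMetric.mem_closure_iff]
  intro ε hε
  obtain ⟨φ, hφ, h⟩ := hψ.approx (ε ^ 2) (by positivity)
  refine ⟨_, ⟨φ, hφ, rfl⟩, ?_⟩
  rw [Lp.edist_toLp_toLp, ← weighted_sub]
  rw [← eLpNorm_weighted_sq (ψ := fun z ω => ψ z ω - grad φ z ω) hC.measurable hC.nonneg
    (fun z => (hψ.isCov.aemeasurable z).sub (aemeasurable_grad hφ.1.aemeasurable z))] at h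
  exact lt_of_not_ge fun h' => absurd (pow_le_pow_left' h' 2) (not_le.2 h)

end Pot

/-! ### Exact cocycles representing L² limits of gradients -/

section Realization

variable {d : ℕ} {Ω : Type*} [MeasurableSpace Ω] [AddAction (Zd d) Ω]
  [MeasurableConstVAdd (Zd d) Ω] {P : Measure Ω} [IsProbabilityMeasure P]
  [VAddInvariantMeasure (Zd d) Ω P] {C : Zd d → Zd d → Ω → ℝ}

/-- If gradients converge along unit vectors on the whole orbit, they converge everywhere. -/
lemma exists_tendsto_grad_of_single {φ : ℕ → Ω → ℝ} {ω : Ω}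
    (h : ∀ (x : Zd d) (i : Fin d), ∃ l, Tendsto (fun k => grad (φ k) (Pi.single i 1) (x +ᵥ ω)) atTop (𝓝 l))
    (x z : Zd d) : ∃ l, Tendsto (fun k => grad (φ k) z (x +ᵥ ω)) atTop (𝓝 l) := by
  let S : AddSubgroup (Zd d) :=
    { carrier := {z | ∀ x : Zd d, ∃ l, Tendsto (fun k => grad (φ k) z (x +ᵥ ω)) atTop (𝓝 l)}
      add_mem' := by
        intro a b ha hb x
        obtain ⟨l, hl⟩ := ha x
        obtain ⟨m, hm⟩ := hb (a + x)
        refine ⟨l + m, (hl.add hm).congr fun k => ?_⟩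
        rw [← vadd_vadd, ← grad_cocycle (φ k) a b]; ring
      zero_mem' := fun x => ⟨0, by simp [grad]⟩
      neg_mem' := by
        intro a ha x
        obtain ⟨l, hl⟩ := ha (-a + x)
        refine ⟨-l, hl.neg.congr fun k => ?_⟩
        simp [grad, vadd_vadd] }
  have hz : z ∈ S := by
    have e : z = ∑ i, z i • (Pi.single i 1 : Zd d) := by
      have := Finset.univ_sum_single z
      conv_lhs => rw [← this]
      refine Finset.sum_congr rfl fun i _ => ?_
      funext j
      by_cases hj : j = i
      · subst hj; simp
      · simp [hj]
    rw [e]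
    refine sum_mem fun i _ => S.zsmul_mem ?_ _
    exact fun x => h x i
  exact hz x

lemma exists_seq_of_mem_closure (hC : IsConductance P C) (hμ : ∫⁻ ω, muTilde C ω ∂P < ∞)
    {u : Lp ℝ 2 (P.prod (Measure.count : Measure (Zd d)))}
    (hu : u ∈ (gradSubmodule P C hC hμ).topologicalClosure) :
    ∃ φ : ℕ → Ω → ℝ, (∀ k, MemLp (φ k) ∞ P) ∧
      ∀ᵐ ω ∂P, ∀ z, Tendsto (fun k => √(C 0 z ω) * grad (φ k) z ω) atTop (𝓝 (u (ω, z))) := by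
  obtain ⟨v, hv, hlim⟩ := mem_closure_iff_seq_limit.1 hu
  choose φ hφ hvφ using hv
  obtain ⟨ns, -, hns⟩ := (tendstoInMeasure_of_tendsto_Lp hlim).exists_seq_tendsto_ae
  refine ⟨fun k => φ (ns k), fun k => hφ _, ?_⟩
  have h2 : ∀ᵐ p ∂(P.prod (Measure.count : Measure (Zd d))),
      ∀ k, v k p = weighted C (grad (φ k)) p := ae_all_iff.2 fun k => by
    rw [hvφ k]; exact MemLp.coeFn_toLp _
  refine ae_of_ae_prod_count (Q := fun ω z =>
    Tendsto (fun k => √(C 0 z ω) * grad (φ (ns k)) z ω) atTop (𝓝 (u (ω, z)))) ?_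
  filter_upwards [hns, h2] with p h3 h4
  exact h3.congr fun k => h4 _

/-- Elements of the abstract closure of the gradients are represented by exact cocycles. -/
lemma exists_isPot_of_mem_closure (hC : IsConductance P C) (hμ : ∫⁻ ω, muTilde C ω ∂P < ∞)
    (hpos : ∀ᵐ ω ∂P, ∀ i, 0 < C 0 (Pi.single i 1) ω)
    {u : Lp ℝ 2 (P.prod (Measure.count : Measure (Zd d)))}
    (hu : u ∈ (gradSubmodule P C hC hμ).topologicalClosure) :
    ∃ ψ, IsPot P C ψ ∧ weighted C ψ =ᵐ[P.prod Measure.count] u := by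
  classical
  obtain ⟨φ, hφ, hlim⟩ := exists_seq_of_mem_closure hC hμ hu
  -- The L² limit says nothing about gradients where C vanishes. Positivity of the nearest-neighbour
  -- conductances gives convergence along unit vectors, and the cocycle relation spreads it to all
  -- z. Since G is invariant under the shifts, extension by zero off G keeps the cocycle identity
  -- for every ω.
  let G : Set Ω := {ω | ∀ x z : Zd d, ∃ l, Tendsto (fun k => grad (φ k) z (x +ᵥ ω)) atTop (𝓝 l)}
  have hG : ∀ᵐ ω ∂P, ω ∈ G := by
    have h1 : ∀ᵐ ω ∂P, ∀ i, ∃ l,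
        Tendsto (fun k => grad (φ k) (Pi.single i 1 : Zd d) ω) atTop (𝓝 l) := by
      filter_upwards [hpos, hlim] with ω h0 h1 i
      refine ⟨_, ((h1 (Pi.single i 1)).const_mul (√(C 0 (Pi.single i 1) ω))⁻¹).congr fun k => ?_⟩
      have := (Real.sqrt_pos.2 (h0 i)).ne'
      field_simp
    filter_upwards [ae_forall_vadd (d := d) P h1] with ω hω
    exact exists_tendsto_grad_of_single hω
  have hGinv : ∀ (x : Zd d) ω, ω ∈ G ↔ x +ᵥ ω ∈ G := by
    intro x ω
    constructor
    · intro h y z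
      rw [vadd_vadd]; exact h _ _
    · intro h y z
      have := h (y - x) z
      rwa [vadd_vadd, sub_add_cancel] at this
  let ψ : Zd d → Ω → ℝ := fun z ω =>
    if ω ∈ G then limUnder atTop (fun k => grad (φ k) z ω) else 0
  have hψ : ∀ ω ∈ G, ∀ z, Tendsto (fun k => grad (φ k) z ω) atTop (𝓝 (ψ z ω)) := by
    intro ω hω z
    simp only [ψ, if_pos hω]
    have := hω 0 z
    rw [zero_vadd] at this
    exact tendsto_nhds_limUnder this
  have hmeas : ∀ z, AEMeasurable (ψ z) P := fun z =>
    aemeasurable_of_tendsto_metrizable_ae atTop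
      (fun k => aemeasurable_grad (hφ k).1.aemeasurable z) (hG.mono fun ω hω => hψ ω hω z)
  have hcoc : ∀ x z ω, ψ (x + z) ω - ψ x ω = ψ z (x +ᵥ ω) := by
    intro x z ω
    by_cases hω : ω ∈ G
    · refine tendsto_nhds_unique ((hψ ω hω (x + z)).sub (hψ ω hω x)) ?_
      exact (hψ _ ((hGinv x ω).1 hω) z).congr fun k => (grad_cocycle (φ k) x z ω).symm
    · have h2 : x +ᵥ ω ∉ G := fun h => hω ((hGinv x ω).2 h)
      simp [ψ, hω, h2]
  have hae : weighted C ψ =ᵐ[P.prod Measure.count] u := by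
    refine ae_prod_count_of_ae (Q := fun ω z => weighted C ψ (ω, z) = u (ω, z)) ?_
    filter_upwards [hlim, hG] with ω h1 h2 z
    exact tendsto_nhds_unique ((hψ ω h2 z).const_mul _) (h1 z)
  have hmem : MemLp (weighted C ψ) 2 (P.prod (Measure.count : Measure (Zd d))) :=
    (memLp_congr_ae hae).2 (Lp.memLp u)
  refine ⟨ψ, ⟨⟨hmeas, hcoc, covNormSq_lt_top_of_memLp hC.measurable hC.nonneg hmeas hmem⟩, ?_⟩, hae⟩
  intro ε hε
  -- `covNormSq` is the square of the L² distance; keeping the distance below 1 makes the square no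
  -- larger than the distance itself.
  have hδ : 0 < min ε 1 := lt_min hε one_pos
  obtain ⟨v, ⟨φ', hφ', rfl⟩, hv⟩ := EMetric.mem_closure_iff.1 hu _ hδ
  refine ⟨φ', hφ', ?_⟩
  rw [← eLpNorm_weighted_sq (ψ := fun z ω => ψ z ω - grad φ' z ω) hC.measurable hC.nonneg
    (fun z => (hmeas z).sub (aemeasurable_grad hφ'.1.aemeasurable z)), weighted_sub]
  have e : u = hmem.toLp _ := by
    rw [Lp.ext_iff]
    exact hae.symm.trans hmem.coeFn_toLp.symm
  rw [e, Lp.edist_toLp_toLp] at hv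
  calc _ ≤ eLpNorm (weighted C ψ - weighted C (grad φ')) 2 (P.prod Measure.count) := by
        rw [pow_two]
        exact mul_le_of_le_one_left' (hv.le.trans (min_le_right _ _))
    _ < min ε 1 := hv
    _ ≤ ε := min_le_left _ _

end Realization

/-! ### Existence of the corrector and its variational equation -/

section Existence

variable {d : ℕ} {Ω : Type*} [MeasurableSpace Ω] {P : Measure Ω} {C : Zd d → Zd d → Ω → ℝ}

/-- The energy is the sum of the squared norms of the components. -/
lemma energy_eq_sum (hCm : ∀ x y, Measurable (C x y)) (hC : ∀ x y ω, 0 ≤ C x y ω)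
    {χ : Zd d → Ω → EuclideanSpace ℝ (Fin d)} (hχ : ∀ i z, AEMeasurable (fun ω => χ z ω i) P) :
    energy P C χ = ∑ i, covNormSq P C (fun z ω => (z i : ℝ) + χ z ω i) := by
  unfold energy covNormSq
  rw [← lintegral_finsetSum']
  · refine lintegral_congr fun ω => ?_
    rw [← Summable.tsum_finsetSum fun _ _ => ENNReal.summable]
    refine tsum_congr fun z => ?_
    rw [← ENNReal.ofReal_sum_of_nonneg fun i _ => mul_nonneg (sq_nonneg _) (hC _ _ _),
      EuclideanSpace.real_norm_sq_eq, Finset.sum_mul]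
    simp [toEuc]
  · exact fun i _ => AEMeasurable.tsum fun z =>
      ((((hχ i z).const_add _).pow_const 2).mul (hCm 0 z).aemeasurable).ennreal_ofReal

variable [AddAction (Zd d) Ω] [IsProbabilityMeasure P]
  [MeasurableConstVAdd (Zd d) Ω] [VAddInvariantMeasure (Zd d) Ω P]

lemma memLp_weighted_coord (hC : IsConductance P C) (hμ : ∫⁻ ω, muTilde C ω ∂P < ∞) (i : Fin d) :
    MemLp (weighted C fun z (_ : Ω) => (z i : ℝ)) 2 (P.prod (Measure.count : Measure (Zd d))) :=
  memLp_weighted hC.measurable hC.nonneg (fun _ => aemeasurable_const)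
    ((lintegral_covNormSq_coord_le hC.nonneg i).trans_lt hμ)

lemma covNormSq_coord_add_eq (hC : IsConductance P C) (hμ : ∫⁻ ω, muTilde C ω ∂P < ∞) (i : Fin d)
    {ψ : Zd d → Ω → ℝ} (hψ : IsPot P C ψ) :
    covNormSq P C (fun z ω => (z i : ℝ) + ψ z ω) =
      ‖-(memLp_weighted_coord hC hμ i).toLp _ - (hψ.isCov.memLp hC).toLp _‖ₑ ^ 2 := by
  rw [← eLpNorm_weighted_sq (ψ := fun z ω => (z i : ℝ) + ψ z ω) hC.measurable hC.nonneg
    (fun z => (hψ.isCov.aemeasurable z).const_add _), weighted_add C fun z _ => (z i : ℝ),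
    ← neg_add', enorm_neg, ← MemLp.toLp_add, Lp.enorm_toLp]

lemma covNormSq_coord_add_ne_top (hC : IsConductance P C) (hμ : ∫⁻ ω, muTilde C ω ∂P < ∞)
    (i : Fin d) {ψ : Zd d → Ω → ℝ} (hψ : IsPot P C ψ) :
    covNormSq P C (fun z ω => (z i : ℝ) + ψ z ω) ≠ ∞ := by
  rw [covNormSq_coord_add_eq hC hμ i hψ]
  exact ENNReal.pow_ne_top enorm_ne_top

/-- Minimality among the elements of `L²_pot` is minimality in the closure of the gradients. -/
lemma norm_eq_iInf_iff_forall_covNormSq_le (hC : IsConductance P C)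
    (hμ : ∫⁻ ω, muTilde C ω ∂P < ∞) (hpos : ∀ᵐ ω ∂P, ∀ i, 0 < C 0 (Pi.single i 1) ω) (i : Fin d)
    {ψ : Zd d → Ω → ℝ} (hψ : IsPot P C ψ) :
    (‖-(memLp_weighted_coord hC hμ i).toLp _ - (hψ.isCov.memLp hC).toLp _‖ =
      ⨅ w : (gradSubmodule P C hC hμ).topologicalClosure,
        ‖-(memLp_weighted_coord hC hμ i).toLp _ - (w : Lp ℝ 2 (P.prod Measure.count))‖) ↔
    ∀ ψ', IsPot P C ψ' → covNormSq P C (fun z ω => (z i : ℝ) + ψ z ω) ≤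
      covNormSq P C (fun z ω => (z i : ℝ) + ψ' z ω) := by
  have hbdd : BddBelow (Set.range fun w : (gradSubmodule P C hC hμ).topologicalClosure =>
      ‖-(memLp_weighted_coord hC hμ i).toLp _ - (w : Lp ℝ 2 (P.prod Measure.count))‖) :=
    ⟨0, by rintro _ ⟨w, rfl⟩; exact norm_nonneg _⟩
  constructor
  · intro h ψ' hψ'
    rw [covNormSq_coord_add_eq hC hμ i hψ, covNormSq_coord_add_eq hC hμ i hψ']
    refine pow_le_pow_left' ?_ 2
    rw [enorm_le_iff_norm_le, h]
    exact ciInf_le hbdd ⟨_, hψ'.toLp_mem_closure hC hμ⟩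
  · intro h
    refine le_antisymm (le_ciInf fun ⟨w, hw⟩ => ?_)
      (ciInf_le hbdd ⟨_, hψ.toLp_mem_closure hC hμ⟩)
    obtain ⟨ψ', hψ', hae⟩ := exists_isPot_of_mem_closure hC hμ hpos hw
    have e : w = (hψ'.isCov.memLp hC).toLp _ := by
      rw [Lp.ext_iff]
      exact hae.symm.trans (MemLp.coeFn_toLp _).symm
    have h1 := h ψ' hψ'
    rw [covNormSq_coord_add_eq hC hμ i hψ, covNormSq_coord_add_eq hC hμ i hψ', ← e] at h1
    rw [← enorm_le_iff_norm_le]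
    exact le_of_not_gt fun h2 => absurd h1 (not_le.2 (ENNReal.pow_lt_pow_left two_ne_zero h2))

/-- Existence of a corrector. -/
lemma exists_isCorrector (hC : IsConductance P C)
    (hμ : ∫⁻ ω, muTilde C ω ∂P < ∞) (hpos : ∀ᵐ ω ∂P, ∀ i, 0 < C 0 (Pi.single i 1) ω) :
    ∃ χ, IsCorrector P C χ := by
  have key : ∀ i : Fin d, ∃ ψ, IsPot P C ψ ∧ ∀ ψ', IsPot P C ψ' →
      covNormSq P C (fun z ω => (z i : ℝ) + ψ z ω) ≤
        covNormSq P C (fun z ω => (z i : ℝ) + ψ' z ω) := by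
    intro i
    obtain ⟨v, hv, hmin⟩ := Submodule.exists_norm_eq_iInf_of_complete_subspace
      (gradSubmodule P C hC hμ).topologicalClosure
      (Submodule.isClosed_topologicalClosure _).isComplete
      (-(memLp_weighted_coord hC hμ i).toLp _)
    obtain ⟨ψ, hψ, hae⟩ := exists_isPot_of_mem_closure hC hμ hpos hv
    have e : v = (hψ.isCov.memLp hC).toLp _ := by
      rw [Lp.ext_iff]
      exact hae.symm.trans (MemLp.coeFn_toLp _).symm
    rw [e] at hmin
    exact ⟨ψ, hψ, (norm_eq_iInf_iff_forall_covNormSq_le hC hμ hpos i hψ).1 hmin⟩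
  choose ψ hψ hmin using key
  refine ⟨fun z ω => WithLp.toLp 2 fun i => ψ i z ω, fun i => hψ i, fun χ' hχ' => ?_⟩
  rw [energy_eq_sum hC.measurable hC.nonneg fun i => (hψ i).isCov.aemeasurable,
    energy_eq_sum hC.measurable hC.nonneg fun i => (hχ' i).isCov.aemeasurable]
  exact Finset.sum_le_sum fun i _ => hmin i _ (hχ' i)

/-- The components of a corrector are minimizers. -/
lemma IsCorrector.covNormSq_coord_le (hC : IsConductance P C) (hμ : ∫⁻ ω, muTilde C ω ∂P < ∞)
    {χ : Zd d → Ω → EuclideanSpace ℝ (Fin d)} (hχ : IsCorrector P C χ) (i : Fin d)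
    {ψ : Zd d → Ω → ℝ} (hψ : IsPot P C ψ) :
    covNormSq P C (fun z ω => (z i : ℝ) + χ z ω i) ≤
      covNormSq P C (fun z ω => (z i : ℝ) + ψ z ω) := by
  classical
  -- Only the i-th component is replaced; the other terms of the energy are finite and cancel.
  let χ' : Zd d → Ω → EuclideanSpace ℝ (Fin d) := fun z ω =>
    WithLp.toLp 2 fun j => if j = i then ψ z ω else χ z ω j
  have hχ' : ∀ j, IsPot P C fun z ω => χ' z ω j := by
    intro j
    by_cases hj : j = i
    · simpa [χ', hj] using hψ
    · simpa [χ', hj] using hχ.isPot j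
  have h := hχ.minimal χ' hχ'
  rw [energy_eq_sum hC.measurable hC.nonneg fun i => (hχ.isPot i).isCov.aemeasurable,
    energy_eq_sum hC.measurable hC.nonneg fun i => (hχ' i).isCov.aemeasurable,
    ← Finset.add_sum_erase _ _ (Finset.mem_univ i), ← Finset.add_sum_erase _ _ (Finset.mem_univ i)]
    at h
  have e : ∑ j ∈ Finset.univ.erase i, covNormSq P C (fun z ω => (z j : ℝ) + χ' z ω j) =
      ∑ j ∈ Finset.univ.erase i, covNormSq P C (fun z ω => (z j : ℝ) + χ z ω j) := by
    refine Finset.sum_congr rfl fun j hj => ?_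
    simp [χ', Finset.ne_of_mem_erase hj]
  rw [e] at h
  have h2 := ENNReal.le_of_add_le_add_right (ENNReal.sum_ne_top.2 fun j _ =>
    covNormSq_coord_add_ne_top hC hμ j (hχ.isPot j)) h
  simpa [χ'] using h2

/-- The weak form of the Euler-Lagrange equation. -/
lemma IsCorrector.integral_eq_zero (hC : IsConductance P C) (hμ : ∫⁻ ω, muTilde C ω ∂P < ∞)
    (hpos : ∀ᵐ ω ∂P, ∀ i, 0 < C 0 (Pi.single i 1) ω)
    {χ : Zd d → Ω → EuclideanSpace ℝ (Fin d)} (hχ : IsCorrector P C χ) (i : Fin d)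
    {φ : Ω → ℝ} (hφ : MemLp φ ∞ P) :
    ∫ p, C 0 p.2 p.1 * ((p.2 i : ℝ) + χ p.2 p.1 i) * grad φ p.2 p.1
      ∂(P.prod (Measure.count : Measure (Zd d))) = 0 := by
  have h1 := ((gradSubmodule P C hC hμ).topologicalClosure.norm_eq_iInf_iff_real_inner_eq_zero
    ((hχ.isPot i).toLp_mem_closure hC hμ)).1
    ((norm_eq_iInf_iff_forall_covNormSq_le hC hμ hpos i (hχ.isPot i)).2
      fun ψ hψ => hχ.covNormSq_coord_le hC hμ i hψ) _
    (Submodule.le_topologicalClosure _ ⟨φ, hφ, rfl⟩)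
  rw [← neg_add', inner_neg_left, neg_eq_zero, ← MemLp.toLp_add, L2.inner_def] at h1
  rw [← h1]
  refine integral_congr_ae ?_
  filter_upwards [MemLp.coeFn_toLp ((memLp_weighted_coord hC hμ i).add
    ((hχ.isPot i).isCov.memLp hC)), MemLp.coeFn_toLp (memLp_weighted_grad hC hμ hφ)] with p h2 h3
  rw [h2, h3]
  simp only [Pi.add_apply, weighted, RCLike.inner_apply, conj_trivial]
  have := Real.mul_self_sqrt (hC.nonneg 0 p.2 p.1)
  linear_combination (-((p.2 i : ℝ) + χ p.2 p.1 i) * grad φ p.2 p.1) * this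

end Existence

/-! ### Almost sure harmonicity of the corrected coordinates -/

section EulerLagrange

variable {d : ℕ} {Ω : Type*} [MeasurableSpace Ω] [AddAction (Zd d) Ω]
  [MeasurableConstVAdd (Zd d) Ω] {P : Measure Ω} [IsProbabilityMeasure P]
  [VAddInvariantMeasure (Zd d) Ω P] {C : Zd d → Zd d → Ω → ℝ}

lemma cocycle_zero {h : Zd d → Ω → ℝ} (hcoc : ∀ x z ω, h (x + z) ω - h x ω = h z (x +ᵥ ω)) (ω : Ω) :
    h 0 ω = 0 := by
  have := hcoc 0 0 ω
  simpa using this.symm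

/-- Off the origin |h| ≤ h² + |z|² since |z| ≥ 1, so the flux is dominated by the two finite
quadratic sums; at the origin h is zero. -/
lemma integrable_flux (hC : IsConductance P C) (hμ : ∫⁻ ω, muTilde C ω ∂P < ∞)
    {h : Zd d → Ω → ℝ} (hm : ∀ z, AEMeasurable (h z) P) (h0 : ∀ ω, h 0 ω = 0)
    (hfin : covNormSq P C h < ∞) :
    Integrable (fun p : Ω × Zd d => C 0 p.2 p.1 * h p.2 p.1)
      (P.prod (Measure.count : Measure (Zd d))) := by
  have i1 := (memLp_weighted hC.measurable hC.nonneg hm hfin).integrable_sq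
  have i2 := (memLp_weighted (ψ := fun z (_ : Ω) => ‖toEuc z‖) hC.measurable hC.nonneg
    (fun _ => aemeasurable_const) hμ).integrable_sq
  refine (i1.add i2).mono' (aestronglyMeasurable_uncurry (f := fun z ω => C 0 z ω * h z ω)
    fun z => (hC.measurable 0 z).aemeasurable.mul (hm z)) (Eventually.of_forall ?_)
  rintro ⟨ω, z⟩
  have hc := hC.nonneg 0 z ω
  simp only [Pi.add_apply, weighted, mul_pow, Real.sq_sqrt hc, Real.norm_eq_abs, abs_mul,
    abs_of_nonneg hc]
  by_cases hz : z = 0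
  · subst hz
    rw [h0]; simp; positivity
  · have := one_le_norm_toEuc hz
    rw [← mul_add]
    refine mul_le_mul_of_nonneg_left ?_ hc
    rw [← sq_abs (h z ω)]
    nlinarith [abs_nonneg (h z ω), sq_nonneg (|h z ω| - 1)]

/-- Antisymmetry of the flux under the change of variables `(ω, z) ↦ (τ_z ω, -z)`. -/
lemma integral_flux_mul_comp (hC : IsConductance P C) {h : Zd d → Ω → ℝ}
    (hcoc : ∀ x z ω, h (x + z) ω - h x ω = h z (x +ᵥ ω)) {φ : Ω → ℝ}
    (i1 : Integrable (fun p : Ω × Zd d => C 0 p.2 p.1 * h p.2 p.1 * φ (p.2 +ᵥ p.1))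
      (P.prod (Measure.count : Measure (Zd d))))
    (i2 : Integrable (fun p : Ω × Zd d => C 0 p.2 p.1 * h p.2 p.1 * φ p.1)
      (P.prod (Measure.count : Measure (Zd d)))) :
    ∫ p, C 0 p.2 p.1 * h p.2 p.1 * φ (p.2 +ᵥ p.1) ∂(P.prod (Measure.count : Measure (Zd d))) =
      -∫ p, C 0 p.2 p.1 * h p.2 p.1 * φ p.1 ∂(P.prod (Measure.count : Measure (Zd d))) := by
  rw [integral_prod_symm _ i1, integral_prod_symm _ i2,
    integral_countable i1.integral_prod_right, integral_countable i2.integral_prod_right]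
  simp only [measureReal_def, Measure.count_singleton, ENNReal.toReal_one, one_smul]
  rw [← (Equiv.neg (Zd d)).tsum_eq, ← tsum_neg]
  refine tsum_congr fun z => ?_
  have hmp : MeasurePreserving (fun ω => z +ᵥ ω) P P := measurePreserving_vadd z P
  have hme : MeasurableEmbedding fun ω : Ω => z +ᵥ ω := measurableEmbedding_const_vadd z
  rw [← hmp.integral_comp hme, ← integral_neg]
  refine integral_congr_ae (Eventually.of_forall fun ω => ?_)
  have h1 : C 0 (-z) (z +ᵥ ω) = C 0 z ω := by
    rw [← hC.shift, hC.symm]; simp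
  have h2 : h (-z) (z +ᵥ ω) = -h z ω := by
    rw [← hcoc]; simp [cocycle_zero hcoc]
  simp [h1, h2]

/-- A cocycle orthogonal to all gradients is divergence free. -/
lemma ae_hasSum_flux_zero (hC : IsConductance P C) (hμ : ∫⁻ ω, muTilde C ω ∂P < ∞)
    {h : Zd d → Ω → ℝ} (hm : ∀ z, AEMeasurable (h z) P)
    (hcoc : ∀ x z ω, h (x + z) ω - h x ω = h z (x +ᵥ ω)) (hfin : covNormSq P C h < ∞)
    (horth : ∀ φ : Ω → ℝ, MemLp φ ∞ P → ∫ p, C 0 p.2 p.1 * h p.2 p.1 * grad φ p.2 p.1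
      ∂(P.prod (Measure.count : Measure (Zd d))) = 0) :
    ∀ᵐ ω ∂P, HasSum (fun z => C 0 z ω * h z ω) 0 := by
  have iF := integrable_flux hC hμ hm (cocycle_zero hcoc) hfin
  have hV : (fun ω => ∫ z, C 0 z ω * h z ω ∂Measure.count) =ᵐ[P] 0 := by
    -- Testing with the indicator of s: by antisymmetry the two parts of the gradient contribute
    -- equally, so orthogonality forces the divergence to have zero integral over s.
    refine iF.integral_prod_left.ae_eq_zero_of_forall_setIntegral_eq_zero fun s hs _ => ?_
    let φ : Ω → ℝ := s.indicator fun _ => 1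
    have hφm : Measurable φ := measurable_const.indicator hs
    have hφb : ∀ ω, ‖φ ω‖ ≤ 1 := fun ω => by
      by_cases hω : ω ∈ s <;> simp [φ, hω]
    have hφ : MemLp φ ∞ P := memLp_top_of_bound hφm.aestronglyMeasurable 1
      (Eventually.of_forall hφb)
    have i2 : Integrable (fun p : Ω × Zd d => C 0 p.2 p.1 * h p.2 p.1 * φ p.1)
        (P.prod (Measure.count : Measure (Zd d))) :=
      iF.mul_bdd (c := 1) (aestronglyMeasurable_uncurry (f := fun _ ω => φ ω)
        fun _ => hφm.aemeasurable) (Eventually.of_forall fun p => hφb p.1)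
    have i1 : Integrable (fun p : Ω × Zd d => C 0 p.2 p.1 * h p.2 p.1 * φ (p.2 +ᵥ p.1))
        (P.prod (Measure.count : Measure (Zd d))) :=
      iF.mul_bdd (c := 1) (aestronglyMeasurable_uncurry (f := fun z ω => φ (z +ᵥ ω))
        fun z => (hφm.comp (measurable_const_vadd z)).aemeasurable)
        (Eventually.of_forall fun p => hφb _)
    have e := horth φ hφ
    simp only [grad, mul_sub] at e
    rw [integral_sub i1 i2, integral_flux_mul_comp hC hcoc i1 i2] at e
    have e2 : ∫ p, C 0 p.2 p.1 * h p.2 p.1 * φ p.1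
        ∂(P.prod (Measure.count : Measure (Zd d))) = 0 := by linarith
    rw [integral_prod _ i2] at e2
    rw [← integral_indicator hs, ← e2]
    refine integral_congr_ae (Eventually.of_forall fun ω => ?_)
    by_cases hω : ω ∈ s <;> simp [φ, hω]
  filter_upwards [hV, iF.prod_right_ae] with ω h1 h2
  have h3 : Summable fun z => C 0 z ω * h z ω := (integrable_count_iff.1 h2).of_norm
  simp only [Pi.zero_apply] at h1
  rw [integral_countable h2] at h1
  simp only [measureReal_def, Measure.count_singleton, ENNReal.toReal_one, one_smul] at h1
  rw [← h1]
  exact h3.hasSum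

/-- The corrected coordinates are almost surely harmonic. -/
lemma IsCorrector.ae_hasSum_zero (hC : IsConductance P C) (hμ : ∫⁻ ω, muTilde C ω ∂P < ∞)
    (hpos : ∀ᵐ ω ∂P, ∀ i, 0 < C 0 (Pi.single i 1) ω)
    {χ : Zd d → Ω → EuclideanSpace ℝ (Fin d)} (hχ : IsCorrector P C χ) (i : Fin d) :
    ∀ᵐ ω ∂P, ∀ x, HasSum
      (fun y => C x y ω * (((y i : ℝ) + χ y ω i) - ((x i : ℝ) + χ x ω i))) 0 := by
  have hcoc : ∀ (x z : Zd d) ω, (((x + z) i : ℤ) : ℝ) + χ (x + z) ω i - ((x i : ℝ) + χ x ω i) =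
      (z i : ℝ) + χ z (x +ᵥ ω) i := by
    intro x z ω
    rw [← (hχ.isPot i).isCov.cocycle x z ω, Pi.add_apply, Int.cast_add]; ring
  have h1 := ae_hasSum_flux_zero hC hμ (h := fun z ω => (z i : ℝ) + χ z ω i)
    (fun z => ((hχ.isPot i).isCov.aemeasurable z).const_add _) hcoc
    (covNormSq_coord_add_ne_top hC hμ i (hχ.isPot i)).lt_top
    (fun φ hφ => hχ.integral_eq_zero hC hμ hpos i hφ)
  filter_upwards [ae_forall_vadd (d := d) P h1] with ω hω x
  rw [← (Equiv.addLeft x).hasSum_iff]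
  refine (hω x).congr_fun fun z => ?_
  simp only [Function.comp, Equiv.coe_addLeft]
  rw [hcoc, ← hC.shift 0 z x ω, zero_add, add_comm]

end EulerLagrange

/-! ### From moment assumptions to bounds on almost every realization -/

lemma norm_toEuc_single {d : ℕ} (i : Fin d) : ‖toEuc (Pi.single i 1 : Zd d)‖ = 1 := by
  have h : toEuc (Pi.single i 1 : Zd d) = EuclideanSpace.single i (1 : ℝ) := by
    ext j
    by_cases hj : j = i
    · subst hj; simp [toEuc]
    · simp [toEuc, hj]
  rw [h]; simp

lemma norm_le_norm_toEuc {d : ℕ} (z : Zd d) : ‖z‖ ≤ ‖toEuc z‖ := by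
  rw [pi_norm_le_iff_of_nonneg (norm_nonneg _)]
  intro i
  have := PiLp.norm_apply_le (toEuc z) i
  simpa [toEuc, Int.norm_eq_abs] using this

lemma sum_le_toReal_tsum {d : ℕ} {a : Zd d → ℝ≥0∞} (x : Zd d) {g : Zd d → ℝ} (hg : ∀ y, 0 ≤ g y)
    (h : ∀ y, ENNReal.ofReal (g y) ≤ a (y - x)) (hfin : ∑' z, a z ≠ ∞) (Y : Finset (Zd d)) :
    ∑ y ∈ Y, g y ≤ (∑' z, a z).toReal := by
  rw [← ENNReal.ofReal_le_iff_le_toReal hfin, ENNReal.ofReal_sum_of_nonneg fun y _ => hg y,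
    ← (Equiv.subRight x).tsum_eq a]
  exact (Finset.sum_le_sum fun y _ => h y).trans (ENNReal.sum_le_tsum Y)

section Moments

variable {d : ℕ} {Ω : Type*} [MeasurableSpace Ω] [AddAction (Zd d) Ω]

/-- The random variable `μ̃_*` for a finite exponent. -/
noncomputable def starSum (p : ℝ) (C : Zd d → Zd d → Ω → ℝ) (ω : Ω) : ℝ≥0∞ :=
  ∑' z, ENNReal.ofReal (‖toEuc z‖ ^ (d * (2 * p / (p + 1) - 1) + 2 * (2 * p / (p + 1))) *
    C 0 z ω ^ (2 * p / (p + 1)))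

lemma muStar_ofReal {p : ℝ} (hp : 0 < p) (C : Zd d → Zd d → Ω → ℝ) :
    muStar (ENNReal.ofReal p) C = starSum p C := by
  funext ω
  have e : ((d : ℝ) * (p - 1) + 4 * p) / (1 + p) =
      d * (2 * p / (p + 1) - 1) + 2 * (2 * p / (p + 1)) := by field_simp; ring
  simp only [muStar, starSum, starWeight, starPower, ENNReal.ofReal_ne_top, if_false,
    ENNReal.toReal_ofReal hp.le, e]

/-- Termwise interpolation. With F = |z|^{d+2} C_{0,z}, the summand with power s is |z|^{-d} F^s;
the values s = 1 and s = 2 give μ̃ and the p = ∞ version of μ̃_*, and F^s ≤ F + F² for s between 1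
and 2. -/
lemma starSum_le {p : ℝ} (hp : 1 < p) {C : Zd d → Zd d → Ω → ℝ} (hC : ∀ x y ω, 0 ≤ C x y ω)
    (ω : Ω) : starSum p C ω ≤ muTilde C ω + muStar ∞ C ω := by
  unfold starSum muTilde muStar
  rw [← ENNReal.tsum_add]
  refine ENNReal.tsum_le_tsum fun z => ?_
  have hc := hC 0 z ω
  simp only [starWeight, starPower, if_true]
  rw [← ENNReal.ofReal_add (by positivity) (by positivity)]
  refine ENNReal.ofReal_le_ofReal ?_
  set s := 2 * p / (p + 1) with hs
  have hs1 : 1 ≤ s := by rw [hs, le_div_iff₀ (by linarith)]; linarith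
  have hs2 : s ≤ 2 := by rw [hs, div_le_iff₀ (by linarith)]; linarith
  by_cases hz : z = 0
  · have h0 : toEuc (0 : Zd d) = 0 := by ext j; simp [toEuc]
    have hpos : (d : ℝ) * (s - 1) + 2 * s ≠ 0 := by
      have : 0 ≤ (d : ℝ) * (s - 1) := by
        apply mul_nonneg <;> [positivity; linarith]
      linarith
    subst hz
    rw [h0, norm_zero, Real.zero_rpow hpos, zero_mul]
    positivity
  · set r := ‖toEuc z‖ with hr
    have hr0 : 0 < r := by linarith [one_le_norm_toEuc hz]
    set F := r ^ ((d : ℝ) + 2) * C 0 z ω with hF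
    have hF0 : 0 ≤ F := by positivity
    have h1 : F ^ s ≤ F + F ^ (2 : ℝ) := by
      rcases le_total F 1 with h | h
      · calc F ^ s ≤ F ^ (1 : ℝ) := Real.rpow_le_rpow_of_exponent_ge_of_imp hF0 h hs1 (by
              intro _ h'; linarith)
          _ = F := Real.rpow_one F
          _ ≤ _ := le_add_of_nonneg_right (by positivity)
      · exact (Real.rpow_le_rpow_of_exponent_le h hs2).trans (le_add_of_nonneg_left hF0)
    have e : ∀ t : ℝ, r ^ (-(d : ℝ)) * F ^ t = r ^ ((d : ℝ) * (t - 1) + 2 * t) * C 0 z ω ^ t := by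
      intro t
      rw [hF, Real.mul_rpow (by positivity) hc, ← Real.rpow_mul hr0.le, ← mul_assoc,
        ← Real.rpow_add hr0]
      congr 2; ring
    have h2 := mul_le_mul_of_nonneg_left h1 (by positivity : 0 ≤ r ^ (-(d : ℝ)))
    rw [mul_add, e, e] at h2
    have e1 := e 1
    rw [Real.rpow_one, Real.rpow_one] at e1
    rw [e1] at h2
    have e2 : (d : ℝ) * (1 - 1) + 2 * 1 = (2 : ℕ) := by push_cast; ring
    have e3 : (d : ℝ) * (2 - 1) + 2 * 2 = d + 4 := by ring
    rwa [e2, e3, Real.rpow_natCast] at h2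

/-- An infinite exponent is replaced by a large finite one at a loss η in 1/r. A finite exponent is
kept unchanged, because μ̃_* itself depends on p. -/
lemma exists_real_exponent {r : ℝ≥0∞} (hr : 1 < r) {η : ℝ} (hη : 0 < η) :
    ∃ s : ℝ, 1 < s ∧ 1 / s ≤ (1 / r).toReal + η ∧ ENNReal.ofReal s ≤ r ∧
      (r ≠ ∞ → r = ENNReal.ofReal s) := by
  by_cases h : r = ∞
  · refine ⟨1 + 1 / η, by linarith [one_div_pos.2 hη], ?_, by simp [h], fun h' => absurd h h'⟩
    have : 1 / (1 + 1 / η) ≤ η := by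
      rw [div_le_iff₀ (by positivity)]
      have : η * (1 / η) = 1 := by field_simp
      nlinarith
    have h3 : 0 ≤ (1 / r).toReal := ENNReal.toReal_nonneg
    linarith
  · refine ⟨r.toReal, ?_, ?_, (ENNReal.ofReal_toReal h).le, fun _ => (ENNReal.ofReal_toReal h).symm⟩
    · rw [← ENNReal.toReal_one]
      exact (ENNReal.toReal_lt_toReal (by simp) h).2 hr
    · rw [ENNReal.toReal_div]; simp; exact hη.le

lemma lintegral_rpow_lt_top_of_memLp {P : Measure Ω} [IsFiniteMeasure P] {f : Ω → ℝ≥0∞} {r : ℝ≥0∞}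
    (hf : MemLp f r P) {s : ℝ} (hs : 0 < s) (hsr : ENNReal.ofReal s ≤ r) :
    ∫⁻ ω, f ω ^ s ∂P < ∞ := by
  have h := lintegral_rpow_enorm_lt_top_of_eLpNorm_lt_top (by simpa using hs) ENNReal.ofReal_ne_top
    (hf.mono_exponent hsr).2
  simpa [ENNReal.toReal_ofReal hs.le] using h

/-- Reduction of the moment assumptions to finite exponents. -/
lemma exists_real_moments {P : Measure Ω} [IsProbabilityMeasure P] (hd : 0 < d)
    {C : Zd d → Zd d → Ω → ℝ} (hC : IsConductance P C)
    {p q : ℝ≥0∞} (hp : 1 < p) (hq : 1 < q) (hpq : 1 / p + 1 / q < 2 / (d : ℝ≥0∞))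
    (hμ : MemLp (muTilde C) p P) (hν : MemLp (nuTilde C) q P)
    (hμs : MemLp (muStar p C) ((p + 1) / 2) P) :
    ∃ p' q' : ℝ, 1 < p' ∧ 1 < q' ∧ 1 / p' + 1 / q' < 2 / d ∧ ∫⁻ ω, muTilde C ω ^ p' ∂P < ∞ ∧
      ∫⁻ ω, nuTilde C ω ^ q' ∂P < ∞ ∧ ∫⁻ ω, starSum p' C ω ^ ((p' + 1) / 2) ∂P < ∞ := by
  have hd' : (d : ℝ≥0∞) ≠ 0 := by simpa using hd.ne'
  have hpt : 1 / p ≠ ∞ := by simp; exact (zero_lt_one.trans hp).ne'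
  have hqt : 1 / q ≠ ∞ := by simp; exact (zero_lt_one.trans hq).ne'
  have hgap : (1 / p).toReal + (1 / q).toReal < 2 / d := by
    rw [← ENNReal.toReal_add hpt hqt]
    have := (ENNReal.toReal_lt_toReal (ENNReal.add_ne_top.2 ⟨hpt, hqt⟩)
      (ENNReal.div_ne_top (by simp) hd')).2 hpq
    simpa [ENNReal.toReal_div] using this
  -- A third of the gap, so that losing η in each of the two reciprocals preserves the strict
  -- inequality.
  set η := (2 / (d : ℝ) - ((1 / p).toReal + (1 / q).toReal)) / 3 with hη
  have hη0 : 0 < η := by rw [hη]; linarith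
  obtain ⟨p', hp1, hp2, hp3, hp4⟩ := exists_real_exponent hp hη0
  obtain ⟨q', hq1, hq2, hq3, -⟩ := exists_real_exponent hq hη0
  refine ⟨p', q', hp1, hq1, by linarith, lintegral_rpow_lt_top_of_memLp hμ (by linarith) hp3,
    lintegral_rpow_lt_top_of_memLp hν (by linarith) hq3, ?_⟩
  by_cases hpt : p = ∞
  · subst hpt
    have hμs' : MemLp (muStar ∞ C) ∞ P := by
      have : ((∞ : ℝ≥0∞) + 1) / 2 = ∞ := by simp [ENNReal.top_div]
      rwa [this] at hμs
    have hs := hμ.add hμs'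
    have h1 := lintegral_rpow_lt_top_of_memLp hs (s := (p' + 1) / 2) (by linarith) le_top
    refine (lintegral_mono fun ω => ?_).trans_lt h1
    exact ENNReal.rpow_le_rpow (starSum_le hp1 hC.nonneg ω) (by linarith)
  · have e := hp4 hpt
    rw [e, muStar_ofReal (by linarith)] at hμs
    refine lintegral_rpow_lt_top_of_memLp hμs (by linarith) (le_of_eq ?_)
    rw [ENNReal.ofReal_div_of_pos (by norm_num), ENNReal.ofReal_add (by linarith) (by norm_num)]
    simp

end Moments

section MomentBounds

variable {d : ℕ} {Ω : Type*} [MeasurableSpace Ω] [AddAction (Zd d) Ω]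
  [MeasurableConstVAdd (Zd d) Ω] {P : Measure Ω} [IsProbabilityMeasure P]
  [VAddInvariantMeasure (Zd d) Ω P] {C : Zd d → Zd d → Ω → ℝ}

lemma ae_exists_sum_toReal_rpow_le {h : Ω → ℝ≥0∞} (hh : AEMeasurable h P) {r : ℝ}
    (hint : ∫⁻ ω, h ω ^ r ∂P < ∞) :
    ∀ᵐ ω ∂P, ∃ κ : ℝ, 0 ≤ κ ∧ ∀ n : ℕ, 1 ≤ n →
      ∑ x ∈ cube d n, (h (x +ᵥ ω)).toReal ^ r ≤ κ * (n : ℝ) ^ d := by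
  filter_upwards [ae_exists_forall_sum_cube_le (d := d) P (hh.pow_const r) hint.ne]
    with ω ⟨κ, hκ, hω⟩
  refine ⟨κ.toReal, ENNReal.toReal_nonneg, fun n hn => ?_⟩
  have h1 := hω n hn
  have hfin : κ * (n : ℝ≥0∞) ^ d ≠ ∞ := by finiteness
  have hsum : ∀ x ∈ cube d n, h (x +ᵥ ω) ^ r ≠ ∞ :=
    ENNReal.sum_ne_top.1 (ne_top_of_le_ne_top hfin h1)
  simp_rw [ENNReal.toReal_rpow]
  rw [← ENNReal.toReal_sum hsum]
  refine (ENNReal.toReal_mono hfin h1).trans (le_of_eq ?_)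
  simp

lemma ae_ne_top_of_lintegral_rpow {h : Ω → ℝ≥0∞} (hh : AEMeasurable h P) {r : ℝ} (hr : 0 < r)
    (hint : ∫⁻ ω, h ω ^ r ∂P < ∞) : ∀ᵐ ω ∂P, ∀ x : Zd d, h (x +ᵥ ω) ≠ ∞ := by
  refine ae_forall_vadd (d := d) P (p := fun ω => h ω ≠ ∞) ?_
  filter_upwards [ae_lt_top' (hh.pow_const r) hint.ne] with ω hω h'
  rw [h', ENNReal.top_rpow_of_pos hr] at hω
  exact lt_irrefl _ hω

lemma one_le_mul_of_inv_le {a : ℝ≥0∞} (ha : a ≠ ∞) {c : ℝ} (h : (ENNReal.ofReal c)⁻¹ ≤ a) :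
    1 ≤ a.toReal * c := by
  have hc : 0 < c := by
    by_contra! hc
    rw [ENNReal.ofReal_of_nonpos hc, ENNReal.inv_zero] at h
    exact ha (top_le_iff.1 h)
  have h2 := ENNReal.toReal_mono ha h
  rw [ENNReal.toReal_inv, ENNReal.toReal_ofReal hc.le] at h2
  calc 1 = c⁻¹ * c := by field_simp
    _ ≤ _ := by gcongr

lemma inv_le_nuTilde (C : Zd d → Zd d → Ω → ℝ) (i : Fin d) (ω : Ω) :
    (ENNReal.ofReal (C 0 (Pi.single i 1) ω))⁻¹ ≤ nuTilde C ω :=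
  ENNReal.le_tsum (f := fun z : {z : Zd d // ‖toEuc z‖ = 1} => (ENNReal.ofReal (C 0 z ω))⁻¹)
    ⟨Pi.single i 1, norm_toEuc_single i⟩

lemma aemeasurable_starSum (hC : IsConductance P C) (p : ℝ) : AEMeasurable (starSum p C) P :=
  AEMeasurable.tsum fun z => (((hC.measurable 0 z).pow_const _).const_mul _).ennreal_ofReal.aemeasurable

lemma aemeasurable_muTilde (hC : IsConductance P C) : AEMeasurable (muTilde C) P :=
  AEMeasurable.tsum fun z => ((hC.measurable 0 z).const_mul _).ennreal_ofReal.aemeasurable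

lemma IsConductance.eq_zero_vadd (hC : IsConductance P C) (x y : Zd d) (ω : Ω) :
    C x y ω = C 0 (y - x) (x +ᵥ ω) := by
  rw [← hC.shift]; simp

/-- Almost every realization of the conductances satisfies the deterministic moment bounds. -/
theorem ae_exists_hasMomentBounds (hC : IsConductance P C) {p q : ℝ} (hp : 1 < p) (hq : 1 < q)
    (hνm : AEMeasurable (nuTilde C) P) (hμ : ∫⁻ ω, muTilde C ω ^ p ∂P < ∞)
    (hν : ∫⁻ ω, nuTilde C ω ^ q ∂P < ∞) (hs : ∫⁻ ω, starSum p C ω ^ ((p + 1) / 2) ∂P < ∞) :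
    ∀ᵐ ω ∂P, ∃ (κ : ℝ) (μ ν M : Zd d → ℝ), 0 ≤ κ ∧
      HasMomentBounds p q κ (fun x y => C x y ω) μ ν M := by
  set s := 2 * p / (p + 1) with hsdef
  have hs0 : 0 < s := by positivity
  have hμm := aemeasurable_muTilde hC
  have hsm := aemeasurable_starSum hC p
  -- The long-jump bound uses the s-th root of μ̃_*, and p / s = (p + 1) / 2: its p-th moment is the
  -- assumed moment.
  have hs' : ∫⁻ ω, (starSum p C ω ^ s⁻¹) ^ p ∂P < ∞ := by
    refine lt_of_eq_of_lt (lintegral_congr fun ω => ?_) hs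
    rw [← ENNReal.rpow_mul]
    congr 1
    rw [hsdef]; field_simp
  filter_upwards [ae_ne_top_of_lintegral_rpow (d := d) hμm (by linarith) hμ,
    ae_ne_top_of_lintegral_rpow (d := d) hνm (by linarith) hν,
    ae_ne_top_of_lintegral_rpow (d := d) hsm (by linarith) hs,
    ae_exists_sum_toReal_rpow_le (d := d) hμm hμ,
    ae_exists_sum_toReal_rpow_le (d := d) hνm hν,
    ae_exists_sum_toReal_rpow_le (d := d) (hsm.pow_const s⁻¹) hs']
    with ω f1 f2 f3 ⟨κ₁, hκ₁, g1⟩ ⟨κ₂, hκ₂, g2⟩ ⟨κ₃, hκ₃, g3⟩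
  have mono : ∀ κ, κ ≤ κ₁ + κ₂ + κ₃ → ∀ (n : ℕ), κ * (n : ℝ) ^ d ≤ (κ₁ + κ₂ + κ₃) * (n : ℝ) ^ d :=
    fun κ h n => mul_le_mul_of_nonneg_right h (by positivity)
  refine ⟨κ₁ + κ₂ + κ₃, fun x => (muTilde C (x +ᵥ ω)).toReal, fun x => (nuTilde C (x +ᵥ ω)).toReal,
    fun x => (starSum p C (x +ᵥ ω) ^ s⁻¹).toReal, by positivity, ?_⟩
  constructor
  case nonneg => exact fun x y => hC.nonneg x y ω
  case symm => exact fun x y => hC.symm x y ω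
  case ν_nonneg => exact fun x => ENNReal.toReal_nonneg
  case M_nonneg => exact fun x => ENNReal.toReal_nonneg
  case one_le =>
    intro x i
    refine one_le_mul_of_inv_le (f2 x) ?_
    rw [hC.eq_zero_vadd x, add_sub_cancel_left]
    exact inv_le_nuTilde C i _
  case sum_ν => exact fun n hn => (g2 n hn).trans (mono _ (by linarith) n)
  case sum_μ => exact fun n hn => (g1 n hn).trans (mono _ (by linarith) n)
  case sum_M => exact fun n hn => (g3 n hn).trans (mono _ (by linarith) n)
  case sum_le_μ =>
    intro x Y
    refine sum_le_toReal_tsum x (fun y => mul_nonneg (by positivity) (hC.nonneg _ _ _))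
      (fun y => ?_) (f1 x) Y
    rw [hC.eq_zero_vadd x y]
    refine ENNReal.ofReal_le_ofReal (mul_le_mul_of_nonneg_right ?_ (hC.nonneg _ _ _))
    gcongr
    exact norm_le_norm_toEuc _
  case sum_le_M =>
    intro x Y
    rw [ENNReal.toReal_rpow, ← hsdef, ENNReal.rpow_inv_rpow hs0.ne']
    have hs1 : 1 ≤ s := by rw [hsdef, le_div_iff₀ (by linarith)]; linarith
    have hw : 0 ≤ (d : ℝ) * (s - 1) + 2 * s := by
      have : 0 ≤ (d : ℝ) * (s - 1) := mul_nonneg (by positivity) (by linarith)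
      linarith
    refine sum_le_toReal_tsum x (fun y => mul_nonneg (by positivity)
      (Real.rpow_nonneg (hC.nonneg _ _ _) _)) (fun y => ?_) (f3 x) Y
    rw [hC.eq_zero_vadd x y]
    refine ENNReal.ofReal_le_ofReal (mul_le_mul_of_nonneg_right ?_
      (Real.rpow_nonneg (hC.nonneg _ _ _) _))
    exact Real.rpow_le_rpow (norm_nonneg _) (norm_le_norm_toEuc _) hw

end MomentBounds

/-! ### Energy approximation of the corrector and conclusion -/

section Sublinearity

variable {d : ℕ} {Ω : Type*} [MeasurableSpace Ω] [AddAction (Zd d) Ω]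
  [MeasurableConstVAdd (Zd d) Ω] {P : Measure Ω} [IsProbabilityMeasure P]
  [VAddInvariantMeasure (Zd d) Ω P] {C : Zd d → Zd d → Ω → ℝ}

lemma ofReal_edgeEnergy_le (hC : IsConductance P C) {g : Zd d → Ω → ℝ}
    (hcoc : ∀ x z ω, g (x + z) ω - g x ω = g z (x +ᵥ ω)) (x : Zd d) (ω : Ω) :
    ENNReal.ofReal (edgeEnergy (fun x y => C x y ω) (fun y => g y ω) x) ≤
      ∑' z, ENNReal.ofReal (g z (x +ᵥ ω) ^ 2 * C 0 z (x +ᵥ ω)) := by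
  unfold edgeEnergy
  rw [ENNReal.ofReal_sum_of_nonneg fun i _ => mul_nonneg (hC.nonneg _ _ _) (sq_nonneg _)]
  have hinj : Function.Injective fun i : Fin d => (Pi.single i 1 : Zd d) := by
    intro i j hij
    by_contra h
    have := congrFun hij i
    simp [h] at this
  calc ∑ i, ENNReal.ofReal (C x (x + Pi.single i 1) ω *
        (g (x + Pi.single i 1) ω - g x ω) ^ 2)
      = ∑ i, ENNReal.ofReal (g (Pi.single i 1) (x +ᵥ ω) ^ 2 * C 0 (Pi.single i 1) (x +ᵥ ω)) := by
        refine Finset.sum_congr rfl fun i _ => ?_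
        rw [hcoc, hC.eq_zero_vadd x, add_sub_cancel_left, mul_comm]
    _ = ∑' i : Fin d,
        ENNReal.ofReal (g (Pi.single i 1) (x +ᵥ ω) ^ 2 * C 0 (Pi.single i 1) (x +ᵥ ω)) :=
        (tsum_fintype _).symm
    _ ≤ _ := ENNReal.tsum_comp_le_tsum_of_injective hinj
        fun z => ENNReal.ofReal (g z (x +ᵥ ω) ^ 2 * C 0 z (x +ᵥ ω))

lemma aemeasurable_tsum_sq_mul (hC : IsConductance P C) {g : Zd d → Ω → ℝ}
    (hg : ∀ z, AEMeasurable (g z) P) :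
    AEMeasurable (fun ω => ∑' z, ENNReal.ofReal (g z ω ^ 2 * C 0 z ω)) P :=
  AEMeasurable.tsum fun z =>
    (((hg z).pow_const 2).mul (hC.measurable 0 z).aemeasurable).ennreal_ofReal

/-- Almost surely an element of `L²_pot` is approximated by bounded functions, with a small
Dirichlet energy of the difference on all cubes. -/
lemma IsPot.ae_exists_approx (hC : IsConductance P C) {ψ : Zd d → Ω → ℝ} (hψ : IsPot P C ψ) :
    ∀ᵐ ω ∂P, ∀ δ : ℝ, 0 < δ → ∃ (b : Zd d → ℝ) (B : ℝ), (∀ x, |b x| ≤ B) ∧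
      ∀ n : ℕ, 1 ≤ n → ∑ x ∈ cube d n,
        edgeEnergy (fun x y => C x y ω) (fun y => ψ y ω - b y) x ≤ δ * (n : ℝ) ^ d := by
  have hlam : ∀ j : ℕ, (2⁻¹ : ℝ≥0∞) ^ j ≠ 0 := fun j => by simp
  -- Squared errors below 4^{-j} against thresholds 2^{-j} leave the summable ratio 2^{-j} for
  -- Borel–Cantelli, while the thresholds still tend to zero.
  have hex : ∀ j : ℕ, ∃ φ : Ω → ℝ, MemLp φ ∞ P ∧
      covNormSq P C (fun x ω => ψ x ω - grad φ x ω) < (2⁻¹ : ℝ≥0∞) ^ j * (2⁻¹ : ℝ≥0∞) ^ j :=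
    fun j => hψ.approx _ (by simp [pos_iff_ne_zero])
  choose φ hφ hφlt using hex
  have hm : ∀ j z, AEMeasurable (fun ω => ψ z ω - grad (φ j) z ω) P := fun j z =>
    (hψ.isCov.aemeasurable z).sub (aemeasurable_grad (hφ j).1.aemeasurable z)
  have hev := ae_eventually_sum_cube_le (d := d) P
    (h := fun j ω => ∑' z, ENNReal.ofReal ((ψ z ω - grad (φ j) z ω) ^ 2 * C 0 z ω))
    (fun j => aemeasurable_tsum_sq_mul hC (hm j))
    (lam := fun j => (2⁻¹ : ℝ≥0∞) ^ j) hlam (fun j => by finiteness) (by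
      refine ne_top_of_le_ne_top (b := ∑' j : ℕ, (2⁻¹ : ℝ≥0∞) ^ j) ?_
        (ENNReal.tsum_le_tsum fun j => ?_)
      · rw [ENNReal.tsum_geometric]; simp
      · exact ENNReal.div_le_of_le_mul (hφlt j).le)
  have hbd : ∀ j, ∃ B : ℝ, 0 ≤ B ∧ ∀ᵐ ω ∂P, |φ j ω| ≤ B := fun j => ae_bounded_of_memLp_top (hφ j)
  choose B hB0 hB using hbd
  filter_upwards [hev, ae_forall_vadd (d := d) P (ae_all_iff.2 hB)] with ω h1 h2 δ hδ
  have hsmall : ∀ᶠ j : ℕ in atTop, (2⁻¹ : ℝ) ^ j * 3 ^ d < δ := by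
    have : Tendsto (fun j : ℕ => (2⁻¹ : ℝ) ^ j * 3 ^ d) atTop (𝓝 (0 * 3 ^ d)) :=
      (tendsto_pow_atTop_nhds_zero_of_lt_one (by norm_num) (by norm_num)).mul_const _
    rw [zero_mul] at this
    exact this.eventually_lt_const hδ
  obtain ⟨j, hj1, hj2⟩ := (h1.and hsmall).exists
  refine ⟨fun x => grad (φ j) x ω, 2 * B j, fun x => ?_, fun n hn => ?_⟩
  · have e1 := h2 x j
    have e2 := h2 0 j
    rw [zero_vadd] at e2
    have := abs_sub (φ j (x +ᵥ ω)) (φ j ω)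
    unfold grad
    linarith
  · have hcoc : ∀ (x z : Zd d) ω, (ψ (x + z) ω - grad (φ j) (x + z) ω) -
        (ψ x ω - grad (φ j) x ω) = ψ z (x +ᵥ ω) - grad (φ j) z (x +ᵥ ω) := fun x z ω => by
      rw [← hψ.isCov.cocycle, ← grad_cocycle]; ring
    have h3 : ENNReal.ofReal (∑ x ∈ cube d n,
        edgeEnergy (fun x y => C x y ω) (fun y => ψ y ω - grad (φ j) y ω) x) ≤
        (2⁻¹ : ℝ≥0∞) ^ j * ((2 * n + 1) ^ d : ℕ) := by
      rw [ENNReal.ofReal_sum_of_nonneg fun x _ => edgeEnergy_nonneg (fun x y => hC.nonneg x y ω) _ _]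
      exact (Finset.sum_le_sum fun x _ => ofReal_edgeEnergy_le hC
        (g := fun z ω => ψ z ω - grad (φ j) z ω) hcoc x ω).trans (hj1 n)
    rw [ENNReal.ofReal_le_iff_le_toReal (by finiteness)] at h3
    have hn' : (1 : ℝ) ≤ n := by exact_mod_cast hn
    calc _ ≤ _ := h3
      _ = (2⁻¹ : ℝ) ^ j * (2 * n + 1 : ℝ) ^ d := by
          rw [ENNReal.toReal_mul, ENNReal.toReal_natCast, ENNReal.toReal_pow, ENNReal.toReal_inv,
            ENNReal.toReal_ofNat]
          push_cast
          rfl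
      _ ≤ (2⁻¹ : ℝ) ^ j * (3 * n : ℝ) ^ d := by gcongr; linarith
      _ = (2⁻¹ : ℝ) ^ j * 3 ^ d * (n : ℝ) ^ d := by rw [mul_pow]; ring
      _ ≤ _ := by gcongr

/-- Everywhere sublinearity of the corrector in terms of cubes. -/
lemma IsCorrector.ae_forall_abs_le (hd : 0 < d) (hC : IsConductance P C) {p q : ℝ} (hp : 1 < p)
    (hq : 1 < q) (hpq : 1 / p + 1 / q < 2 / d) (hνm : AEMeasurable (nuTilde C) P)
    (hμ1 : ∫⁻ ω, muTilde C ω ∂P < ∞) (hμ : ∫⁻ ω, muTilde C ω ^ p ∂P < ∞)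
    (hν : ∫⁻ ω, nuTilde C ω ^ q ∂P < ∞) (hs : ∫⁻ ω, starSum p C ω ^ ((p + 1) / 2) ∂P < ∞)
    (hpos : ∀ᵐ ω ∂P, ∀ i, 0 < C 0 (Pi.single i 1) ω)
    {χ : Zd d → Ω → EuclideanSpace ℝ (Fin d)} (hχ : IsCorrector P C χ) :
    ∀ᵐ ω ∂P, ∀ ε : ℝ, 0 < ε → ∃ N : ℕ, ∀ n : ℕ, N ≤ n → ∀ x ∈ cube d n, ∀ i, |χ x ω i| ≤ ε * n := by
  filter_upwards [ae_exists_hasMomentBounds hC hp hq hνm hμ hν hs,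
    ae_all_iff.2 fun i => hχ.ae_hasSum_zero hC hμ1 hpos i,
    ae_all_iff.2 fun i => (hχ.isPot i).ae_exists_approx hC]
    with ω ⟨κ, μ, ν, M, hκ, hb⟩ hharm happ ε hε
  -- The deterministic bound is stated for ε ≤ 1, hence the minimum. The coordinate function is
  -- 1-Lipschitz for the sup norm.
  have key : ∀ i, ∃ N : ℕ, ∀ n : ℕ, N ≤ n → ∀ x ∈ cube d n, |χ x ω i| ≤ min ε 1 * n := fun i =>
    exists_forall_abs_le_of_harmonic hd hp hq hκ hpq hb (f := fun x => χ x ω i)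
      (l := fun x => (x i : ℝ)) (fun x y => by
        have := norm_le_pi_norm (y - x) i
        rw [Int.norm_eq_abs, Pi.sub_apply] at this
        exact_mod_cast this) (hharm i) (happ i) (lt_min hε one_pos) (min_le_right _ _)
  choose N hN using key
  refine ⟨Finset.univ.sup N, fun n hn x hx i => ?_⟩
  refine (hN i n ((Finset.le_sup (Finset.mem_univ i)).trans hn) x hx).trans ?_
  gcongr
  exact min_le_left _ _

lemma norm_le_sum_abs (v : EuclideanSpace ℝ (Fin d)) : ‖v‖ ≤ ∑ i, |v i| := by
  have h : v = ∑ i, v i • EuclideanSpace.single i (1 : ℝ) := by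
    ext j
    simp [Finset.sum_apply, Pi.single_apply]
  conv_lhs => rw [h]
  refine (norm_sum_le _ _).trans (le_of_eq ?_)
  simp [norm_smul]

lemma tendsto_iSup_ball_of_forall {g : Zd d → EuclideanSpace ℝ (Fin d)}
    (h : ∀ ε : ℝ, 0 < ε → ∃ N : ℕ, ∀ n : ℕ, N ≤ n → ∀ x ∈ cube d n, ∀ i, |g x i| ≤ ε * n) :
    Tendsto (fun n : ℕ => (1 / (n : ℝ)) * ⨆ x : ball d n, ‖g x‖) atTop (𝓝 0) := by
  rw [Metric.tendsto_atTop]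
  intro ε hε
  obtain ⟨N, hN⟩ := h (ε / (d + 1)) (by positivity)
  refine ⟨max N 1, fun n hn => ?_⟩
  have hn1 : (0 : ℝ) < n := by exact_mod_cast (le_of_max_le_right hn)
  have h1 : ⨆ x : ball d n, ‖g x‖ ≤ d * (ε / (d + 1) * n) := by
    refine Real.iSup_le (fun x => ?_) (by positivity)
    have hx : (x : Zd d) ∈ cube d n := mem_cube_iff_norm.2 ((norm_le_norm_toEuc _).trans x.2)
    refine (norm_le_sum_abs _).trans ?_
    refine (Finset.sum_le_sum fun i _ => hN n (le_of_max_le_left hn) x hx i).trans (le_of_eq ?_)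
    simp
  have h0 : 0 ≤ ⨆ x : ball d n, ‖g x‖ := Real.iSup_nonneg fun _ => norm_nonneg _
  rw [Real.dist_eq, sub_zero, abs_of_nonneg (by positivity)]
  calc 1 / (n : ℝ) * ⨆ x : ball d n, ‖g x‖ ≤ 1 / (n : ℝ) * (d * (ε / (d + 1) * n)) := by gcongr
    _ = ε * (d / (d + 1)) := by field_simp
    _ < ε * 1 := by
        gcongr
        rw [div_lt_one (by positivity)]; linarith
    _ = ε := mul_one ε

end Sublinearity

end RandomConductance

theorem theorem1p4 {d : ℕ} (hd : 2 ≤ d)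
    {Ω : Type*} [MeasurableSpace Ω] (P : Measure Ω) [IsProbabilityMeasure P]
    [AddAction (RandomConductance.Zd d) Ω]
    [MeasurableConstVAdd (RandomConductance.Zd d) Ω]
    [ErgodicVAdd (RandomConductance.Zd d) Ω P]
    (C : RandomConductance.Zd d → RandomConductance.Zd d → Ω → ℝ)
    (hC : RandomConductance.IsConductance P C)
    (p q : ℝ≥0∞) (hp : 1 < p) (hq : 1 < q) (hpq : 1 / p + 1 / q < 2 / (d : ℝ≥0∞))
    (hμ : MemLp (RandomConductance.muTilde C) p P)
    (hν : MemLp (RandomConductance.nuTilde C) q P)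
    (hμs : MemLp (RandomConductance.muStar p C) ((p + 1) / 2) P) :
    (∃ χ, RandomConductance.IsCorrector P C χ) ∧
    ∀ χ, RandomConductance.IsCorrector P C χ →
      ∀ᵐ ω ∂P, Tendsto
        (fun n : ℕ => (1 / (n : ℝ)) * ⨆ x : RandomConductance.ball d n, ‖χ x ω‖)
        atTop (𝓝 0) := by
  have hd0 : 0 < d := by omega
  obtain ⟨p', q', hp', hq', hpq', hμ', hν', hs'⟩ :=
    RandomConductance.exists_real_moments hd0 hC hp hq hpq hμ hν hμs
  have hμ1 : ∫⁻ ω, RandomConductance.muTilde C ω ∂P < ∞ := by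
    simpa using RandomConductance.lintegral_rpow_lt_top_of_memLp hμ one_pos (by simpa using hp.le)
  -- Finiteness of ν̃ almost surely excludes vanishing nearest-neighbour conductances, by the
  -- convention 1/0 = ∞.
  have hpos : ∀ᵐ ω ∂P, ∀ i, 0 < C 0 (Pi.single i 1) ω := by
    filter_upwards [RandomConductance.ae_ne_top_of_lintegral_rpow (d := d) hν.1.aemeasurable
      (by linarith) hν'] with ω hω i
    have h0 := hω 0
    rw [zero_vadd] at h0
    have h := RandomConductance.one_le_mul_of_inv_le h0 (RandomConductance.inv_le_nuTilde C i ω)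
    exact pos_of_mul_pos_right (one_pos.trans_le h) ENNReal.toReal_nonneg
  refine ⟨RandomConductance.exists_isCorrector hC hμ1 hpos, fun χ hχ => ?_⟩
  filter_upwards [hχ.ae_forall_abs_le hd0 hC hp' hq' hpq' hν.1.aemeasurable hμ1 hμ' hν' hs' hpos]
    with ω hω
  exact RandomConductance.tendsto_iSup_ball_of_forall (g := fun x => χ x ω) hω
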